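/- Let $m,N\in\mathbb N$ ($m,N\ge 1$) with $N+1\ge m$, let $h=1/N$, and let $\omega\in\mathbb R$ with $\omega h\notin\mathbb Z$. Let $L_2^{(m)}[0,1]$ be the space of functions $\varphi:[0,1]\to\mathbb C$ whose derivative of order $m-1$ is absolutely continuous and whose derivative of order $m$ is square integrable, with the (semi)norm $\|\varphi\|=\bigl(\int_0^1|\varphi^{(m)}(x)|^2\,dx\bigr)^{1/2}$. For $C=(C_0,\dots,C_N)\in\mathbb C^{N+1}$ let $$(\ell,\varphi)=\int_0^1 e^{2\pi i\omega x}\varphi(x)\,dx-\sum_{\beta=0}^N C_\beta\varphi(h\beta),\qquad \|\ell\|=\sup_{\|\varphi\|\le 1}|(\ell,\varphi)| .$$ Call $C$ optimal in the sense of Sard if $(\ell,x^\alpha)=0$ for $\alpha=0,\dots,m-1$ and $\|\ell\|$ is minimal among all coefficient vectors satisfying these conditions. Let $E_k$ be the Euler–Frobenius polynomials, $$E_k(x)=\frac{(1-x)^{k+2}}{x}\Bigl(x\frac{d}{dx}\Bigr)^k\frac{x}{(1-x)^2},$$ and let $\Delta^i0^j=\sum_{l=1}^i(-1)^{i-l}\binom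 il l^j$. Then $E_{2m-2}$ has degree $2m-2$ with coefficients $\mathrm a_\alpha=\sum_{j=0}^{\alpha}(-1)^j\binom{2m}{j}(\alpha+1-j)^{2m-1}$ ($0\le\alpha\le 2m-2$), and it has exactly $m-1$ distinct complex roots $q_1,\dots,q_{m-1}$ with $|q_k|<1$. Put $$K=K_{\omega,m}=\left(\frac{\sin\pi\omega h}{\pi\omega h}\right)^{2m}\frac{(2m-1)!}{2\sum_{\alpha=0}^{m-2}\mathrm a_\alpha\cos[2\pi\omega h(m-1-\alpha)]+\mathrm a_{m-1}} .$$ The following system of $2m-2$ linear equations in $a_1,\dots,a_{m-1},b_1,\dots,b_{m-1}\in\mathbb C$, where $j=1,\dots,m-1$ in both families, has exactly one solution: $$\sum_{k=1}^{m-1}a_k\sum_{t=1}^{j}\frac{q_k\Delta^t0^j}{(q_k-1)^{t+1}}+\sum_{k=1}^{m-1}b_k\sum_{t=1}^j\frac{q_k^{N+t}\Delta^t0^{j}}{(1-q_k)^{t+1}}=\frac{j!}{(2\pi i\omega h)^{j+1}}-\sum_{t=1}^j\frac{e^{2\pi i\omega h}K\Delta^t0^j}{(e^{2\pi i\omega h}-1)^{t+1}},$$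 $$\begin{aligned}&\sum_{k=1}^{m-1}a_k\Bigl[\sum_{t=1}^j\frac{q_k^t\Delta^t0^j}{(1-q_k)^{t+1}}-\sum_{\alpha=1}^{j}h^{\alpha-j}\tbinom j\alpha\sum_{t=1}^{\alpha}\frac{q_k^{N+t}\Delta^t0^{\alpha}}{(1-q_k)^{t+1}}\Bigr]\\&\quad+\sum_{k=1}^{m-1}b_k\Bigl[\sum_{t=1}^j\frac{q_k^{N+1}\Delta^t0^j}{(q_k-1)^{t+1}}-\sum_{\alpha=1}^{j}h^{\alpha-j}\tbinom j\alpha\sum_{t=1}^{\alpha}\frac{q_k\Delta^t0^{\alpha}}{(q_k-1)^{t+1}}\Bigr]\\&=\frac{(-1)^{j+1}j!}{(2\pi i\omega h)^{j+1}}+\sum_{\alpha=1}^{j}h^{\alpha-j}\frac{(-1)^{\alpha}j!\,e^{2\pi i\omega}}{(j-\alpha)!(2\pi i\omega h)^{\alpha+1}}-\frac{K}{1-e^{2\pi i\omega h}}\sum_{t=1}^j\Bigl(\frac{e^{2\pi i\omega h}}{1-e^{2\pi i\omega h}}\Bigr)^t\Delta^t0^j\\&\quad+\frac{K e^{2\pi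 i\omega}}{1-e^{2\pi i\omega h}}\sum_{\alpha=1}^{j}h^{\alpha-j}\tbinom j\alpha\sum_{t=1}^{\alpha}\Bigl(\frac{e^{2\pi i\omega h}}{1-e^{2\pi i\omega h}}\Bigr)^t\Delta^t0^\alpha .\end{aligned}$$ With this solution, the Sard-optimal coefficients exist, are unique, and are $$\mathring C_0=h\Bigl(\frac{e^{2\pi i\omega h}K}{e^{2\pi i\omega h}-1}-\frac1{2\pi i\omega h}+\sum_{k=1}^{m-1}\Bigl(a_k\frac{q_k}{q_k-1}+b_k\frac{q_k^N}{1-q_k}\Bigr)\Bigr),$$ $$\mathring C_\beta=h\Bigl(e^{2\pi i\omega h\beta}K+\sum_{k=1}^{m-1}\bigl(a_kq_k^\beta+b_kq_k^{N-\beta}\bigr)\Bigr),\qquad \beta=1,\dots,N-1,$$ $$\mathring C_N=h\Bigl(\frac{e^{2\pi i\omega}K}{1-e^{2\pi i\omega h}}+\frac{e^{2\pi i\omega}}{2\pi i\omega h}+\sum_{k=1}^{m-1}\Bigl(a_k\frac{q_k^N}{1-q_k}+b_k\frac{q_k}{q_k-1}\Bigr)\Bigr).$$ -/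

import Mathlib

open MeasureTheory Set
open scoped BigOperators ENNReal

namespace SardFourier

noncomputable section

/-! ### The Sobolev space `L₂^{(m)}[0,1]` and Sard's optimization problem -/

/-- The derivative `φ^{(k)}` on the interval `[0,1]` (one-sided at the end points). -/
def intervalDeriv (k : ℕ) (φ : ℝ → ℂ) : ℝ → ℂ :=
  iteratedDerivWithin k φ (Icc (0 : ℝ) 1)

/-- Membership in `L₂^{(m)}[0,1]`, for `m ≥ 1`: `φ` has an absolutely continuous derivative of
order `m - 1` on `[0,1]`, and its derivative of order `m`, which then exists almost everywhere,
is square integrable. Only the values of `φ` on `[0,1]` matter. -/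
structure MemSobolev (m : ℕ) (φ : ℝ → ℂ) : Prop where
  contDiffOn : ContDiffOn ℝ ((m - 1 : ℕ) : WithTop ℕ∞) φ (Icc (0 : ℝ) 1)
  absolutelyContinuous : AbsolutelyContinuousOnInterval (intervalDeriv (m - 1) φ) 0 1
  memLp : MemLp (intervalDeriv m φ) 2 (volume.restrict (Icc (0 : ℝ) 1))

/-- The (semi)norm `‖φ‖ = (∫₀¹ |φ^{(m)}(x)|² dx)^{1/2}` of `L₂^{(m)}[0,1]`. -/
def sobolevNorm (m : ℕ) (φ : ℝ → ℂ) : ℝ :=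
  Real.sqrt (∫ x in (0 : ℝ)..1, ‖intervalDeriv m φ x‖ ^ 2)

/-- The step `h = 1 / N`. -/
def step (N : ℕ) : ℝ := 1 / (N : ℝ)

/-- The error `(ℓ, φ) = ∫₀¹ e^{2πiωx} φ(x) dx - ∑_{β=0}^N C_β φ(hβ)`. -/
def errorFunctional (N : ℕ) (ω : ℝ) (C : Fin (N + 1) → ℂ) (φ : ℝ → ℂ) : ℂ :=
  (∫ x in (0 : ℝ)..1, Complex.exp (2 * Real.pi * Complex.I * ω * x) * φ x)
    - ∑ β : Fin (N + 1), C β * φ (step N * (β : ℕ))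

/-- The norm `‖ℓ‖` of the error functional in the conjugate space `L₂^{(m)*}[0,1]`. -/
def errorNorm (m N : ℕ) (ω : ℝ) (C : Fin (N + 1) → ℂ) : ℝ≥0∞ :=
  ⨆ (φ : ℝ → ℂ) (_ : MemSobolev m φ) (_ : sobolevNorm m φ ≤ 1), ‖errorFunctional N ω C φ‖ₑ

/-- The conditions `(ℓ, x^α) = 0`, `α = 0, …, m - 1`, under which `ℓ` is a functional on
`L₂^{(m)}[0,1]`. -/
def IsExact (m N : ℕ) (ω : ℝ) (C : Fin (N + 1) → ℂ) : Prop :=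
  ∀ α : ℕ, α < m → errorFunctional N ω C (fun x => (x : ℂ) ^ α) = 0

/-- `C` are optimal coefficients in the sense of Sard. -/
def IsSardOptimal (m N : ℕ) (ω : ℝ) (C : Fin (N + 1) → ℂ) : Prop :=
  IsExact m N ω C ∧
    errorNorm m N ω C = ⨅ (C' : Fin (N + 1) → ℂ) (_ : IsExact m N ω C'), errorNorm m N ω C'

/-! ### Euler–Frobenius polynomials -/

/-- The Euler–Frobenius polynomial `E_k`, by the recursion that the formula
`E_k(x) = (1-x)^{k+2} / x * (x d/dx)^k (x / (1-x)^2)` amounts to;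
`eulerFrobenius_eq` below is this formula. -/
def eulerFrobenius : ℕ → Polynomial ℤ
  | 0 => 1
  | k + 1 =>
    (1 + ((k : Polynomial ℤ) + 1) * Polynomial.X) * eulerFrobenius k
      + Polynomial.X * (1 - Polynomial.X) * Polynomial.derivative (eulerFrobenius k)

/-- The operator `x d/dx`. -/
def eulerOp (f : ℂ → ℂ) : ℂ → ℂ := fun x => x * deriv f x

theorem eulerOp_iterate (k : ℕ) : ∀ x : ℂ, x ≠ 1 →
    (eulerOp^[k] (fun y => y / (1 - y) ^ 2)) x
      = x * Polynomial.aeval x (eulerFrobenius k) / (1 - x) ^ (k + 2) := by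
  induction k with
  | zero => intro x _; simp [eulerFrobenius]
  | succ k ih =>
    intro x hx
    have hx' : (1 - x) ≠ 0 := sub_ne_zero.mpr (Ne.symm hx)
    rw [Function.iterate_succ_apply']
    have hev : (eulerOp^[k] (fun y => y / (1 - y) ^ 2)) =ᶠ[nhds x]
        fun y => y * Polynomial.aeval y (eulerFrobenius k) / (1 - y) ^ (k + 2) := by
      filter_upwards [isOpen_ne.mem_nhds hx] with y hy using ih y hy
    have h1 : HasDerivAt (fun y : ℂ => y * Polynomial.aeval y (eulerFrobenius k))
        (1 * Polynomial.aeval x (eulerFrobenius k)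
          + x * Polynomial.aeval x (Polynomial.derivative (eulerFrobenius k))) x :=
      (hasDerivAt_id x).mul (Polynomial.hasDerivAt_aeval (eulerFrobenius k) x)
    have h2 : HasDerivAt (fun y : ℂ => (1 - y) ^ (k + 2))
        (((k + 2 : ℕ) : ℂ) * (1 - x) ^ (k + 1) * (-1)) x :=
      ((hasDerivAt_id x).const_sub 1).pow (k + 2)
    have h3 := h1.div h2 (pow_ne_zero (k + 2) hx')
    change x * deriv (eulerOp^[k] (fun y => y / (1 - y) ^ 2)) x = _
    rw [hev.deriv_eq]
    refine (congrArg (fun d => x * d) h3.deriv).trans ?_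
    simp only [eulerFrobenius, map_add, map_mul, map_sub, map_one, map_natCast,
      Polynomial.aeval_X]
    field_simp
    push_cast
    ring

/-- The defining formula of the Euler–Frobenius polynomials. -/
theorem eulerFrobenius_eq (k : ℕ) (x : ℂ) (h0 : x ≠ 0) (h1 : x ≠ 1) :
    Polynomial.aeval x (eulerFrobenius k)
      = (1 - x) ^ (k + 2) / x * (eulerOp^[k] (fun y => y / (1 - y) ^ 2)) x := by
  have h : (1 - x) ≠ 0 := sub_ne_zero.mpr (Ne.symm h1)
  rw [eulerOp_iterate k x h1]
  field_simp

/-- `q_1, …, q_{m-1}` are the roots of `E_{2m-2}` with `|q_k| < 1`, each listed once. -/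
def IsInnerRoots (m : ℕ) (q : Fin (m - 1) → ℂ) : Prop :=
  Function.Injective q ∧
    ∀ z : ℂ, (∃ k, q k = z) ↔ (Polynomial.aeval z (eulerFrobenius (2 * m - 2)) = 0 ∧ ‖z‖ < 1)

/-- `𝐚_α = ∑_{j=0}^α (-1)^j C(2m, j) (α + 1 - j)^{2m-1}`. -/
def efCoeff (m α : ℕ) : ℤ :=
  ∑ j ∈ Finset.range (α + 1), (-1) ^ j * ((2 * m).choose j : ℤ) * ((α : ℤ) + 1 - j) ^ (2 * m - 1)

/-! ### The explicit formulas -/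

/-- `Δ^i 0^j = ∑_{l=1}^i (-1)^{i-l} C(i, l) l^j`. -/
def diffZero (i j : ℕ) : ℂ :=
  ∑ l ∈ Finset.Icc 1 i, (-1 : ℂ) ^ (i - l) * (i.choose l : ℂ) * (l : ℂ) ^ j

/-- `K_{ω,m}`. -/
def K (m N : ℕ) (ω : ℝ) : ℝ :=
  (Real.sin (Real.pi * ω * step N) / (Real.pi * ω * step N)) ^ (2 * m) *
    (Nat.factorial (2 * m - 1) : ℝ) /
      (2 * ∑ α ∈ Finset.range (m - 1),
          (efCoeff m α : ℝ) * Real.cos (2 * Real.pi * ω * step N * ((m : ℝ) - 1 - α))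
        + (efCoeff m (m - 1) : ℝ))

/-- `2πiωh`. -/
def w (N : ℕ) (ω : ℝ) : ℂ := 2 * Real.pi * Complex.I * ω * step N

/-- `e^{2πiωh}`. -/
def eh (N : ℕ) (ω : ℝ) : ℂ := Complex.exp (w N ω)

/-- `e^{2πiω}`. -/
def e1 (ω : ℝ) : ℂ := Complex.exp (2 * Real.pi * Complex.I * ω)

/-- The system of `2m - 2` linear equations for `a_k`, `b_k`: two families, `j = 1, …, m - 1`. -/
def IsSystemSolution (m N : ℕ) (ω : ℝ) (q a b : Fin (m - 1) → ℂ) : Prop :=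
  (∀ j ∈ Finset.Icc 1 (m - 1),
    ∑ k, a k * (∑ t ∈ Finset.Icc 1 j, q k * diffZero t j / (q k - 1) ^ (t + 1))
      + ∑ k, b k * (∑ t ∈ Finset.Icc 1 j, q k ^ (N + t) * diffZero t j / (1 - q k) ^ (t + 1))
    = (Nat.factorial j : ℂ) / w N ω ^ (j + 1)
      - ∑ t ∈ Finset.Icc 1 j, eh N ω * K m N ω * diffZero t j / (eh N ω - 1) ^ (t + 1)) ∧
  (∀ j ∈ Finset.Icc 1 (m - 1),
    ∑ k, a k * ((∑ t ∈ Finset.Icc 1 j, q k ^ t * diffZero t j / (1 - q k) ^ (t + 1))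
        - ∑ α ∈ Finset.Icc 1 j, (step N : ℂ) ^ ((α : ℤ) - j) * (j.choose α : ℂ) *
            ∑ t ∈ Finset.Icc 1 α, q k ^ (N + t) * diffZero t α / (1 - q k) ^ (t + 1))
      + ∑ k, b k * ((∑ t ∈ Finset.Icc 1 j, q k ^ (N + 1) * diffZero t j / (q k - 1) ^ (t + 1))
        - ∑ α ∈ Finset.Icc 1 j, (step N : ℂ) ^ ((α : ℤ) - j) * (j.choose α : ℂ) *
            ∑ t ∈ Finset.Icc 1 α, q k * diffZero t α / (q k - 1) ^ (t + 1))
    = (-1) ^ (j + 1) * (Nat.factorial j : ℂ) / w N ω ^ (j + 1)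
      + ∑ α ∈ Finset.Icc 1 j, (step N : ℂ) ^ ((α : ℤ) - j) *
          ((-1) ^ α * (Nat.factorial j : ℂ) * e1 ω / ((Nat.factorial (j - α) : ℂ) * w N ω ^ (α + 1)))
      - K m N ω / (1 - eh N ω) *
          ∑ t ∈ Finset.Icc 1 j, (eh N ω / (1 - eh N ω)) ^ t * diffZero t j
      + K m N ω * e1 ω / (1 - eh N ω) *
          ∑ α ∈ Finset.Icc 1 j, (step N : ℂ) ^ ((α : ℤ) - j) * (j.choose α : ℂ) *
            ∑ t ∈ Finset.Icc 1 α, (eh N ω / (1 - eh N ω)) ^ t * diffZero t α)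

/-- The explicit coefficients: the two end points `β = 0`, `β = N`, and `β = 1, …, N - 1`. -/
def explicitCoeff (m N : ℕ) (ω : ℝ) (q a b : Fin (m - 1) → ℂ) (β : Fin (N + 1)) : ℂ :=
  if (β : ℕ) = 0 then
    step N * (eh N ω * K m N ω / (eh N ω - 1) - 1 / w N ω
      + ∑ k, (a k * (q k / (q k - 1)) + b k * (q k ^ N / (1 - q k))))
  else if (β : ℕ) = N then
    step N * (e1 ω * K m N ω / (1 - eh N ω) + e1 ω / w N ω
      + ∑ k, (a k * (q k ^ N / (1 - q k)) + b k * (q k / (q k - 1))))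
  else
    step N * (Complex.exp (2 * Real.pi * Complex.I * ω * step N * (β : ℕ)) * K m N ω
      + ∑ k, (a k * q k ^ (β : ℕ) + b k * q k ^ (N - (β : ℕ))))

end

end SardFourier

namespace SardFourier

noncomputable section

/-! Two ideas meet: a Hilbert space characterisation of the optimal rule, and a discrete convolution
identity that verifies it.

For a rule exact in degrees below m, ‖ℓ‖ is the L² norm of its Peano kernel of order m
(`iSup_norm_eq`). Minimising over exact rules is therefore an orthogonal projection. An exact rule
is the unique minimiser as soon as the convolution of ℓ with the Green function u_+^{2m-1}/(2m-1)!
agrees at the nodes with a polynomial of degree below m (`SolvesGrid`): the kernel is then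
orthogonal to all admissible variations, and Pythagoras applies (`integral_norm_sq_peano_add`,
`isSardOptimal_iff`).

After rescaling by h, the interior coefficients are combinations of z^β with z = q_k, 1/q_k or λ =
e^{2πiωh}. A finite sum of z^γ p(γ) is a difference of two analytically continued infinite sums, one
from each end (`geomSum_eq_sum_add`), and the integral splits in the same way
(`integral_exp_mul_eval`). In the convolution at β the terms from the end β involve only the top
moment ∑ γ^{2m-1} z^γ = z E_{2m-2}(z)/(1-z)^{2m}. It vanishes at q_k and 1/q_k, and K is the
constant for which its value at λ cancels the contribution of the integral (`K_mul_geomMoment`).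
What remains is a fixed left functional applied to (β - X)^{2m-1}, a polynomial in β. Its degree is
below m once that functional kills 1, X, …, X^{m-1}: the formula for C_0 covers X^0, the first
family of equations the rest. Exactness follows by treating the end N likewise, with C_N and the
second family.

The system is square, so only the homogeneous one matters. A homogeneous solution gives an exact
rule for the weight 0 that satisfies the grid condition, so all its coefficients vanish. The grid
polynomial then has N + 1 ≥ m zeros and vanishes, hence the left moments of all orders below 2m
vanish; since the 2m - 1 ratios are distinct, so do all amplitudes
(`eq_zero_of_sum_geomMoment_eq_zero`).

The existence of the q_k comes from Rolle's theorem in the variable z/(1-z) (`geomPoly_roots`)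
together with the symmetry z ↦ 1/z. -/

open Polynomial in
/-- The polynomials `P_j` with `∑_{γ ≥ 1} γ^j z^γ = P_j (z / (1 - z))`. -/
def geomPoly : ℕ → Polynomial ℝ
  | 0 => X
  | j + 1 => X * (1 + X) * derivative (geomPoly j)

/-! ### Moments of geometric sequences as polynomials in z/(1-z) -/

section geomPoly
open Polynomial

/-- This is the index shift ∑_{γ≥1} γ^j z^γ = z ∑_{γ≥0} (γ+1)^j z^γ, written in s = z/(1-z), where
1/(1-z) = 1 + s. The induction applies z d/dz = s(1+s) d/ds to both sides. -/
theorem geomPoly_functional (j : ℕ) :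
    (1 + X) * geomPoly j
      = X + X * ∑ α ∈ Finset.range (j + 1), (j.choose α : ℝ[X]) * geomPoly α := by
  induction j with
  | zero => simp [geomPoly]; ring
  | succ j ih =>
    have hD := congrArg (fun p => X * (1 + X) * derivative p) ih
    simp only [derivative_mul, derivative_add, derivative_one, derivative_X, derivative_sum,
      derivative_natCast] at hD
    have h1 : X * (1 + X) * ∑ α ∈ Finset.range (j + 1),
        ((0 : ℝ[X]) * geomPoly α + (j.choose α : ℝ[X]) * derivative (geomPoly α))
        = ∑ α ∈ Finset.range (j + 1), (j.choose α : ℝ[X]) * geomPoly (α + 1) := by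
      rw [Finset.mul_sum]
      refine Finset.sum_congr rfl fun α _ => ?_
      rw [geomPoly]; ring
    have h2 : ∑ α ∈ Finset.range (j + 1 + 1), ((j + 1).choose α : ℝ[X]) * geomPoly α
        = ∑ α ∈ Finset.range (j + 1), (j.choose α : ℝ[X]) * geomPoly α
          + ∑ α ∈ Finset.range (j + 1), (j.choose α : ℝ[X]) * geomPoly (α + 1) := by
      rw [Finset.sum_range_succ', Finset.sum_congr rfl
        (fun α _ => by rw [Nat.choose_succ_succ, Nat.cast_add, add_mul]),
        Finset.sum_add_distrib]
      have : ∑ α ∈ Finset.range (j + 1), (j.choose (α + 1) : ℝ[X]) * geomPoly (α + 1)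
          + (j.choose 0 : ℝ[X]) * geomPoly 0
          = ∑ α ∈ Finset.range (j + 1), (j.choose α : ℝ[X]) * geomPoly α := by
        rw [← Finset.sum_range_succ' (fun α => (j.choose α : ℝ[X]) * geomPoly α),
          Finset.sum_range_succ]
        simp
      rw [← this]; simp; ring
    rw [h2, ← h1]
    rw [geomPoly]
    linear_combination hD - X * ih

/-- Δ^t 0^j is t! times a Stirling number of the second kind for j ≥ 1; this is the Stirling
recurrence. -/
theorem diffZero_succ (t j : ℕ) (ht : 1 ≤ t) :
    diffZero t (j + 1) = t * (diffZero t j + diffZero (t - 1) j) := by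
  obtain ⟨t, rfl⟩ : ∃ s, t = s + 1 := ⟨t - 1, by omega⟩
  simp only [diffZero, Nat.add_sub_cancel]
  have h : ∑ l ∈ Finset.Icc 1 t, (-1 : ℂ) ^ (t - l) * (t.choose l : ℂ) * (l : ℂ) ^ j
      = ∑ l ∈ Finset.Icc 1 (t + 1), (-1 : ℂ) ^ (t - l) * (t.choose l : ℂ) * (l : ℂ) ^ j := by
    rw [Finset.sum_Icc_succ_top (by omega)]; simp
  rw [h, ← Finset.sum_add_distrib, Finset.mul_sum]
  refine Finset.sum_congr rfl fun l hl => ?_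
  obtain ⟨hl1, hl2⟩ := Finset.mem_Icc.mp hl
  obtain ⟨l, rfl⟩ : ∃ s, l = s + 1 := ⟨l - 1, by omega⟩
  have hc : (((t + 1).choose (l + 1) : ℕ) : ℂ) * ((l : ℂ) + 1) = ((t : ℂ) + 1) * (t.choose l : ℂ) := by
    have := Nat.add_one_mul_choose_eq t l
    exact_mod_cast this.symm
  have hp : (((t + 1).choose (l + 1) : ℕ) : ℂ) = (t.choose l : ℂ) + (t.choose (l + 1) : ℂ) := by
    exact_mod_cast Nat.choose_succ_succ t l
  have hsub : t + 1 - (l + 1) = t - l := by omega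
  rw [hsub]
  rcases Nat.lt_or_ge l t with hlt | hge
  · have e1 : t - l = (t - (l + 1)) + 1 := by omega
    rw [e1, pow_succ, pow_succ]
    push_cast
    linear_combination (-(-1) ^ (t - (l + 1))) * ((l : ℂ) + 1) ^ j * hc
      + (-1) ^ (t - (l + 1)) * ((t:ℂ) + 1) * ((l : ℂ) + 1) ^ j * hp
  · have : l = t := by omega
    subst this
    simp [pow_succ]; ring

theorem diffZero_zero (j : ℕ) : diffZero 0 j = 0 := by simp [diffZero]

/-- A difference of order t annihilates degree j < t. The case j = 0 must be excluded because the
sum omits l = 0. -/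
theorem diffZero_of_lt {t j : ℕ} (hj : 1 ≤ j) (h : j < t) : diffZero t j = 0 := by
  induction j, hj using Nat.le_induction generalizing t with
  | base =>
    obtain ⟨t, rfl⟩ : ∃ s, t = s + 2 := ⟨t - 2, by omega⟩
    have h0 := Int.alternating_sum_range_choose_of_ne (n := t + 1) (by omega)
    have h1 : (∑ l ∈ Finset.range (t + 2), (-1 : ℂ) ^ l * ((t + 1).choose l : ℂ)) = 0 := by
      exact_mod_cast congrArg (Int.cast : ℤ → ℂ) h0
    simp only [diffZero, pow_one]
    rw [Finset.range_eq_Ico, Finset.sum_Ico_eq_sum_range] at h1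
    have : Finset.Icc 1 (t + 2) = Finset.Ico 1 (t + 3) := by ext; simp; omega
    rw [this, Finset.sum_Ico_eq_sum_range]
    -- Absorption, (l + 1) C(t+2, l+1) = (t + 2) C(t+1, l), reduces the sum to an alternating sum of
    -- binomials.
    have h2 := congrArg (fun x => (-1 : ℂ) ^ (t + 1) * ((t : ℂ) + 2) * x) h1
    simp only [mul_zero] at h2
    rw [← h2, Finset.mul_sum]
    refine Finset.sum_congr (by congr 1) fun l hl => ?_
    have hl' : l ≤ t + 1 := by have := Finset.mem_range.mp hl; omega
    have hc := Nat.add_one_mul_choose_eq (t + 1) l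
    have hc' : ((t : ℂ) + 2) * ((t + 1).choose l : ℂ)
        = ((t + 2).choose (l + 1) : ℂ) * ((l : ℂ) + 1) := by
      have : ((t + 1 + 1 : ℕ) : ℂ) * ((t + 1).choose l : ℂ)
        = ((t + 1 + 1).choose (l + 1) : ℂ) * ((l + 1 : ℕ) : ℂ) := by exact_mod_cast hc
      push_cast at this
      linear_combination this
    have e1 : (-1 : ℂ) ^ (t + 2 - (1 + l)) = (-1) ^ (t + 1) * (-1) ^ l := by
      have : t + 1 = (t + 2 - (1 + l)) + l := by omega
      rw [this, pow_add, mul_assoc, ← pow_add, ← two_mul, pow_mul]; simp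
    rw [e1, add_comm 1 l]
    push_cast
    simp only [zero_add]
    linear_combination (-(-1) ^ (t + 1)) * (-1) ^ l * hc'
  | succ j hj ih =>
    rw [diffZero_succ t j (by omega), ih (by omega), ih (by omega)]; simp

theorem diffZero_one_one : diffZero 1 1 = 1 := by simp [diffZero]

/-- The link between the sums over Δ^t 0^j in the linear system and the moments: both sides obey the
same recursion, by `diffZero_succ`. -/
theorem map_geomPoly (j : ℕ) (hj : 1 ≤ j) :
    (geomPoly j).map (algebraMap ℝ ℂ)
      = (1 + X) * ∑ t ∈ Finset.Icc 1 j, C (diffZero t j) * X ^ t := by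
  induction j, hj using Nat.le_induction with
  | base => simp [geomPoly, diffZero_one_one]; ring
  | succ j hj ih =>
    have e : (geomPoly (j + 1)).map (algebraMap ℝ ℂ)
        = X * (1 + X) * derivative ((geomPoly j).map (algebraMap ℝ ℂ)) := by
      simp [geomPoly, derivative_map]
    rw [e, ih]
    have h1 : ∑ t ∈ Finset.Icc 1 (j + 1), C (diffZero t (j + 1)) * X ^ t
        = ∑ t ∈ Finset.Icc 1 (j + 1), ((t : ℂ[X]) * C (diffZero t j) * X ^ t)
          + ∑ t ∈ Finset.Icc 1 (j + 1), ((t : ℂ[X]) * C (diffZero (t - 1) j) * X ^ t) := by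
      rw [← Finset.sum_add_distrib]
      refine Finset.sum_congr rfl fun t ht => ?_
      rw [diffZero_succ t j (Finset.mem_Icc.mp ht).1]
      simp only [map_mul, map_add, map_natCast]; ring
    have h2 : ∑ t ∈ Finset.Icc 1 (j + 1), ((t : ℂ[X]) * C (diffZero t j) * X ^ t)
        = ∑ t ∈ Finset.Icc 1 j, ((t : ℂ[X]) * C (diffZero t j) * X ^ t) := by
      rw [Finset.sum_Icc_succ_top (by omega), diffZero_of_lt hj (by omega)]; simp
    have h3 : ∑ t ∈ Finset.Icc 1 (j + 1), ((t : ℂ[X]) * C (diffZero (t - 1) j) * X ^ t)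
        = ∑ t ∈ Finset.Icc 1 j, (((t : ℂ[X]) + 1) * C (diffZero t j) * X ^ (t + 1)) := by
      have : Finset.Icc 1 (j + 1) = Finset.Ico 1 (j + 2) := by ext; simp; omega
      have h' : Finset.Icc 1 j = Finset.Ico 1 (j + 1) := by ext; simp
      rw [this, h', Finset.sum_eq_sum_Ico_succ_bot (by omega), ← Finset.sum_Ico_add' _ 1 (j + 1) 1]
      simp [diffZero_zero]
    rw [h1, h2, h3, ← Finset.sum_add_distrib]
    simp only [derivative_mul, derivative_add, derivative_one, derivative_X, derivative_sum,
      derivative_C, derivative_X_pow]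
    rw [zero_add, one_mul, mul_add, Finset.mul_sum, Finset.mul_sum, Finset.mul_sum,
      Finset.mul_sum, ← Finset.sum_add_distrib]
    refine Finset.sum_congr rfl fun t ht => ?_
    obtain ⟨t, rfl⟩ : ∃ s, t = s + 1 := ⟨t - 1, by have := (Finset.mem_Icc.mp ht).1; omega⟩
    simp only [Nat.add_sub_cancel, map_natCast]
    push_cast
    ring

/-- The substitution z ↦ 1/z becomes s ↦ -1 - s for s = z/(1-z). The parity fails for j = 0, where
the polynomial is X. -/
theorem geomPoly_comp (j : ℕ) (hj : 1 ≤ j) :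
    (geomPoly j).comp (-1 - X) = (-1) ^ (j + 1) * geomPoly j := by
  induction j, hj using Nat.le_induction with
  | base => simp [geomPoly]; ring
  | succ j hj ih =>
    have h := congrArg derivative ih
    rw [derivative_comp] at h
    have e : derivative ((-1 : ℝ[X]) ^ (j + 1) * geomPoly j)
        = (-1) ^ (j + 1) * derivative (geomPoly j) := by
      have : ((-1 : ℝ[X]) ^ (j + 1)) = C ((-1) ^ (j + 1)) := by simp
      rw [this, derivative_C_mul]
    rw [e] at h
    simp only [derivative_sub, derivative_neg, derivative_one, derivative_X] at h
    simp only [geomPoly, mul_comp, add_comp, X_comp, one_comp]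
    linear_combination (-(-1 - X) * (1 + (-1 - X))) * h

theorem natDegree_geomPoly (j : ℕ) :
    (geomPoly j).natDegree = j + 1 ∧ (geomPoly j).leadingCoeff = (j.factorial : ℝ) := by
  induction j with
  | zero => simp [geomPoly]
  | succ j ih =>
    obtain ⟨h1, h2⟩ := ih
    have hd : (derivative (geomPoly j)).natDegree = j := by
      rw [natDegree_derivative, h1]; simp
    have hl : (derivative (geomPoly j)).leadingCoeff = ((j + 1).factorial : ℝ) := by
      have h2' : (geomPoly j).coeff (j + 1) = (j.factorial : ℝ) := by rw [← h1, coeff_natDegree, h2]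
      rw [leadingCoeff, hd, coeff_derivative, h2', Nat.factorial_succ]; push_cast; ring
    have hne : derivative (geomPoly j) ≠ 0 := by
      intro h; rw [h, leadingCoeff_zero] at hl; exact (Nat.cast_ne_zero.2 (Nat.factorial_ne_zero _)) hl.symm
    have hX : ((1 : ℝ[X]) + X).natDegree = 1 := by
      rw [add_comm]; exact natDegree_X_add_C (1 : ℝ)
    have hX0 : ((1 : ℝ[X]) + X) ≠ 0 := by intro h; rw [h] at hX; simp at hX
    have hXl : ((1 : ℝ[X]) + X).leadingCoeff = 1 := by
      rw [add_comm]; exact leadingCoeff_X_add_C (1 : ℝ)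
    constructor
    · rw [geomPoly, natDegree_mul (mul_ne_zero X_ne_zero hX0) hne, natDegree_mul X_ne_zero hX0,
        hd, hX, natDegree_X]; ring
    · rw [geomPoly, leadingCoeff_mul, leadingCoeff_mul, hXl, hl]; simp

theorem geomPoly_ne_zero (j : ℕ) : geomPoly j ≠ 0 := by
  intro h; have := (natDegree_geomPoly j).1; simp [h] at this

/-- Rolle: j + 1 simple real roots force j distinct roots of the derivative, which is all its degree
allows. The factor X(1+X) adds 0 and -1, which are new because a simple root is not a root of the
derivative. -/
theorem geomPoly_roots (j : ℕ) : (geomPoly j).roots.Nodup ∧ (geomPoly j).roots.card = j + 1 := by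
  induction j with
  | zero => simp [geomPoly]
  | succ j ih =>
    obtain ⟨hn, hc⟩ := ih
    have hle : Multiset.card (derivative (geomPoly j)).roots ≤ j := by
      have := card_roots' (derivative (geomPoly j))
      rw [natDegree_derivative, (natDegree_geomPoly j).1] at this
      simpa using this
    have hfin : (geomPoly j).roots.toFinset.card = j + 1 := by
      rw [Multiset.toFinset_card_of_nodup hn, hc]
    have hR := card_roots_toFinset_le_derivative (geomPoly j)
    have hR2 := Multiset.toFinset_card_le (derivative (geomPoly j)).roots
    have hcd : Multiset.card (derivative (geomPoly j)).roots = j := by omega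
    have hnd : (derivative (geomPoly j)).roots.Nodup := by
      rw [← Multiset.toFinset_card_eq_card_iff_nodup]; omega
    have hsimple : ∀ x, (geomPoly j).IsRoot x → ¬ (derivative (geomPoly j)).IsRoot x := by
      intro x hx hdx
      have h1 := (one_lt_rootMultiplicity_iff_isRoot (geomPoly_ne_zero j)).2 ⟨hx, hdx⟩
      have := (Multiset.nodup_iff_count_le_one.1 hn) x
      rw [count_roots] at this; omega
    have h0 : ∀ j, (geomPoly j).IsRoot 0 := by
      intro j; cases j <;> simp [geomPoly]
    have h1 : ∀ j, 1 ≤ j → (geomPoly j).IsRoot (-1) := by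
      intro j hj; obtain ⟨i, rfl⟩ : ∃ i, j = i + 1 := ⟨j - 1, by omega⟩
      simp [geomPoly]
    -- For j = 0 the point -1 is not a root of X, but then the derivative is the constant 1.
    have hm1 : ¬ (derivative (geomPoly j)).IsRoot (-1) := by
      rcases Nat.eq_zero_or_pos j with rfl | hj
      · simp [geomPoly]
      · exact hsimple _ (h1 j hj)
    have hr : (geomPoly (j + 1)).roots = 0 ::ₘ (-1) ::ₘ (derivative (geomPoly j)).roots := by
      have hne := geomPoly_ne_zero (j + 1)
      rw [geomPoly] at hne ⊢
      rw [roots_mul hne, roots_mul (left_ne_zero_of_mul hne), roots_X]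
      have : (1 + X : ℝ[X]) = X + C 1 := by simp [add_comm]
      rw [this, roots_X_add_C]
      simp
    rw [hr]
    refine ⟨?_, by simp [hcd]⟩
    rw [Multiset.nodup_cons, Multiset.nodup_cons]
    refine ⟨?_, ?_, hnd⟩
    · simp only [Multiset.mem_cons, not_or]
      exact ⟨by norm_num, fun h => hsimple 0 (h0 j) (isRoot_of_mem_roots h)⟩
    · exact fun h => hm1 (isRoot_of_mem_roots h)

end geomPoly

/-! ### Coefficients of the Euler–Frobenius polynomials, and the moments in terms of them -/

section eulerFrobenius
open Polynomial

theorem eulerFrobenius_coeff_zero (k : ℕ) : (eulerFrobenius k).coeff 0 = 1 := by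
  induction k with
  | zero => simp [eulerFrobenius]
  | succ k ih => simp [eulerFrobenius, ih, mul_assoc, mul_coeff_zero]

theorem eulerFrobenius_coeff_succ (k α : ℕ) :
    (eulerFrobenius (k + 1)).coeff (α + 1)
      = ((α : ℤ) + 2) * (eulerFrobenius k).coeff (α + 1)
        + ((k : ℤ) + 1 - α) * (eulerFrobenius k).coeff α := by
  have e : eulerFrobenius (k + 1) = eulerFrobenius k
      + C ((k : ℤ) + 1) * (X * eulerFrobenius k)
      + X * derivative (eulerFrobenius k) - X * (X * derivative (eulerFrobenius k)) := by
    rw [eulerFrobenius]; simp only [map_add, map_natCast, map_one]; ring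
  rw [e]
  simp only [coeff_sub, coeff_add, coeff_C_mul, coeff_X_mul, coeff_derivative]
  rcases α with _ | α
  · simp [mul_coeff_zero]; ring
  · simp only [coeff_X_mul, coeff_derivative]; push_cast; ring

theorem eulerFrobenius_coeff_of_lt {k α : ℕ} (h : k < α) : (eulerFrobenius k).coeff α = 0 := by
  induction k generalizing α with
  | zero => rw [eulerFrobenius, coeff_one]; simp; omega
  | succ k ih =>
    obtain ⟨α, rfl⟩ : ∃ s, α = s + 1 := ⟨α - 1, by omega⟩
    rw [eulerFrobenius_coeff_succ, ih (by omega), ih (by omega)]; simp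

/-- The two weights in `eulerFrobenius_coeff_succ` are exchanged when the index is reflected, so the
palindromic property is inherited. It makes K a cosine sum. -/
theorem eulerFrobenius_coeff_symm {k a b : ℕ} (h : a + b = k) :
    (eulerFrobenius k).coeff a = (eulerFrobenius k).coeff b := by
  induction k generalizing a b with
  | zero => obtain ⟨rfl, rfl⟩ : a = 0 ∧ b = 0 := by omega
            rfl
  | succ k ih =>
    have key : (eulerFrobenius (k + 1)).coeff 0 = (eulerFrobenius (k + 1)).coeff (k + 1) := by
      rw [eulerFrobenius_coeff_succ, eulerFrobenius_coeff_of_lt (Nat.lt_succ_self k),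
        ← ih (a := 0) (b := k) (by omega), eulerFrobenius_coeff_zero, eulerFrobenius_coeff_zero]
      ring
    rcases a with _ | a
    · obtain rfl : b = k + 1 := by omega
      exact key
    rcases b with _ | b
    · obtain rfl : a = k := by omega
      exact key.symm
    rw [eulerFrobenius_coeff_succ, eulerFrobenius_coeff_succ, ih (a := a + 1) (b := b) (by omega),
      ih (a := a) (b := b + 1) (by omega)]
    have : (k : ℤ) = a + b + 1 := by omega
    rw [this]; ring

theorem natDegree_eulerFrobenius (k : ℕ) : (eulerFrobenius k).natDegree = k := by
  refine natDegree_eq_of_le_of_coeff_ne_zero ?_ ?_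
  · exact natDegree_le_iff_coeff_eq_zero.2 fun α hα => eulerFrobenius_coeff_of_lt hα
  · rw [eulerFrobenius_coeff_symm (a := k) (b := 0) (by omega), eulerFrobenius_coeff_zero]
    exact one_ne_zero

theorem eulerFrobenius_coeff (k α : ℕ) :
    (eulerFrobenius k).coeff α
      = ∑ j ∈ Finset.range (α + 1),
          (-1) ^ j * ((k + 2).choose j : ℤ) * ((α : ℤ) + 1 - j) ^ (k + 1) := by
  induction k generalizing α with
  | zero =>
    rw [eulerFrobenius, coeff_one]
    rcases α with _ | _ | α
    · simp
    · simp [Finset.sum_range_succ]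
    · have h : ∀ j ∈ Finset.range (α + 2 + 1), j ∉ Finset.range 3 →
          (-1 : ℤ) ^ j * ((0 + 2).choose j : ℤ) * (((α + 2 : ℕ) : ℤ) + 1 - j) ^ (0 + 1) = 0 := by
        intro j _ hj
        rw [Nat.choose_eq_zero_of_lt (by simp at hj; omega)]; simp
      rw [← Finset.sum_subset (by intro j hj; simp at hj ⊢; omega) h]
      simp [Finset.sum_range_succ]; ring
  | succ k ih =>
    rcases α with _ | α
    · rw [eulerFrobenius_coeff_zero]; simp
    rw [eulerFrobenius_coeff_succ, ih, ih, Finset.mul_sum, Finset.mul_sum]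
    -- With the term j = 0 split off, index j + 1 in the sum for α + 1 meets index j in the sum for
    -- α, with the same base α + 1 - j; Pascal's rule then joins them.
    rw [Finset.sum_range_succ' _ (α + 1), Finset.sum_range_succ' _ (α + 1)]
    rw [add_right_comm, ← Finset.sum_add_distrib]
    congr 1
    · refine Finset.sum_congr rfl fun j _ => ?_
      have h1 : ((k + 2).choose (j + 1) : ℤ) * ((j : ℤ) + 1)
          = ((k + 2).choose j : ℤ) * ((k : ℤ) + 2 - j) := by
        rcases Nat.lt_or_ge (k + 2) j with h | h
        · rw [Nat.choose_eq_zero_of_lt h, Nat.choose_eq_zero_of_lt (by omega)]; simp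
        · have := Nat.choose_succ_right_eq (k + 2) j
          zify [h] at this
          linear_combination this
      have h2 : ((k + 1 + 2).choose (j + 1) : ℤ)
          = (k + 2).choose j + (k + 2).choose (j + 1) := by
        exact_mod_cast Nat.choose_succ_succ (k + 2) j
      rw [h2]
      push_cast
      have h3 : ((α : ℤ) + 1 + 1 - (j + 1)) = α + 1 - j := by ring
      rw [h3, pow_succ (-1 : ℤ) j, pow_succ _ (k + 1)]
      linear_combination (-(-1) ^ j) * ((α : ℤ) + 1 - j) ^ (k + 1) * h1
    · push_cast; simp; ring

theorem eulerFrobenius_coeff_eq_efCoeff (m α : ℕ) (hm : 1 ≤ m) :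
    (eulerFrobenius (2 * m - 2)).coeff α = efCoeff m α := by
  rw [eulerFrobenius_coeff, efCoeff]
  have h1 : 2 * m - 2 + 2 = 2 * m := by omega
  have h2 : 2 * m - 2 + 1 = 2 * m - 1 := by omega
  rw [h1, h2]

/-- `∑_{γ ≥ 1} γ^j z^γ`, continued analytically to `z ≠ 1`. -/
def geomMoment (j : ℕ) (z : ℂ) : ℂ := aeval (z / (1 - z)) (geomPoly j)

theorem geomMoment_zero (z : ℂ) : geomMoment 0 z = z / (1 - z) := by simp [geomMoment, geomPoly]

/-- Under s = z/(1-z) the operator z d/dz becomes s(1+s) d/ds, the one that generates `geomPoly`. -/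
theorem geomMoment_succ_eq_eulerOp (k : ℕ) : ∀ z : ℂ, z ≠ 1 →
    (eulerOp^[k] (fun y => y / (1 - y) ^ 2)) z = geomMoment (k + 1) z := by
  induction k with
  | zero =>
    intro z hz
    have : 1 - z ≠ 0 := sub_ne_zero.2 hz.symm
    simp [geomMoment, geomPoly]; field_simp; ring
  | succ k ih =>
    intro x hx
    have hx' : (1 - x) ≠ 0 := sub_ne_zero.mpr (Ne.symm hx)
    rw [Function.iterate_succ_apply']
    have hev : (eulerOp^[k] (fun y => y / (1 - y) ^ 2)) =ᶠ[nhds x] geomMoment (k + 1) := by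
      filter_upwards [isOpen_ne.mem_nhds hx] with y hy using ih y hy
    change x * deriv (eulerOp^[k] (fun y => y / (1 - y) ^ 2)) x = _
    rw [hev.deriv_eq]
    have h1 : HasDerivAt (fun y : ℂ => y / (1 - y)) ((1 * (1 - x) - x * (-1)) / (1 - x) ^ 2) x :=
      (hasDerivAt_id x).div ((hasDerivAt_id x).const_sub 1) hx'
    have h2 := ((geomPoly (k + 1)).hasDerivAt_aeval (x / (1 - x))).comp x h1
    have h3 : deriv (geomMoment (k + 1)) x = _ := h2.deriv
    rw [h3]
    conv_rhs => rw [geomMoment, geomPoly]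
    simp only [map_mul, map_add, map_one, aeval_X]
    field_simp
    ring

/-- Two evaluations of the same iterate of z d/dz. This is how zeros of the Euler–Frobenius
polynomial become zeros of a moment. -/
theorem geomMoment_succ (k : ℕ) {z : ℂ} (hz : z ≠ 1) :
    geomMoment (k + 1) z = z * aeval z (eulerFrobenius k) / (1 - z) ^ (k + 2) := by
  rw [← geomMoment_succ_eq_eulerOp k z hz, eulerOp_iterate k z hz]

theorem geomMoment_functional (j : ℕ) {z : ℂ} (hz : z ≠ 1) :
    geomMoment j z = z * (1 + ∑ α ∈ Finset.range (j + 1), (j.choose α : ℂ) * geomMoment α z) := by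
  have h := congrArg (aeval (z / (1 - z))) (geomPoly_functional j)
  simp only [map_mul, map_add, map_one, aeval_X, map_sum, map_natCast] at h
  have hz' : 1 - z ≠ 0 := sub_ne_zero.mpr (Ne.symm hz)
  have h1 : 1 + z / (1 - z) = 1 / (1 - z) := by field_simp; ring
  rw [h1] at h
  change 1 / (1 - z) * geomMoment j z = z / (1 - z) + z / (1 - z) *
    ∑ α ∈ Finset.range (j + 1), (j.choose α : ℂ) * geomMoment α z at h
  field_simp at h
  exact h

theorem geomMoment_eq_sum {j : ℕ} (hj : 1 ≤ j) {z : ℂ} (hz : z ≠ 1) :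
    geomMoment j z = ∑ t ∈ Finset.Icc 1 j, z ^ t * diffZero t j / (1 - z) ^ (t + 1) := by
  have hz' : 1 - z ≠ 0 := sub_ne_zero.mpr (Ne.symm hz)
  have h : geomMoment j z = eval (z / (1 - z)) ((geomPoly j).map (algebraMap ℝ ℂ)) := by
    rw [eval_map_algebraMap, geomMoment]
  rw [h, map_geomPoly j hj]
  have h1 : 1 + z / (1 - z) = 1 / (1 - z) := by field_simp; ring
  simp only [eval_mul, eval_add, eval_one, eval_X, eval_finsetSum, eval_C, eval_pow, h1]
  rw [Finset.mul_sum]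
  refine Finset.sum_congr rfl fun t _ => ?_
  rw [div_pow]; field_simp; ring

theorem geomMoment_inv {j : ℕ} (hj : 1 ≤ j) {z : ℂ} (h0 : z ≠ 0) (hz : z ≠ 1) :
    geomMoment j z⁻¹ = (-1) ^ (j + 1) * geomMoment j z := by
  have h := congrArg (aeval (z / (1 - z))) (geomPoly_comp j hj)
  have hz' : 1 - z ≠ 0 := sub_ne_zero.mpr (Ne.symm hz)
  have hz'' : z - 1 ≠ 0 := sub_ne_zero.mpr hz
  rw [aeval_comp] at h
  simp only [map_sub, map_neg, map_one, aeval_X, map_mul, map_pow] at h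
  rw [geomMoment, geomMoment, ← h]
  congr 1
  have : 1 - z⁻¹ ≠ 0 := by
    intro h; apply hz''; field_simp at h; simpa using h
  congr 1
  field_simp
  ring

theorem geomMoment_inv_eq_sum {j : ℕ} (hj : 1 ≤ j) {z : ℂ} (h0 : z ≠ 0) (hz : z ≠ 1) :
    geomMoment j z⁻¹ = ∑ t ∈ Finset.Icc 1 j, z * diffZero t j / (z - 1) ^ (t + 1) := by
  have hz'' : z - 1 ≠ 0 := sub_ne_zero.mpr hz
  rw [geomMoment_eq_sum hj (by simpa using hz)]
  refine Finset.sum_congr rfl fun t _ => ?_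
  have : 1 - z⁻¹ = (z - 1) / z := by field_simp
  rw [this, div_pow, inv_pow, pow_succ z t]
  field_simp

/-! ### The roots of `E_{2m-2}` -/

/-- Since z E_{2m-2}(z)/(1-z)^{2m} is P_{2m-1}(z/(1-z)), roots of E_{2m-2} come from the roots of
P_{2m-1} other than 0 and -1, which correspond to z = 0 and z = ∞. There are 2m - 2 of these, equal
to the degree, so no others exist, and all are real. Closure under inversion is `geomMoment_inv`. -/
theorem exists_roots_eulerFrobenius (m : ℕ) (hm : 1 ≤ m) :
    ∃ R : Finset ℝ, R.card = 2 * m - 2 ∧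
      (∀ z : ℂ, aeval z (eulerFrobenius (2 * m - 2)) = 0 ↔ ∃ r ∈ R, z = (r : ℂ)) ∧
      (∀ r ∈ R, r ≠ 0 ∧ r ≠ 1 ∧ r ≠ -1 ∧ r⁻¹ ∈ R) := by
  set E := eulerFrobenius (2 * m - 2) with hE
  set P := geomPoly (2 * m - 1) with hP
  have hj : 2 * m - 1 = 2 * m - 2 + 1 := by omega
  have hE0 : E ≠ 0 := by
    intro h
    have := eulerFrobenius_coeff_zero (2 * m - 2)
    rw [← hE, h] at this; simp at this
  have hmom : ∀ z : ℂ, z ≠ 1 → geomMoment (2 * m - 1) z = z * aeval z E / (1 - z) ^ (2 * m) := by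
    intro z hz
    rw [hj, geomMoment_succ _ hz]
    congr 2; omega
  have hmomR : ∀ r : ℝ, geomMoment (2 * m - 1) r = ((P.eval (r / (1 - r)) : ℝ) : ℂ) := by
    intro r
    rw [geomMoment]
    have : ((r : ℂ) / (1 - r)) = ((r / (1 - r) : ℝ) : ℂ) := by push_cast; ring
    rw [this, ← Complex.coe_algebraMap, aeval_algebraMap_apply, coe_aeval_eq_eval]
  obtain ⟨hnd, hcard⟩ := geomPoly_roots (2 * m - 1)
  have hP0 : P ≠ 0 := geomPoly_ne_zero _
  have hr0 : P.IsRoot 0 := by rw [hP, hj]; simp [geomPoly]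
  have hr1 : P.IsRoot (-1) := by rw [hP, hj]; simp [geomPoly]
  set S : Finset ℝ := (P.roots.toFinset.erase 0).erase (-1) with hS
  have hScard : S.card = 2 * m - 2 := by
    rw [hS, Finset.card_erase_of_mem, Finset.card_erase_of_mem, Multiset.toFinset_card_of_nodup hnd,
      hcard]
    · omega
    · simpa [hP0] using hr0
    · simp only [Finset.mem_erase, Multiset.mem_toFinset, mem_roots hP0]
      exact ⟨by norm_num, hr1⟩
  have hSmem : ∀ s, s ∈ S ↔ s ≠ -1 ∧ s ≠ 0 ∧ P.IsRoot s := by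
    intro s; simp only [hS, Finset.mem_erase, Multiset.mem_toFinset, mem_roots hP0]
  -- The map s ↦ s/(1+s) inverts z ↦ z/(1-z).
  set R : Finset ℝ := S.image (fun s => s / (1 + s)) with hR
  have hRcard : R.card = 2 * m - 2 := by
    rw [hR, Finset.card_image_of_injOn, hScard]
    intro s hs t ht hst
    have h1 : (1 + s) ≠ 0 := fun h => ((hSmem s).1 hs).1 (by linarith)
    have h2 : (1 + t) ≠ 0 := fun h => ((hSmem t).1 ht).1 (by linarith)
    simp only at hst
    field_simp at hst
    linarith
  have hRroot : ∀ r ∈ R, aeval (r : ℂ) E = 0 ∧ r ≠ 0 ∧ r ≠ 1 ∧ P.IsRoot (r / (1 - r)) := by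
    intro r hr
    obtain ⟨s, hs, rfl⟩ := Finset.mem_image.1 hr
    obtain ⟨h1, h2, h3⟩ := (hSmem s).1 hs
    have h1' : (1 + s) ≠ 0 := fun h => h1 (by linarith)
    have hne0 : s / (1 + s) ≠ 0 := div_ne_zero h2 h1'
    have hne1 : s / (1 + s) ≠ 1 := by
      intro h; rw [div_eq_one_iff_eq h1'] at h; linarith
    have hs' : s / (1 + s) / (1 - s / (1 + s)) = s := by
      have : 1 - s / (1 + s) = 1 / (1 + s) := by field_simp; ring
      rw [this]; field_simp
    refine ⟨?_, hne0, hne1, by rw [hs']; exact h3⟩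
    have hz : ((s / (1 + s) : ℝ) : ℂ) ≠ 1 := by exact_mod_cast hne1
    have h := hmom _ hz
    rw [hmomR, hs', h3.eq_zero] at h
    have hd : (1 - ((s / (1 + s) : ℝ) : ℂ)) ^ (2 * m) ≠ 0 :=
      pow_ne_zero _ (sub_ne_zero.2 hz.symm)
    rw [eq_div_iff hd] at h
    simp only [Complex.ofReal_zero, zero_mul] at h
    rcases mul_eq_zero.1 h.symm with h | h
    · exact absurd (by exact_mod_cast h) hne0
    · exact h
  have hroots : ∀ z : ℂ, aeval z E = 0 ↔ ∃ r ∈ R, z = (r : ℂ) := by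
    intro z
    refine ⟨fun hz => ?_, fun ⟨r, hr, h⟩ => by rw [h]; exact (hRroot r hr).1⟩
    set Q := E.map (algebraMap ℤ ℂ) with hQ
    have hinj : Function.Injective (algebraMap ℤ ℂ) := by
      simpa using (Int.cast_injective : Function.Injective (Int.cast : ℤ → ℂ))
    have hQ0 : Q ≠ 0 := (Polynomial.map_ne_zero_iff hinj).2 hE0
    have hQd : Q.natDegree = 2 * m - 2 := by
      rw [hQ, natDegree_map_eq_of_injective hinj, hE, natDegree_eulerFrobenius]
    have hsub : R.image (fun r : ℝ => (r : ℂ)) ⊆ Q.roots.toFinset := by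
      intro w hw
      obtain ⟨r, hr, rfl⟩ := Finset.mem_image.1 hw
      rw [Multiset.mem_toFinset, mem_roots hQ0, IsRoot, eval_map_algebraMap]
      exact (hRroot r hr).1
    have heq : R.image (fun r : ℝ => (r : ℂ)) = Q.roots.toFinset := by
      refine Finset.eq_of_subset_of_card_le hsub ?_
      rw [Finset.card_image_of_injective _ Complex.ofReal_injective, hRcard]
      exact (Multiset.toFinset_card_le _).trans ((card_roots' Q).trans hQd.le)
    have : z ∈ Q.roots.toFinset := by
      rw [Multiset.mem_toFinset, mem_roots hQ0, IsRoot, eval_map_algebraMap]; exact hz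
    rw [← heq] at this
    obtain ⟨r, hr, h⟩ := Finset.mem_image.1 this
    exact ⟨r, hr, h.symm⟩
  refine ⟨R, hRcard, hroots, fun r hr => ?_⟩
  obtain ⟨h1, h2, h3, h4⟩ := hRroot r hr
  have hc0 : (r : ℂ) ≠ 0 := by exact_mod_cast h2
  have hc1 : (r : ℂ) ≠ 1 := by exact_mod_cast h3
  refine ⟨h2, h3, ?_, ?_⟩
  -- A root at -1 would make -1/2, the fixed point of s ↦ -1 - s, a root of P_{2m-1}. That
  -- polynomial is even about -1/2, so its derivative vanishes there too, against simplicity.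
  · rintro rfl
    have hhalf : (-1 : ℝ) / (1 - -1) = -1 / 2 := by norm_num
    rw [hhalf] at h4
    have hd := congrArg (fun p => eval (-1 / 2 : ℝ) (derivative p))
      (geomPoly_comp (2 * m - 1) (by omega))
    have hev : (2 * m - 1 + 1) = 2 * m := by omega
    rw [hev, pow_mul] at hd
    simp only [derivative_comp] at hd
    simp at hd
    rw [show (-1 - -1 / 2 : ℝ) = -1 / 2 by norm_num] at hd
    have hder : (derivative P).IsRoot (-1 / 2) := by
      rw [IsRoot]; linarith
    have hm1 := (one_lt_rootMultiplicity_iff_isRoot hP0).2 ⟨h4, hder⟩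
    have := (Multiset.nodup_iff_count_le_one.1 hnd) (-1 / 2)
    rw [count_roots, ← hP] at this
    omega
  · have hi1 : (r : ℂ)⁻¹ ≠ 1 := by simpa using hc1
    have h := geomMoment_inv (j := 2 * m - 1) (by omega) hc0 hc1
    rw [hmom _ hc1, h1, hmom _ hi1] at h
    have hd : (1 - (r : ℂ)⁻¹) ^ (2 * m) ≠ 0 := pow_ne_zero _ (sub_ne_zero.2 hi1.symm)
    simp only [mul_zero, zero_div] at h
    rcases mul_eq_zero.1 ((div_eq_zero_iff.1 h).resolve_right hd) with h | h
    · exact absurd (inv_eq_zero.1 h) hc0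
    · obtain ⟨r', hr', h'⟩ := (hroots _).1 h
      have : r⁻¹ = r' := by exact_mod_cast h'
      rw [this]; exact hr'

theorem exists_isInnerRoots (m : ℕ) (hm : 1 ≤ m) : ∃ q : Fin (m - 1) → ℂ, IsInnerRoots m q := by
  obtain ⟨R, hc, hroots, hR⟩ := exists_roots_eulerFrobenius m hm
  set A := R.filter (fun r => |r| < 1) with hA
  set B := R.filter (fun r => ¬ |r| < 1) with hB
  -- Inversion exchanges the roots inside and outside the unit circle, and none lies on it.
  have hAB : A.card = B.card := by
    have h1 : ∀ r ∈ R, |r| ≠ 1 := by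
      intro r hr h
      rcases (abs_eq (by norm_num : (0 : ℝ) ≤ 1)).1 h with h | h
      · exact (hR r hr).2.1 h
      · exact (hR r hr).2.2.1 h
    refine Finset.card_bij (fun r _ => r⁻¹) ?_ ?_ ?_
    · intro r hr
      obtain ⟨hr, hlt⟩ := Finset.mem_filter.1 hr
      refine Finset.mem_filter.2 ⟨(hR r hr).2.2.2, ?_⟩
      rw [abs_inv, not_lt]
      exact (one_le_inv₀ (abs_pos.2 (hR r hr).1)).2 hlt.le
    · intro a _ b _ h; exact inv_injective h
    · intro r hr
      obtain ⟨hr, hlt⟩ := Finset.mem_filter.1 hr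
      refine ⟨r⁻¹, Finset.mem_filter.2 ⟨(hR r hr).2.2.2, ?_⟩, inv_inv r⟩
      rw [abs_inv]
      exact inv_lt_one_of_one_lt₀ (lt_of_le_of_ne (not_lt.1 hlt) (h1 r hr).symm)
  have hsum : A.card + B.card = R.card := Finset.card_filter_add_card_filter_not _
  have hAc : A.card = m - 1 := by omega
  let e := A.equivFinOfCardEq hAc
  refine ⟨fun k => ((e.symm k : ℝ) : ℂ), ?_, ?_⟩
  · intro k l h
    have : ((e.symm k : ℝ)) = (e.symm l : ℝ) := Complex.ofReal_injective h
    exact e.symm.injective (Subtype.ext this)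
  · intro z
    rw [hroots]
    constructor
    · rintro ⟨k, rfl⟩
      obtain ⟨h1, h2⟩ := Finset.mem_filter.1 (e.symm k).2
      exact ⟨⟨_, h1, rfl⟩, by simpa using h2⟩
    · rintro ⟨⟨r, hr, rfl⟩, hz⟩
      have : r ∈ A := Finset.mem_filter.2 ⟨hr, by simpa using hz⟩
      exact ⟨e ⟨r, this⟩, by simp⟩

/-- All roots are real and differ from ±1. At z = e^{2πiωh} this says that the denominator of K is
not zero. -/
theorem eulerFrobenius_ne_zero_of_norm_eq_one {m : ℕ} (hm : 1 ≤ m) {z : ℂ} (hz : ‖z‖ = 1) :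
    aeval z (eulerFrobenius (2 * m - 2)) ≠ 0 := by
  obtain ⟨R, -, hroots, hR⟩ := exists_roots_eulerFrobenius m hm
  intro h
  obtain ⟨r, hr, rfl⟩ := (hroots z).1 h
  have : |r| = 1 := by simpa using hz
  rcases (abs_eq (by norm_num : (0 : ℝ) ≤ 1)).1 this with h | h
  · exact (hR r hr).2.1 h
  · exact (hR r hr).2.2.1 h

namespace IsInnerRoots
variable {m : ℕ} {q : Fin (m - 1) → ℂ}

theorem norm_lt_one (hq : IsInnerRoots m q) (k : Fin (m - 1)) : ‖q k‖ < 1 :=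
  ((hq.2 (q k)).1 ⟨k, rfl⟩).2

theorem ne_one (hq : IsInnerRoots m q) (k : Fin (m - 1)) : q k ≠ 1 := by
  intro h; have := hq.norm_lt_one k; simp [h] at this

theorem ne_zero (hq : IsInnerRoots m q) (k : Fin (m - 1)) : q k ≠ 0 := by
  intro h
  have h1 := ((hq.2 (q k)).1 ⟨k, rfl⟩).1
  rw [h, aeval_def, eval₂_at_zero, eulerFrobenius_coeff_zero] at h1
  simp at h1

theorem geomMoment_eq_zero (hq : IsInnerRoots m q) (k : Fin (m - 1)) :
    geomMoment (2 * m - 1) (q k) = 0 := by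
  have hm := k.2
  have : 2 * m - 1 = 2 * m - 2 + 1 := by omega
  rw [this, geomMoment_succ _ (hq.ne_one k), ((hq.2 (q k)).1 ⟨k, rfl⟩).1]
  simp

theorem geomMoment_inv_eq_zero (hq : IsInnerRoots m q) (k : Fin (m - 1)) :
    geomMoment (2 * m - 1) (q k)⁻¹ = 0 := by
  have hm := k.2
  rw [geomMoment_inv (by omega) (hq.ne_zero k) (hq.ne_one k), hq.geomMoment_eq_zero k, mul_zero]

end IsInnerRoots

end eulerFrobenius

/-! ### Analytically continued sums and integrals as functionals on polynomials -/

section umbral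
open Polynomial

/-- The linear functional on polynomials with `X ^ n ↦ μ n`. -/
def umbral (μ : ℕ → ℂ) : ℂ[X] →ₗ[ℂ] ℂ := (Polynomial.basisMonomials ℂ).constr ℂ μ

theorem basisMonomials_eq_X_pow (n : ℕ) : Polynomial.basisMonomials ℂ n = X ^ n := by
  rw [coe_basisMonomials]; exact (X_pow_eq_monomial n).symm

@[simp] theorem umbral_X_pow (μ : ℕ → ℂ) (n : ℕ) : umbral μ (X ^ n) = μ n := by
  have h := (Polynomial.basisMonomials ℂ).constr_basis ℂ μ n
  rwa [basisMonomials_eq_X_pow] at h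

theorem umbral_X_add_C_pow (μ : ℕ → ℂ) (x : ℂ) (n : ℕ) :
    umbral μ ((X + C x) ^ n)
      = ∑ i ∈ Finset.range (n + 1), x ^ (n - i) * (n.choose i : ℂ) * μ i := by
  rw [add_pow, map_sum]
  refine Finset.sum_congr rfl fun i _ => ?_
  have : (X : ℂ[X]) ^ i * C x ^ (n - i) * (n.choose i : ℂ[X])
      = (x ^ (n - i) * (n.choose i : ℂ)) • X ^ i := by
    rw [smul_eq_C_mul, map_mul, map_pow, map_natCast]; ring
  rw [this, map_smul, umbral_X_pow, smul_eq_mul]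

theorem linearMap_ext_X_pow {f g : ℂ[X] →ₗ[ℂ] ℂ} (h : ∀ n, f (X ^ n) = g (X ^ n)) : f = g := by
  refine (Polynomial.basisMonomials ℂ).ext fun n => ?_
  rw [basisMonomials_eq_X_pow]; exact h n

theorem taylor_X_pow (x : ℂ) (n : ℕ) : taylor x (X ^ n : ℂ[X]) = (X + C x) ^ n := by
  simp [taylor_apply]

/-- The functional `p ↦ ∑_{γ ≥ 1} z^γ p(γ)`, continued analytically to `z ≠ 1`. -/
def geomSum (z : ℂ) : ℂ[X] →ₗ[ℂ] ℂ := umbral (fun j => geomMoment j z)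

theorem geomSum_functional {z : ℂ} (hz : z ≠ 1) (p : ℂ[X]) :
    geomSum z p = z * (p.eval 1 + geomSum z (taylor 1 p)) := by
  have h : geomSum z = z • (leval 1 + geomSum z ∘ₗ taylor (1 : ℂ)) := by
    refine linearMap_ext_X_pow fun n => ?_
    simp only [LinearMap.smul_apply, LinearMap.add_apply, LinearMap.comp_apply, leval_apply,
      smul_eq_mul]
    change _ = z * (_ + geomSum z (taylor 1 (X ^ n)))
    rw [taylor_X_pow, geomSum, umbral_X_add_C_pow, umbral_X_pow, geomMoment_functional n hz]
    simp
  exact congrArg (fun f : ℂ[X] →ₗ[ℂ] ℂ => f p) h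

/-- Peeling off M terms with the shift relation expresses a finite sum through two continued
infinite ones, without requiring |z| < 1; this is needed for 1/q_k and for λ. -/
theorem geomSum_eq_sum_add {z : ℂ} (hz : z ≠ 1) (p : ℂ[X]) (M : ℕ) :
    geomSum z p = ∑ γ ∈ Finset.range M, z ^ (γ + 1) * p.eval ((γ : ℂ) + 1)
      + z ^ M * geomSum z (taylor (M : ℂ) p) := by
  induction M with
  | zero => simp
  | succ M ih =>
    rw [ih, Finset.sum_range_succ, geomSum_functional hz (taylor (M : ℂ) p), taylor_taylor,
      taylor_eval]
    push_cast
    rw [add_comm (1 : ℂ) (M : ℂ)]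
    ring

/-- The functional `p ↦ ∫_0^∞ e^{wt} p(t) dt`, continued analytically to `w ≠ 0`. -/
def laplace (w : ℂ) : ℂ[X] →ₗ[ℂ] ℂ :=
  umbral (fun n => (-1) ^ (n + 1) * (n.factorial : ℂ) / w ^ (n + 1))

/-- Integration by parts for the formal integral; only the boundary term at 0 survives. -/
theorem laplace_derivative {w : ℂ} (hw : w ≠ 0) (p : ℂ[X]) :
    w * laplace w p + laplace w (derivative p) = - p.eval 0 := by
  have h : w • laplace w + laplace w ∘ₗ derivative = - leval 0 := by
    refine linearMap_ext_X_pow fun n => ?_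
    simp only [LinearMap.smul_apply, LinearMap.add_apply, LinearMap.comp_apply, leval_apply,
      smul_eq_mul, LinearMap.neg_apply]
    rcases n with _ | n
    · rw [laplace, umbral_X_pow]; simp; field_simp
    · have : derivative (X ^ (n + 1) : ℂ[X]) = ((n : ℂ) + 1) • X ^ n := by
        rw [derivative_X_pow, smul_eq_C_mul]; simp
      rw [this, map_smul, laplace, umbral_X_pow, umbral_X_pow, Nat.factorial_succ]
      simp only [eval_pow, eval_X, smul_eq_mul]
      push_cast
      field_simp
      ring
  exact congrArg (fun f : ℂ[X] →ₗ[ℂ] ℂ => f p) h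

theorem hasDerivAt_umbral_taylor (μ : ℕ → ℂ) (p : ℂ[X]) (t : ℂ) :
    HasDerivAt (fun t => umbral μ (taylor t p)) (umbral μ (taylor t (derivative p))) t := by
  induction p using Polynomial.induction_on' with
  | add p q hp hq =>
    simp only [map_add]
    exact hp.add hq
  | monomial n c =>
    rw [← C_mul_X_pow_eq_monomial, ← smul_eq_C_mul]
    simp only [map_smul, taylor_X_pow, umbral_X_add_C_pow]
    refine HasDerivAt.const_smul c ?_
    rcases n with _ | n
    · simpa using hasDerivAt_const t (μ 0)
    have e : derivative (X ^ (n + 1) : ℂ[X]) = ((n : ℂ) + 1) • X ^ n := by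
      rw [derivative_X_pow, smul_eq_C_mul]; simp
    rw [e, map_smul, map_smul, taylor_X_pow, umbral_X_add_C_pow]
    have h : ∀ i ∈ Finset.range (n + 1 + 1),
        HasDerivAt (fun t : ℂ => t ^ (n + 1 - i) * ((n + 1).choose i : ℂ) * μ i)
          ((((n + 1 - i : ℕ) : ℂ) * t ^ (n + 1 - i - 1)) * ((n + 1).choose i : ℂ) * μ i) t :=
      fun i _ => ((hasDerivAt_pow _ t).mul_const _).mul_const _
    have hs := HasDerivAt.fun_sum h
    convert hs using 1
    rw [Finset.sum_range_succ _ (n + 1)]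
    simp only [Nat.sub_self, Nat.cast_zero, zero_mul, add_zero, smul_eq_mul]
    rw [Finset.mul_sum]
    refine Finset.sum_congr rfl fun i hi => ?_
    have hc := Nat.choose_mul_succ_eq n i
    have hc' : (n.choose i : ℂ) * ((n : ℂ) + 1)
        = ((n + 1).choose i : ℂ) * ((n + 1 - i : ℕ) : ℂ) := by exact_mod_cast hc
    have : n + 1 - i - 1 = n - i := by omega
    rw [this]
    linear_combination t ^ (n - i) * μ i * hc'

/-- The continuous counterpart of `geomSum_eq_sum_add`: minus the formal tail from t, e^{wt} times
the formal integral of p(· + t), is an antiderivative of the integrand. -/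
theorem integral_exp_mul_eval {w : ℂ} (hw : w ≠ 0) (p : ℂ[X]) (M : ℝ) :
    ∫ t in (0 : ℝ)..M, Complex.exp (w * t) * p.eval (t : ℂ)
      = laplace w p - Complex.exp (w * M) * laplace w (taylor (M : ℂ) p) := by
  have hd : ∀ t : ℝ, HasDerivAt
      (fun t : ℝ => -(Complex.exp (w * t) * laplace w (taylor (t : ℂ) p)))
      (Complex.exp (w * t) * p.eval (t : ℂ)) t := by
    intro t
    have h1 : HasDerivAt (fun z : ℂ => Complex.exp (w * z)) (Complex.exp (w * t) * (w * 1)) t :=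
      ((hasDerivAt_id (t : ℂ)).const_mul w).cexp
    have h2 := (h1.mul (hasDerivAt_umbral_taylor
      (fun n => (-1) ^ (n + 1) * (n.factorial : ℂ) / w ^ (n + 1)) p t)).neg.comp_ofReal
    refine h2.congr_deriv ?_
    have h3 := laplace_derivative hw (taylor (t : ℂ) p)
    have h4 : derivative (taylor (t : ℂ) p) = taylor (t : ℂ) (derivative p) := by
      simp [taylor_apply, derivative_comp]
    rw [h4, taylor_eval, zero_add] at h3
    simp only [laplace] at h3
    linear_combination (-Complex.exp (w * t)) * h3
  rw [intervalIntegral.integral_eq_sub_of_hasDerivAt (fun t _ => hd t)]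
  · simp; ring
  · apply Continuous.intervalIntegrable
    fun_prop

/-- Vanishing of the moments of a combination of geometric sequences with different ratios forces
the combination to be trivial. -/
theorem eq_zero_of_sum_geomMoment_eq_zero {κ : Type*} [Fintype κ] (ζ d : κ → ℂ)
    (hζ : Function.Injective ζ) (h0 : ∀ x, ζ x ≠ 0) (h1 : ∀ x, ζ x ≠ 1) (M : ℕ)
    (hM : Fintype.card κ ≤ M) (h : ∀ j < M, ∑ x, d x * geomMoment j (ζ x) = 0) (x : κ) :
    d x = 0 := by
  classical
  set s : κ → ℂ := fun x => ζ x / (1 - ζ x) with hs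
  -- The hypotheses say that p ↦ ∑ d_x p(s_x) kills P_0, …, P_{M-1}. Since P_j has degree exactly j
  -- + 1 and no constant term, these span the polynomials of degree at most M that vanish at 0.
  have key : ∀ n ≤ M, ∀ p : ℂ[X], p.natDegree ≤ n → p.eval 0 = 0 →
      ∑ x, d x * p.eval (s x) = 0 := by
    intro n
    induction n with
    | zero =>
      intro _ p hp hp0
      rw [eq_C_of_natDegree_le_zero hp] at hp0 ⊢
      simp at hp0
      simp [hp0]
    | succ n ih =>
      intro hn p hp hp0
      set P := (geomPoly n).map (algebraMap ℝ ℂ) with hP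
      have hPd : P.natDegree = n + 1 := by rw [hP, natDegree_map, (natDegree_geomPoly n).1]
      have hPl : P.coeff (n + 1) = n.factorial := by
        rw [hP, coeff_map]
        have := (natDegree_geomPoly n).2
        rw [leadingCoeff, (natDegree_geomPoly n).1] at this
        rw [this]; simp
      have hP0 : P.eval 0 = 0 := by
        rw [hP]; cases n <;> simp [geomPoly]
      have hf : (n.factorial : ℂ) ≠ 0 := Nat.cast_ne_zero.2 n.factorial_ne_zero
      set c : ℂ := p.coeff (n + 1) / n.factorial with hc
      have hr : (p - C c * P).natDegree ≤ n := by
        rw [natDegree_le_iff_coeff_eq_zero]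
        intro i hi
        rw [coeff_sub, coeff_C_mul]
        rcases Nat.lt_or_ge (n + 1) i with h' | h'
        · rw [coeff_eq_zero_of_natDegree_lt (by omega),
            coeff_eq_zero_of_natDegree_lt (by omega)]; simp
        · obtain rfl : i = n + 1 := by omega
          rw [hPl, hc]; field_simp; simp
      have h2 := ih (by omega) (p - C c * P) hr (by simp [hp0, hP0])
      have h3 : ∑ x, d x * P.eval (s x) = 0 := by
        rw [← h n (by omega)]
        refine Finset.sum_congr rfl fun x _ => ?_
        rw [hP, eval_map_algebraMap, geomMoment]
      have : ∑ x, d x * p.eval (s x)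
          = ∑ x, d x * (p - C c * P).eval (s x) + c * ∑ x, d x * P.eval (s x) := by
        rw [Finset.mul_sum, ← Finset.sum_add_distrib]
        refine Finset.sum_congr rfl fun x _ => ?_
        simp; ring
      rw [this, h2, h3]; simp
  have hsinj : Function.Injective s := by
    intro y z hyz
    have hy := sub_ne_zero.2 (h1 y).symm
    have hz := sub_ne_zero.2 (h1 z).symm
    simp only [hs] at hyz
    field_simp at hyz
    exact hζ (by linear_combination hyz)
  -- A Lagrange polynomial isolating s_x; the factor X supplies p(0) = 0 and is harmless because s_x
  -- ≠ 0.
  set p : ℂ[X] := X * ∏ y ∈ Finset.univ.erase x, (X - C (s y)) with hp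
  have hpd : p.natDegree ≤ M := by
    refine natDegree_mul_le.trans ?_
    rw [natDegree_X, natDegree_prod_of_monic _ _ (fun y _ => monic_X_sub_C _)]
    simp only [natDegree_X_sub_C, Finset.sum_const, smul_eq_mul, mul_one]
    rw [Finset.card_erase_of_mem (Finset.mem_univ x), Finset.card_univ]
    have : 0 < Fintype.card κ := Fintype.card_pos_iff.2 ⟨x⟩
    omega
  have hk := key M le_rfl p hpd (by simp [hp])
  rw [Finset.sum_eq_single x] at hk
  · refine (mul_eq_zero.1 hk).resolve_right ?_
    simp only [hp, eval_mul, eval_X, eval_prod, eval_sub, eval_C]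
    refine mul_ne_zero (div_ne_zero (h0 x) (sub_ne_zero.2 (h1 x).symm)) ?_
    refine Finset.prod_ne_zero_iff.2 fun y hy => sub_ne_zero.2 fun h => ?_
    exact (Finset.mem_erase.1 hy).1 (hsinj h.symm)
  · intro y _ hy
    simp only [hp, eval_mul, eval_X, eval_prod, eval_sub, eval_C]
    rw [Finset.prod_eq_zero (Finset.mem_erase.2 ⟨hy, Finset.mem_univ y⟩) (sub_self _)]
    simp
  · simp

/-! ### Combinations of geometric sequences against an exponential weight -/

section combination

variable {κ : Type*} [Fintype κ] (ζ d : κ → ℂ) (σ w c₀ : ℂ)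

/-- The functional
`p ↦ ∑_{γ ≥ 1} (∑_x d_x ζ_x^γ) p(γ) + c₀ p(0) - σ ∫_0^∞ e^{wt} p(t) dt`, continued analytically. -/
def leftMoments : ℂ[X] →ₗ[ℂ] ℂ :=
  ∑ x, d x • geomSum (ζ x) + c₀ • leval 0 - σ • laplace w

theorem leftMoments_apply (p : ℂ[X]) : leftMoments ζ d σ w c₀ p
    = ∑ x, d x * geomSum (ζ x) p + c₀ * p.eval 0 - σ * laplace w p := by
  simp [leftMoments, LinearMap.sum_apply]

theorem sum_geom_mul_eval (hζ : ∀ x, ζ x ≠ 1) (p : ℂ[X]) (M : ℕ) :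
    ∑ γ ∈ Finset.range M, (∑ x, d x * ζ x ^ (γ + 1)) * p.eval ((γ : ℂ) + 1)
      = ∑ x, d x * geomSum (ζ x) p
        - ∑ x, d x * ζ x ^ M * geomSum (ζ x) (taylor (M : ℂ) p) := by
  rw [← Finset.sum_sub_distrib]
  simp only [Finset.sum_mul]
  rw [Finset.sum_comm]
  refine Finset.sum_congr rfl fun x _ => ?_
  rw [geomSum_eq_sum_add (hζ x) p M, mul_add, Finset.mul_sum, ← mul_assoc, add_sub_cancel_right]
  exact Finset.sum_congr rfl fun γ _ => by ring

theorem geomSum_neg_X_pow (z : ℂ) (n : ℕ) :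
    geomSum z ((-X) ^ n) = (-1) ^ n * geomMoment n z := by
  have : (-X : ℂ[X]) ^ n = ((-1 : ℂ) ^ n) • X ^ n := by
    rw [neg_pow, smul_eq_C_mul]; simp
  rw [this, map_smul, geomSum, umbral_X_pow, smul_eq_mul]

theorem laplace_neg_X_pow (n : ℕ) :
    laplace w ((-X) ^ n) = - (n.factorial : ℂ) / w ^ (n + 1) := by
  have : (-X : ℂ[X]) ^ n = ((-1 : ℂ) ^ n) • X ^ n := by
    rw [neg_pow, smul_eq_C_mul]; simp
  rw [this, map_smul, laplace, umbral_X_pow, smul_eq_mul, pow_succ (-1 : ℂ)]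
  have h : (-1 : ℂ) ^ n * (-1) ^ n = 1 := by rw [← mul_pow]; simp
  linear_combination (-(n.factorial : ℂ) / w ^ (n + 1)) * h

theorem taylor_sub_X_pow (b : ℂ) (n : ℕ) : taylor b ((C b - X) ^ n : ℂ[X]) = (-X) ^ n := by
  simp [taylor_apply]

/-- The convolution with the truncated power is a polynomial on the grid. -/
theorem convolution_eq_leftMoments (hζ : ∀ x, ζ x ≠ 1) (hw : w ≠ 0) {n : ℕ} (hn : 1 ≤ n)
    (hK : ∀ β : ℕ, ∑ x, d x * ζ x ^ β * geomMoment n (ζ x) * (-1) ^ n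
      + σ * Complex.exp (w * β) * (n.factorial : ℂ) / w ^ (n + 1) = 0)
    (β : ℕ) (hβ : 1 ≤ β) (c : ℕ → ℂ) (hc0 : c 0 = c₀)
    (hc : ∀ γ, 1 ≤ γ → γ < β → c γ = ∑ x, d x * ζ x ^ γ) :
    ∑ γ ∈ Finset.range β, c γ * ((β : ℂ) - γ) ^ n
      - σ * ∫ t in (0 : ℝ)..β, Complex.exp (w * t) * ((β : ℂ) - t) ^ n
      = leftMoments ζ d σ w c₀ ((C (β : ℂ) - X) ^ n) := by
  have hI := integral_exp_mul_eval hw ((C (β : ℂ) - X) ^ n) β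
  simp only [eval_pow, eval_sub, eval_C, eval_X] at hI
  rw [hI]
  have hS := sum_geom_mul_eval ζ d hζ ((C (β : ℂ) - X) ^ n) β
  simp only [eval_pow, eval_sub, eval_C, eval_X] at hS
  obtain ⟨M, rfl⟩ : ∃ M, β = M + 1 := ⟨β - 1, by omega⟩
  rw [Finset.sum_range_succ] at hS
  -- The kernel vanishes at γ = β because n ≥ 1. Hence the value c β never enters, and β may be the
  -- end node, whose coefficient is not of interior form.
  have hz : (((M + 1 : ℕ) : ℂ) - ((M : ℂ) + 1)) ^ n = 0 := by
    push_cast; rw [sub_self, zero_pow (by omega)]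
  rw [hz, mul_zero, add_zero] at hS
  rw [Finset.sum_range_succ', hc0]
  have hS' : ∑ γ ∈ Finset.range M, c (γ + 1) * (((M + 1 : ℕ) : ℂ) - ((γ + 1 : ℕ) : ℂ)) ^ n
      = ∑ γ ∈ Finset.range M, (∑ x, d x * ζ x ^ (γ + 1))
          * (((M + 1 : ℕ) : ℂ) - ((γ : ℂ) + 1)) ^ n := by
    refine Finset.sum_congr rfl fun γ hγ => ?_
    rw [hc (γ + 1) (by omega) (by have := Finset.mem_range.1 hγ; omega)]
    push_cast; rfl
  rw [hS', hS, leftMoments_apply]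
  simp only [Complex.ofReal_natCast, taylor_sub_X_pow, geomSum_neg_X_pow, laplace_neg_X_pow]
  -- Recentred at β the kernel is (-X)^n, so the terms from the far end contain only moments of
  -- order n, which cancel by `hK`.
  have h := hK (M + 1)
  have h' : ∑ x, d x * ζ x ^ (M + 1) * ((-1) ^ n * geomMoment n (ζ x))
      = ∑ x, d x * ζ x ^ (M + 1) * geomMoment n (ζ x) * (-1) ^ n :=
    Finset.sum_congr rfl fun x _ => by ring
  rw [h']
  simp only [eval_pow, eval_sub, eval_C, eval_X, Nat.cast_zero]
  linear_combination (-1) * h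

/-- Sum and integral are both split into a contribution of the end 0 and one of the end N. The
middle term on the right corrects for c N not being of interior form. -/
theorem functional_eq_leftMoments (hζ : ∀ x, ζ x ≠ 1) (hw : w ≠ 0) {N : ℕ} (hN : 1 ≤ N)
    (c : ℕ → ℂ) (hc0 : c 0 = c₀) (hc : ∀ γ, 1 ≤ γ → γ < N → c γ = ∑ x, d x * ζ x ^ γ)
    (p : ℂ[X]) :
    σ * (∫ t in (0 : ℝ)..N, Complex.exp (w * t) * p.eval (t : ℂ))
      - ∑ γ ∈ Finset.range (N + 1), c γ * p.eval (γ : ℂ)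
      = - leftMoments ζ d σ w c₀ p
        + (∑ x, d x * ζ x ^ N * geomSum (ζ x) (taylor (N : ℂ) p)
          + (∑ x, d x * ζ x ^ N - c N) * p.eval (N : ℂ)
          - σ * Complex.exp (w * N) * laplace w (taylor (N : ℂ) p)) := by
  have hI := integral_exp_mul_eval hw p N
  have hS := sum_geom_mul_eval ζ d hζ p N
  rw [hI, leftMoments_apply]
  obtain ⟨M, rfl⟩ : ∃ M, N = M + 1 := ⟨N - 1, by omega⟩
  rw [Finset.sum_range_succ] at hS
  rw [Finset.sum_range_succ, Finset.sum_range_succ', hc0]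
  have hS' : ∑ γ ∈ Finset.range M, c (γ + 1) * p.eval ((γ + 1 : ℕ) : ℂ)
      = ∑ γ ∈ Finset.range M, (∑ x, d x * ζ x ^ (γ + 1)) * p.eval ((γ : ℂ) + 1) := by
    refine Finset.sum_congr rfl fun γ hγ => ?_
    rw [hc (γ + 1) (by omega) (by have := Finset.mem_range.1 hγ; omega)]
    push_cast; rfl
  rw [hS', eq_sub_of_add_eq hS]
  simp only [Complex.ofReal_natCast, Nat.cast_zero]
  push_cast
  ring

end combination

end umbral

/-! ### Iterated primitives -/

/-- The primitive of `f` that vanishes at `0`. -/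
def primitive (f : ℝ → ℂ) (x : ℝ) : ℂ := ∫ t in (0 : ℝ)..x, f t

theorem locallyIntegrable_intervalIntegrable {f : ℝ → ℂ} (hf : LocallyIntegrable f volume)
    (a b : ℝ) : IntervalIntegrable f volume a b :=
  (hf.integrableOn_isCompact isCompact_uIcc).intervalIntegrable

theorem continuous_primitive {f : ℝ → ℂ} (hf : LocallyIntegrable f volume) :
    Continuous (primitive f) :=
  intervalIntegral.continuous_primitive (locallyIntegrable_intervalIntegrable hf) 0

theorem locallyIntegrable_primitive_iterate {f : ℝ → ℂ} (hf : LocallyIntegrable f volume)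
    (k : ℕ) : LocallyIntegrable (primitive^[k] f) volume := by
  induction k with
  | zero => exact hf
  | succ k ih =>
    rw [Function.iterate_succ_apply']; exact (continuous_primitive ih).locallyIntegrable

theorem continuous_primitive_iterate {f : ℝ → ℂ} (hf : LocallyIntegrable f volume)
    (k : ℕ) : Continuous (primitive^[k + 1] f) := by
  rw [Function.iterate_succ_apply']
  exact continuous_primitive (locallyIntegrable_primitive_iterate hf k)

theorem hasDerivAt_primitive {f : ℝ → ℂ} (hf : Continuous f) (x : ℝ) :
    HasDerivAt (primitive f) (f x) x :=
  intervalIntegral.integral_hasDerivAt_right (hf.intervalIntegrable _ _)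
    (hf.stronglyMeasurableAtFilter _ _) hf.continuousAt

theorem primitive_zero (f : ℝ → ℂ) : primitive f 0 = 0 := by simp [primitive]

/-- Fubini's theorem on a triangle. -/
theorem integral_triangle {G : ℝ → ℝ → ℂ} (hG : Continuous (Function.uncurry G)) {g : ℝ → ℂ}
    (hg : LocallyIntegrable g volume) {b : ℝ} (hb : 0 ≤ b) :
    ∫ y in (0 : ℝ)..b, ∫ t in (0 : ℝ)..y, G y t * g t
      = ∫ t in (0 : ℝ)..b, ∫ y in t..b, G y t * g t := by
  set μ := volume.restrict (Ioc (0 : ℝ) b) with hμ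
  have hg' : Integrable g μ := (locallyIntegrable_intervalIntegrable hg 0 b).1
  have hT : MeasurableSet {p : ℝ × ℝ | p.2 ≤ p.1} := measurableSet_le measurable_snd measurable_fst
  have hint : Integrable (Function.uncurry fun y t => if t ≤ y then G y t * g t else 0)
      (μ.prod μ) := by
    have h1 : Integrable (fun p : ℝ × ℝ => g p.2) (μ.prod μ) := hg'.comp_snd μ
    obtain ⟨B, hB⟩ := (isCompact_Icc.prod isCompact_Icc :
      IsCompact (Icc (0 : ℝ) b ×ˢ Icc (0 : ℝ) b)).exists_bound_of_continuousOn hG.continuousOn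
    have hmem : ∀ᵐ p ∂(μ.prod μ), p ∈ Icc (0 : ℝ) b ×ˢ Icc (0 : ℝ) b := by
      rw [hμ, Measure.prod_restrict]
      filter_upwards [ae_restrict_mem (measurableSet_Ioc.prod measurableSet_Ioc)] with p hp
      exact ⟨Ioc_subset_Icc_self hp.1, Ioc_subset_Icc_self hp.2⟩
    have h2 : Integrable (fun p : ℝ × ℝ => G p.1 p.2 * g p.2) (μ.prod μ) := by
      refine h1.bdd_mul (c := B) hG.aestronglyMeasurable ?_
      filter_upwards [hmem] with p hp using hB p hp
    refine (h2.indicator hT).congr (Filter.Eventually.of_forall fun p => ?_)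
    simp [Function.uncurry, indicator]
  have hsw := integral_integral_swap hint
  have hl : ∫ y in (0 : ℝ)..b, ∫ t in (0 : ℝ)..y, G y t * g t
      = ∫ y, ∫ t, (if t ≤ y then G y t * g t else 0) ∂μ ∂μ := by
    rw [intervalIntegral.integral_of_le hb]
    refine setIntegral_congr_fun measurableSet_Ioc fun y hy => ?_
    rw [intervalIntegral.integral_of_le hy.1.le]
    have : (fun t => if t ≤ y then G y t * g t else 0)
        = (Iic y).indicator (fun t => G y t * g t) := by ext t; simp [indicator]
    rw [this, integral_indicator measurableSet_Iic, hμ, Measure.restrict_restrict measurableSet_Iic]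
    congr 2
    ext t; simp only [mem_inter_iff, mem_Ioc, mem_Iic]
    exact ⟨fun h => ⟨h.2, h.1, h.2.trans hy.2⟩, fun h => ⟨h.2.1, h.1⟩⟩
  have hr : ∫ t in (0 : ℝ)..b, ∫ y in t..b, G y t * g t
      = ∫ t, ∫ y, (if t ≤ y then G y t * g t else 0) ∂μ ∂μ := by
    rw [intervalIntegral.integral_of_le hb]
    refine setIntegral_congr_fun measurableSet_Ioc fun t ht => ?_
    rw [intervalIntegral.integral_of_le ht.2]
    have : (fun y => if t ≤ y then G y t * g t else 0)
        = (Ici t).indicator (fun y => G y t * g t) := by ext y; simp [indicator]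
    rw [this, integral_indicator measurableSet_Ici, hμ, Measure.restrict_restrict measurableSet_Ici,
      ← integral_Icc_eq_integral_Ioc]
    congr 2
    ext y; simp only [mem_inter_iff, mem_Ioc, mem_Ici, mem_Icc]
    exact ⟨fun h => ⟨h.1, ht.1.trans_le h.1, h.2⟩, fun h => ⟨h.1, h.2.2⟩⟩
  rw [hl, hr, hsw]

theorem integral_sub_pow_div_factorial (k : ℕ) (s x : ℝ) :
    ∫ t in s..x, ((x : ℂ) - t) ^ k / (k.factorial : ℂ)
      = ((x : ℂ) - s) ^ (k + 1) / ((k + 1).factorial : ℂ) := by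
  have hd : ∀ t : ℝ, HasDerivAt
      (fun t : ℝ => -(((x : ℂ) - t) ^ (k + 1) / ((k + 1).factorial : ℂ)))
      (((x : ℂ) - t) ^ k / (k.factorial : ℂ)) t := by
    intro t
    have h := (((((hasDerivAt_id (t : ℂ)).const_sub (x : ℂ)).pow (k + 1)).div_const
      ((k + 1).factorial : ℂ)).neg).comp_ofReal
    refine h.congr_deriv ?_
    have h1 : (k.factorial : ℂ) ≠ 0 := Nat.cast_ne_zero.2 k.factorial_ne_zero
    have h2 : (k : ℂ) + 1 ≠ 0 := Nat.cast_add_one_ne_zero k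
    simp only [Nat.factorial_succ, Nat.add_sub_cancel, id]
    push_cast
    field_simp
  rw [intervalIntegral.integral_eq_sub_of_hasDerivAt (fun t _ => hd t)]
  · simp
  · apply Continuous.intervalIntegrable; fun_prop

/-- Cauchy's formula for repeated integration. -/
theorem primitive_iterate_eq {f : ℝ → ℂ} (hf : LocallyIntegrable f volume) (k : ℕ) {x : ℝ}
    (hx : 0 ≤ x) :
    primitive^[k + 1] f x
      = ∫ t in (0 : ℝ)..x, ((x : ℂ) - t) ^ k / (k.factorial : ℂ) * f t := by
  induction k generalizing f with
  | zero => simp [primitive]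
  | succ k ih =>
    rw [Function.iterate_succ_apply, ih (continuous_primitive hf).locallyIntegrable]
    have h : ∀ t : ℝ, ((x : ℂ) - t) ^ k / (k.factorial : ℂ) * primitive f t
        = ∫ s in (0 : ℝ)..t, ((x : ℂ) - t) ^ k / (k.factorial : ℂ) * f s := fun t => by
      rw [intervalIntegral.integral_const_mul]; rfl
    simp only [h]
    rw [integral_triangle (G := fun y _ => ((x : ℂ) - y) ^ k / (k.factorial : ℂ))
      (by unfold Function.uncurry; fun_prop) hf hx]
    refine intervalIntegral.integral_congr fun t _ => ?_
    rw [intervalIntegral.integral_mul_const, integral_sub_pow_div_factorial]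

theorem absolutelyContinuous_primitive {g : ℝ → ℂ} (hg : LocallyIntegrable g volume) (a b : ℝ)
    (h0 : 0 ∈ uIcc a b) : AbsolutelyContinuousOnInterval (primitive g) a b := by
  have hi := locallyIntegrable_intervalIntegrable hg
  have hre : ∀ a b, IntervalIntegrable (fun t => (g t).re) volume a b :=
    fun a b => ⟨(hi a b).1.re, (hi a b).2.re⟩
  have him : ∀ a b, IntervalIntegrable (fun t => (g t).im) volume a b :=
    fun a b => ⟨(hi a b).1.im, (hi a b).2.im⟩
  have hc : ∀ c : ℂ, AbsolutelyContinuousOnInterval (fun _ : ℝ => c) a b := fun c =>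
    (contDiff_const (n := 1)).contDiffOn.absolutelyContinuousOnInterval
  have h1 := ((hre a b).absolutelyContinuousOnInterval_intervalIntegral h0).fun_smul (hc 1)
  have h2 := ((him a b).absolutelyContinuousOnInterval_intervalIntegral h0).fun_smul (hc Complex.I)
  have h3 := h1.fun_add h2
  have : primitive g = fun x => (∫ v in (0 : ℝ)..x, (g v).re) • (1 : ℂ)
      + (∫ v in (0 : ℝ)..x, (g v).im) • Complex.I := by
    ext x
    rw [primitive, ← intervalIntegral.integral_smul_const, ← intervalIntegral.integral_smul_const,
      ← intervalIntegral.integral_add]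
    · refine intervalIntegral.integral_congr fun t _ => ?_
      simp [Complex.re_add_im]
    · exact ⟨(hre 0 x).1.smul_const _, (hre 0 x).2.smul_const _⟩
    · exact ⟨(him 0 x).1.smul_const _, (him 0 x).2.smul_const _⟩
  rw [this]; exact h3

/-- The difference of `u` and the primitive is absolutely continuous with derivative zero almost
everywhere, hence constant. -/
theorem eq_add_primitive_of_ae_hasDerivAt {u g : ℝ → ℂ} {b : ℝ} (hb : 0 ≤ b)
    (hu : AbsolutelyContinuousOnInterval u 0 b) (hg : LocallyIntegrable g volume)
    (h : ∀ᵐ x, x ∈ uIcc 0 b → HasDerivAt u (g x) x) {x : ℝ} (hx : x ∈ Icc 0 b) :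
    u x = u 0 + primitive g x := by
  have hac := hu.fun_sub (absolutelyContinuous_primitive hg 0 b left_mem_uIcc)
  have hd := (locallyIntegrable_intervalIntegrable hg 0 b).ae_hasDerivAt_integral
  obtain ⟨c, hc⟩ := hac.const_of_ae_hasDerivAt_zero (by
    filter_upwards [h, hd] with y hy1 hy2 hy
    have := (hy1 hy).sub (hy2 hy 0 left_mem_uIcc)
    rwa [sub_self] at this)
  have e0 := hc 0 left_mem_uIcc
  have ex := hc x (by rwa [uIcc_of_le hb])
  rw [primitive_zero, sub_zero] at e0
  rw [e0, ← ex]; ring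

/-! ### Sobolev functions and iterated primitives -/

theorem intervalDeriv_succ (k : ℕ) (φ : ℝ → ℂ) :
    intervalDeriv (k + 1) φ = derivWithin (intervalDeriv k φ) (Icc 0 1) :=
  iteratedDerivWithin_succ

theorem ae_mem_Ioo_of_mem_uIcc : ∀ᵐ x : ℝ, x ∈ uIcc (0 : ℝ) 1 → x ∈ Ioo (0 : ℝ) 1 := by
  have h₁ : ∀ᵐ x : ℝ, x ≠ 0 := by simp [ae_iff, measure_singleton]
  have h₂ : ∀ᵐ x : ℝ, x ≠ 1 := by simp [ae_iff, measure_singleton]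
  filter_upwards [h₁, h₂] with x h1 h2 h
  rw [uIcc_of_le zero_le_one] at h
  exact ⟨lt_of_le_of_ne h.1 h1.symm, lt_of_le_of_ne h.2 h2⟩

/-- The derivative of order `m` on `[0,1]`, extended by zero. -/
def cutDeriv (m : ℕ) (φ : ℝ → ℂ) : ℝ → ℂ := (Icc (0 : ℝ) 1).indicator (intervalDeriv m φ)

theorem MemSobolev.locallyIntegrable_cutDeriv {m : ℕ} {φ : ℝ → ℂ} (h : MemSobolev m φ) :
    LocallyIntegrable (cutDeriv m φ) volume := by
  have h1 : Integrable (intervalDeriv m φ) (volume.restrict (Icc (0 : ℝ) 1)) :=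
    h.memLp.integrable one_le_two
  exact ((integrable_indicator_iff measurableSet_Icc).2 h1).locallyIntegrable

/-- Taylor's formula: a Sobolev function is a polynomial plus an iterated primitive. -/
theorem MemSobolev.exists_eq_add_primitive {k : ℕ} {φ : ℝ → ℂ} (h : MemSobolev (k + 1) φ) :
    ∃ p : Polynomial ℂ, p.natDegree ≤ k ∧ ∀ x ∈ Icc (0 : ℝ) 1,
      φ x = p.eval (x : ℂ) + primitive^[k + 1] (cutDeriv (k + 1) φ) x := by
  set g := cutDeriv (k + 1) φ with hg
  have hgi := h.locallyIntegrable_cutDeriv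
  have hcd := h.contDiffOn
  have hac := h.absolutelyContinuous
  simp only [Nat.add_sub_cancel] at hcd hac
  -- Descent through the derivatives: absolute continuity is needed only at order k, and every later
  -- integration is classical.
  suffices H : ∀ i ≤ k, ∃ p : Polynomial ℂ, p.natDegree ≤ i ∧ ∀ x ∈ Icc (0 : ℝ) 1,
      intervalDeriv (k - i) φ x = p.eval (x : ℂ) + primitive^[i + 1] g x by
    obtain ⟨p, hp, hx⟩ := H k le_rfl
    refine ⟨p, hp, fun x hx' => ?_⟩
    rw [← hx x hx', Nat.sub_self, intervalDeriv, iteratedDerivWithin_zero]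
  intro i
  induction i with
  | zero =>
    intro _
    refine ⟨Polynomial.C (intervalDeriv k φ 0), by simp, fun x hx => ?_⟩
    rw [Polynomial.eval_C, Nat.sub_zero]
    refine eq_add_primitive_of_ae_hasDerivAt zero_le_one hac hgi ?_ hx
    filter_upwards [hac.boundedVariationOn.ae_differentiableAt_of_mem_uIcc,
      ae_mem_Ioo_of_mem_uIcc] with y hy1 hy2 hy
    have hyo := hy2 hy
    have hd := (hy1 hy).hasDerivAt
    have : g y = deriv (intervalDeriv k φ) y := by
      rw [hg, cutDeriv, indicator_of_mem (Ioo_subset_Icc_self hyo), intervalDeriv_succ,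
        derivWithin_of_mem_nhds (Icc_mem_nhds hyo.1 hyo.2)]
    change HasDerivAt _ (g y) y
    rw [this]; exact hd
  | succ i ih =>
    intro hi
    obtain ⟨p, hp, hx⟩ := ih (by omega)
    have hki : k - i = (k - (i + 1)) + 1 := by omega
    set u := intervalDeriv (k - (i + 1)) φ with hu
    have hdu : DifferentiableOn ℝ u (Icc 0 1) :=
      hcd.differentiableOn_iteratedDerivWithin (by exact_mod_cast (by omega : k - (i + 1) < k))
        (uniqueDiffOn_Icc zero_lt_one)
    obtain ⟨P, hPd, hPe⟩ : ∃ P : Polynomial ℂ, P.natDegree ≤ i + 1 ∧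
        P.derivative = p := by
      refine ⟨∑ n ∈ Finset.range (i + 1),
        Polynomial.C (p.coeff n / ((n : ℂ) + 1)) * Polynomial.X ^ (n + 1), ?_, ?_⟩
      · refine Polynomial.natDegree_sum_le_of_forall_le _ _ fun n hn => ?_
        refine (Polynomial.natDegree_C_mul_X_pow_le _ _).trans ?_
        have := Finset.mem_range.1 hn; omega
      · conv_rhs => rw [p.as_sum_range_C_mul_X_pow' (n := i + 1) (by omega)]
        rw [Polynomial.derivative_sum]
        refine Finset.sum_congr rfl fun n _ => ?_
        rw [Polynomial.derivative_C_mul_X_pow]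
        congr 2
        have : (n : ℂ) + 1 ≠ 0 := Nat.cast_add_one_ne_zero n
        push_cast; field_simp
    have hdv : ∀ x : ℝ, HasDerivAt (fun x : ℝ => P.eval (x : ℂ) + primitive^[i + 2] g x)
        (p.eval (x : ℂ) + primitive^[i + 1] g x) x := by
      intro x
      have h1 : HasDerivAt (fun x : ℝ => P.eval (x : ℂ)) (p.eval (x : ℂ)) x := by
        rw [← hPe]; exact (P.hasDerivAt (x : ℂ)).comp_ofReal
      refine h1.add ?_
      rw [Function.iterate_succ_apply' _ (i + 1)]
      exact hasDerivAt_primitive (continuous_primitive_iterate hgi i) x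
    -- The constant matches the values at 0, where the iterated primitive vanishes.
    refine ⟨P + Polynomial.C (u 0 - P.eval 0), ?_, fun x hx' => ?_⟩
    · refine (Polynomial.natDegree_add_le _ _).trans ?_
      simp [hPd]
    have huniq : UniqueDiffOn ℝ (Icc (0 : ℝ) 1) := uniqueDiffOn_Icc zero_lt_one
    set v : ℝ → ℂ := fun x => (u 0 - P.eval 0) + (P.eval (x : ℂ) + primitive^[i + 2] g x) with hv
    have hdv' : ∀ x : ℝ, HasDerivAt v (p.eval (x : ℂ) + primitive^[i + 1] g x) x :=
      fun x => (hdv x).const_add _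
    have heq := eq_of_derivWithin_eq (f := u) (g := v) hdu
      (fun y _ => (hdv' y).differentiableAt.differentiableWithinAt)
      (fun y hy => by
        have hy' := Ico_subset_Icc_self hy
        rw [(hdv' y).hasDerivWithinAt.derivWithin (huniq y hy'), ← hx y hy', hki,
          intervalDeriv_succ])
      (by
        simp only [hv]
        rw [Function.iterate_succ_apply' _ (i + 1), primitive_zero]; simp)
    rw [heq x hx']
    simp only [hv, Polynomial.eval_add, Polynomial.eval_C]
    ring

theorem intervalDeriv_primitive_iterate {g : ℝ → ℂ} (hg : LocallyIntegrable g volume) {k i : ℕ}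
    (hi : i ≤ k) {x : ℝ} (hx : x ∈ Icc (0 : ℝ) 1) :
    intervalDeriv i (primitive^[k + 1] g) x = primitive^[k - i + 1] g x := by
  induction i generalizing x with
  | zero => rw [intervalDeriv, iteratedDerivWithin_zero]; rfl
  | succ i ih =>
    rw [intervalDeriv_succ, derivWithin_congr (fun y hy => ih (by omega) hy) (ih (by omega) hx)]
    have : k - i + 1 = (k - (i + 1) + 1) + 1 := by omega
    rw [this, Function.iterate_succ_apply']
    exact (hasDerivAt_primitive (continuous_primitive_iterate hg _) x).hasDerivWithinAt.derivWithin
      (uniqueDiffOn_Icc zero_lt_one x hx)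

theorem contDiff_primitive_iterate {g : ℝ → ℂ} (hg : LocallyIntegrable g volume) (k : ℕ) :
    ContDiff ℝ (k : ℕ) (primitive^[k + 1] g) := by
  induction k with
  | zero => exact contDiff_zero.2 (continuous_primitive_iterate hg 0)
  | succ k ih =>
    have hd : ∀ x, HasDerivAt (primitive^[k + 2] g) (primitive^[k + 1] g x) x := by
      intro x
      rw [Function.iterate_succ_apply' _ (k + 1)]
      exact hasDerivAt_primitive (continuous_primitive_iterate hg k) x
    have := (contDiff_succ_iff_deriv (𝕜 := ℝ) (n := (k : ℕ)) (f := primitive^[k + 2] g)).2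
      ⟨fun x => (hd x).differentiableAt, by simp, by
        have : deriv (primitive^[k + 2] g) = primitive^[k + 1] g := funext fun x => (hd x).deriv
        rw [this]; exact ih⟩
    exact_mod_cast this

theorem ae_intervalDeriv_primitive_iterate {g : ℝ → ℂ} (hg : LocallyIntegrable g volume) (k : ℕ) :
    ∀ᵐ x ∂(volume.restrict (Icc (0 : ℝ) 1)), intervalDeriv (k + 1) (primitive^[k + 1] g) x = g x := by
  rw [ae_restrict_iff' measurableSet_Icc]
  filter_upwards [(locallyIntegrable_intervalIntegrable hg 0 1).ae_hasDerivAt_integral] with x hx hx'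
  have h1 : HasDerivAt (primitive g) (g x) x :=
    hx (by rwa [uIcc_of_le zero_le_one]) 0 left_mem_uIcc
  rw [intervalDeriv_succ, derivWithin_congr
    (fun y hy => intervalDeriv_primitive_iterate hg le_rfl hy)
    (intervalDeriv_primitive_iterate hg le_rfl hx')]
  simp only [Nat.sub_self, zero_add, Function.iterate_one]
  exact h1.hasDerivWithinAt.derivWithin (uniqueDiffOn_Icc zero_lt_one x hx')

/-- Any square integrable function is thus realised as a derivative of order k + 1, which provides
the extremal function of the error functional. -/
theorem memSobolev_primitive_iterate {g : ℝ → ℂ} (hg : LocallyIntegrable g volume)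
    (hg2 : MemLp g 2 (volume.restrict (Icc (0 : ℝ) 1))) (k : ℕ) :
    MemSobolev (k + 1) (primitive^[k + 1] g) where
  contDiffOn := (contDiff_primitive_iterate hg k).contDiffOn
  absolutelyContinuous := by
    have h := absolutelyContinuous_primitive hg 0 1 left_mem_uIcc
    simp only [Nat.add_sub_cancel]
    have heq : EqOn (intervalDeriv k (primitive^[k + 1] g)) (primitive g) (uIcc 0 1) := by
      intro x hx
      rw [uIcc_of_le zero_le_one] at hx
      rw [intervalDeriv_primitive_iterate hg le_rfl hx]; simp
    rw [absolutelyContinuousOnInterval_iff] at h ⊢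
    intro ε hε
    obtain ⟨δ, hδ, H⟩ := h ε hε
    refine ⟨δ, hδ, fun E hE1 hE2 => ?_⟩
    rw [Finset.sum_congr rfl fun i hi => ?_]
    · exact H E hE1 hE2
    · obtain ⟨h1, h2⟩ := hE1.1 i hi
      rw [heq h1, heq h2]
  memLp := (memLp_congr_ae (ae_intervalDeriv_primitive_iterate hg k)).2 hg2

/-! ### Truncated powers -/

/-- The truncated power `u_+^k / k!`. -/
def tpow (k : ℕ) (u : ℝ) : ℂ := if 0 < u then (u : ℂ) ^ k / (k.factorial : ℂ) else 0

theorem tpow_sub_left_eq (k : ℕ) (a : ℝ) : (fun t => tpow k (a - t))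
    = (Iio a).indicator (fun t : ℝ => ((a - t : ℝ) : ℂ) ^ k / (k.factorial : ℂ)) := by
  ext t; simp [tpow, indicator]

theorem tpow_sub_right_eq (k : ℕ) (a : ℝ) : (fun t => tpow k (t - a))
    = (Ioi a).indicator (fun t : ℝ => ((t - a : ℝ) : ℂ) ^ k / (k.factorial : ℂ)) := by
  ext t; simp [tpow, indicator]

theorem memLp_of_continuous {f : ℝ → ℂ} (hf : Continuous f) :
    MemLp f 2 (volume.restrict (Icc (0 : ℝ) 1)) := by
  obtain ⟨B, hB⟩ := isCompact_Icc.exists_bound_of_continuousOn (s := Icc (0 : ℝ) 1) hf.continuousOn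
  refine MemLp.of_bound hf.aestronglyMeasurable B ?_
  filter_upwards [ae_restrict_mem measurableSet_Icc] with x hx using hB x hx

theorem locallyIntegrable_tpow_left (k : ℕ) (a : ℝ) :
    LocallyIntegrable (fun t => tpow k (a - t)) volume := by
  rw [tpow_sub_left_eq]
  refine LocallyIntegrable.indicator (Continuous.locallyIntegrable ?_) measurableSet_Iio
  fun_prop

theorem locallyIntegrable_tpow_right (k : ℕ) (a : ℝ) :
    LocallyIntegrable (fun t => tpow k (t - a)) volume := by
  rw [tpow_sub_right_eq]
  refine LocallyIntegrable.indicator (Continuous.locallyIntegrable ?_) measurableSet_Ioi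
  fun_prop

theorem memLp_tpow_left (k : ℕ) (a : ℝ) :
    MemLp (fun t => tpow k (a - t)) 2 (volume.restrict (Icc (0 : ℝ) 1)) := by
  rw [tpow_sub_left_eq]
  refine MemLp.indicator measurableSet_Iio (memLp_of_continuous ?_)
  fun_prop

theorem locallyIntegrable_const_mul {f : ℝ → ℂ} (hf : LocallyIntegrable f volume) (c : ℂ) :
    LocallyIntegrable (fun t => c * f t) volume := hf.smul c

/-- The base point 0 of the primitive lies to the left of the support, because 0 ≤ a. -/
theorem primitive_tpow (k : ℕ) {a : ℝ} (ha : 0 ≤ a) :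
    primitive (fun t => tpow k (t - a)) = fun t => tpow (k + 1) (t - a) := by
  have hi := locallyIntegrable_intervalIntegrable (locallyIntegrable_tpow_right k a)
  have hz : ∀ s ≤ a, ∫ t in (0 : ℝ)..s, tpow k (t - a) = 0 := by
    intro s hs
    refine intervalIntegral.integral_zero_ae (Filter.Eventually.of_forall fun t ht => ?_)
    have : t ≤ a := by
      rcases uIoc_subset_uIcc ht with ⟨h1, h2⟩
      exact h2.trans (max_le ha hs)
    rw [tpow, if_neg (by linarith)]
  ext s
  rcases le_or_gt s a with h | h
  · rw [primitive, hz s h, tpow, if_neg (by linarith)]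
  · rw [primitive, ← intervalIntegral.integral_add_adjacent_intervals (hi 0 a) (hi a s), hz a le_rfl,
      zero_add, tpow, if_pos (by linarith)]
    have hd : ∀ t : ℝ, HasDerivAt
        (fun t : ℝ => ((t : ℂ) - a) ^ (k + 1) / ((k + 1).factorial : ℂ))
        (((t : ℂ) - a) ^ k / (k.factorial : ℂ)) t := by
      intro t
      have h := (((((hasDerivAt_id (t : ℂ)).sub_const (a : ℂ)).pow (k + 1)).div_const
        ((k + 1).factorial : ℂ))).comp_ofReal
      refine h.congr_deriv ?_
      have h1 : (k.factorial : ℂ) ≠ 0 := Nat.cast_ne_zero.2 k.factorial_ne_zero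
      have h2 : (k : ℂ) + 1 ≠ 0 := Nat.cast_add_one_ne_zero k
      simp only [Nat.factorial_succ, Nat.add_sub_cancel, id]
      push_cast
      field_simp
    have : ∫ t in a..s, tpow k (t - a) = ∫ t in a..s, (((t : ℂ) - a) ^ k / (k.factorial : ℂ)) := by
      refine intervalIntegral.integral_congr_uIoo fun t ht => ?_
      rw [uIoo_of_le h.le] at ht
      rw [tpow, if_pos (by linarith [ht.1])]; push_cast; rfl
    rw [this, intervalIntegral.integral_eq_sub_of_hasDerivAt (fun t _ => hd t)]
    · simp
    · apply Continuous.intervalIntegrable; fun_prop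

theorem primitive_iterate_tpow (k j : ℕ) {a : ℝ} (ha : 0 ≤ a) :
    primitive^[j] (fun t => tpow k (t - a)) = fun t => tpow (k + j) (t - a) := by
  induction j with
  | zero => rfl
  | succ j ih => rw [Function.iterate_succ_apply', ih, primitive_tpow _ ha]; rfl

theorem primitive_iterate_sub {f g : ℝ → ℂ} (hf : LocallyIntegrable f volume)
    (hg : LocallyIntegrable g volume) (j : ℕ) :
    primitive^[j] (fun t => f t - g t) = fun t => primitive^[j] f t - primitive^[j] g t := by
  induction j with
  | zero => rfl
  | succ j ih =>
    simp only [Function.iterate_succ_apply', ih]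
    ext x
    exact intervalIntegral.integral_sub
      (locallyIntegrable_intervalIntegrable (locallyIntegrable_primitive_iterate hf j) _ _)
      (locallyIntegrable_intervalIntegrable (locallyIntegrable_primitive_iterate hg j) _ _)

theorem primitive_iterate_const_mul (f : ℝ → ℂ) (c : ℂ) (j : ℕ) :
    primitive^[j] (fun t => c * f t) = fun t => c * primitive^[j] f t := by
  induction j with
  | zero => rfl
  | succ j ih =>
    simp only [Function.iterate_succ_apply', ih]
    ext x
    exact intervalIntegral.integral_const_mul _ _

theorem primitive_iterate_sum {ι : Type*} (s : Finset ι) {f : ι → ℝ → ℂ}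
    (hf : ∀ i ∈ s, LocallyIntegrable (f i) volume) (j : ℕ) :
    primitive^[j] (fun t => ∑ i ∈ s, f i t) = fun t => ∑ i ∈ s, primitive^[j] (f i) t := by
  induction j with
  | zero => rfl
  | succ j ih =>
    simp only [Function.iterate_succ_apply', ih]
    ext x
    exact intervalIntegral.integral_finsetSum fun i hi =>
      locallyIntegrable_intervalIntegrable (locallyIntegrable_primitive_iterate (hf i hi) j) _ _

theorem primitive_iterate_pow (n j : ℕ) :
    primitive^[j] (fun t : ℝ => (t : ℂ) ^ n / (n.factorial : ℂ))
      = fun t : ℝ => (t : ℂ) ^ (n + j) / ((n + j).factorial : ℂ) := by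
  induction j with
  | zero => rfl
  | succ j ih =>
    rw [Function.iterate_succ_apply', ih]
    ext x
    have hd : ∀ t : ℝ, HasDerivAt
        (fun t : ℝ => (t : ℂ) ^ (n + j + 1) / ((n + j + 1).factorial : ℂ))
        ((t : ℂ) ^ (n + j) / ((n + j).factorial : ℂ)) t := by
      intro t
      have h := (((hasDerivAt_id (t : ℂ)).pow (n + j + 1)).div_const
        ((n + j + 1).factorial : ℂ)).comp_ofReal
      refine h.congr_deriv ?_
      have h1 : ((n + j).factorial : ℂ) ≠ 0 := Nat.cast_ne_zero.2 (n + j).factorial_ne_zero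
      have h2 : ((n + j : ℕ) : ℂ) + 1 ≠ 0 := Nat.cast_add_one_ne_zero _
      simp only [Nat.factorial_succ, Nat.add_sub_cancel, id]
      push_cast at h2 ⊢
      field_simp
    rw [primitive, intervalIntegral.integral_eq_sub_of_hasDerivAt (fun t _ => hd t)]
    · simp [← add_assoc]
    · apply Continuous.intervalIntegrable; fun_prop

theorem primitive_iterate_congr {f g : ℝ → ℂ} (hf : LocallyIntegrable f volume)
    (hg : LocallyIntegrable g volume)
    (h : ∀ᵐ t ∂(volume.restrict (Icc (0 : ℝ) 1)), f t = g t) (j : ℕ) {x : ℝ}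
    (hx : x ∈ Icc (0 : ℝ) 1) : primitive^[j + 1] f x = primitive^[j + 1] g x := by
  rw [primitive_iterate_eq hf j hx.1, primitive_iterate_eq hg j hx.1]
  refine intervalIntegral.integral_congr_ae ?_
  rw [ae_restrict_iff' measurableSet_Icc] at h
  filter_upwards [h] with t ht htx
  rw [uIoc_of_le hx.1] at htx
  rw [ht ⟨htx.1.le, htx.2.trans hx.2⟩]

/-! ### The Peano kernel of a functional -/

section peano

variable {ι : Type*} [Fintype ι] (ρ : ℝ → ℂ) (x : ι → ℝ) (c d : ι → ℂ) (k : ℕ)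

/-- The functional `φ ↦ ∫₀¹ ρ φ - ∑_β c_β φ(x_β)`. -/
def quadFunctional (φ : ℝ → ℂ) : ℂ := (∫ t in (0 : ℝ)..1, ρ t * φ t) - ∑ β, c β * φ (x β)

/-- The Peano kernel of order `k + 1`. -/
def peano (t : ℝ) : ℂ :=
  (∫ y in t..1, ρ y * (((y : ℂ) - t) ^ k / (k.factorial : ℂ))) - ∑ β, c β * tpow k (x β - t)

variable {ρ} {x}

theorem continuous_peano_integral (hρ : Continuous ρ) :
    Continuous fun t : ℝ => ∫ y in t..1, ρ y * (((y : ℂ) - t) ^ k / (k.factorial : ℂ)) := by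
  have h : Continuous fun t : ℝ => ∫ y in (1 : ℝ)..t, ρ y * (((y : ℂ) - t) ^ k / (k.factorial : ℂ)) :=
    intervalIntegral.continuous_parametric_intervalIntegral_of_continuous
      (f := fun (t y : ℝ) => ρ y * (((y : ℂ) - t) ^ k / (k.factorial : ℂ)))
      (by unfold Function.uncurry; fun_prop) continuous_id
  refine h.neg.congr fun t => ?_
  rw [intervalIntegral.integral_symm]; rfl

theorem locallyIntegrable_peano (hρ : Continuous ρ) :
    LocallyIntegrable (peano ρ x c k) volume := by
  refine (continuous_peano_integral k hρ).locallyIntegrable.sub ?_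
  exact locallyIntegrable_finsetSum _ fun β _ => locallyIntegrable_const_mul (locallyIntegrable_tpow_left k (x β)) _

theorem memLp_peano (hρ : Continuous ρ) :
    MemLp (peano ρ x c k) 2 (volume.restrict (Icc (0 : ℝ) 1)) := by
  refine (memLp_of_continuous (continuous_peano_integral k hρ)).sub ?_
  exact memLp_finsetSum _ fun β _ => (memLp_tpow_left k (x β)).const_mul _

theorem peano_add (t : ℝ) :
    peano ρ x (c + d) k t = peano ρ x c k t + peano 0 x d k t := by
  simp only [peano, Pi.add_apply, add_mul, Finset.sum_add_distrib, Pi.zero_apply, zero_mul,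
    intervalIntegral.integral_zero]
  ring

theorem conj_tpow (u : ℝ) : (starRingEnd ℂ) (tpow k u) = tpow k u := by
  unfold tpow; split_ifs <;> simp

theorem conj_peano_zero (t : ℝ) :
    (starRingEnd ℂ) (peano 0 x c k t) = peano 0 x (fun β => (starRingEnd ℂ) (c β)) k t := by
  simp only [peano, Pi.zero_apply, zero_mul, intervalIntegral.integral_zero, zero_sub, map_neg,
    map_sum, map_mul, conj_tpow]

theorem intervalIntegrable_tpow_mul {g : ℝ → ℂ} (hg : LocallyIntegrable g volume) (a u v : ℝ) :
    IntervalIntegrable (fun t => tpow k (a - t) * g t) volume u v := by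
  have : (fun t => tpow k (a - t) * g t) = (Iio a).indicator
      (fun t : ℝ => ((a - t : ℝ) : ℂ) ^ k / (k.factorial : ℂ) * g t) := by
    ext t; simp [tpow, indicator]
  rw [this]
  have h1 : LocallyIntegrable
      (fun t : ℝ => ((a - t : ℝ) : ℂ) ^ k / (k.factorial : ℂ) * g t) volume := by
    refine (locallyIntegrable_iff.2 fun K hK => ?_)
    exact (hg.integrableOn_isCompact hK).continuousOn_mul (by fun_prop) hK
  exact locallyIntegrable_intervalIntegrable (h1.indicator measurableSet_Iio) u v

theorem primitive_iterate_eq_integral_tpow {g : ℝ → ℂ} (hg : LocallyIntegrable g volume) {a : ℝ}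
    (ha : a ∈ Icc (0 : ℝ) 1) :
    primitive^[k + 1] g a = ∫ t in (0 : ℝ)..1, tpow k (a - t) * g t := by
  have hi := intervalIntegrable_tpow_mul k hg a
  rw [primitive_iterate_eq hg k ha.1,
    ← intervalIntegral.integral_add_adjacent_intervals (hi 0 a) (hi a 1)]
  have h2 : ∫ t in a..1, tpow k (a - t) * g t = 0 := by
    refine intervalIntegral.integral_zero_ae (Filter.Eventually.of_forall fun t ht => ?_)
    rw [uIoc_of_le ha.2] at ht
    rw [tpow, if_neg (by linarith [ht.1]), zero_mul]
  rw [h2, add_zero]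
  refine intervalIntegral.integral_congr_uIoo fun t ht => ?_
  rw [uIoo_of_le ha.1] at ht
  rw [tpow, if_pos (by linarith [ht.2])]; push_cast; rfl

/-- Peano's representation: insert Cauchy's formula for the repeated primitive and exchange the
integrals over the triangle. -/
theorem quadFunctional_primitive (hρ : Continuous ρ) (hx : ∀ β, x β ∈ Icc (0 : ℝ) 1) {g : ℝ → ℂ}
    (hg : LocallyIntegrable g volume) :
    quadFunctional ρ x c (primitive^[k + 1] g) = ∫ t in (0 : ℝ)..1, peano ρ x c k t * g t := by
  have h1 : ∫ y in (0 : ℝ)..1, ρ y * primitive^[k + 1] g y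
      = ∫ t in (0 : ℝ)..1,
          (∫ y in t..1, ρ y * (((y : ℂ) - t) ^ k / (k.factorial : ℂ))) * g t := by
    have := integral_triangle (G := fun y t => ρ y * (((y : ℂ) - t) ^ k / (k.factorial : ℂ)))
      (by unfold Function.uncurry; fun_prop) hg (zero_le_one' ℝ)
    simp only [intervalIntegral.integral_mul_const] at this
    rw [← this]
    refine intervalIntegral.integral_congr fun y hy => ?_
    rw [uIcc_of_le zero_le_one] at hy
    rw [primitive_iterate_eq hg k hy.1, ← intervalIntegral.integral_const_mul]
    exact intervalIntegral.integral_congr fun t _ => by ring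
  rw [quadFunctional, h1]
  simp only [peano, sub_mul, Finset.sum_mul]
  rw [intervalIntegral.integral_sub, intervalIntegral.integral_finsetSum]
  · congr 1
    refine Finset.sum_congr rfl fun β _ => ?_
    rw [primitive_iterate_eq_integral_tpow k hg (hx β), ← intervalIntegral.integral_const_mul]
    exact intervalIntegral.integral_congr fun t _ => by ring
  · intro β _
    simp only [mul_assoc]
    exact (intervalIntegrable_tpow_mul k hg (x β) 0 1).const_mul _
  · exact (locallyIntegrable_intervalIntegrable hg 0 1).continuousOn_mul
      (continuous_peano_integral k hρ).continuousOn
  · simp only [mul_assoc]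
    exact (IntervalIntegrable.sum Finset.univ
      fun β _ => (intervalIntegrable_tpow_mul k hg (x β) 0 1).const_mul (c β)).congr
        (fun t _ => by simp)

theorem quadFunctional_congr (hx : ∀ β, x β ∈ Icc (0 : ℝ) 1) {φ ψ : ℝ → ℂ}
    (h : ∀ t ∈ Icc (0 : ℝ) 1, φ t = ψ t) : quadFunctional ρ x c φ = quadFunctional ρ x c ψ := by
  rw [quadFunctional, quadFunctional, Finset.sum_congr rfl fun β _ => by rw [h _ (hx β)]]
  congr 1
  refine intervalIntegral.integral_congr fun t ht => ?_
  rw [uIcc_of_le zero_le_one] at ht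
  rw [h t ht]

theorem quadFunctional_add (hρ : Continuous ρ) {φ ψ : ℝ → ℂ} (hφ : Continuous φ)
    (hψ : Continuous ψ) :
    quadFunctional ρ x c (fun t => φ t + ψ t)
      = quadFunctional ρ x c φ + quadFunctional ρ x c ψ := by
  simp only [quadFunctional, mul_add, Finset.sum_add_distrib]
  rw [intervalIntegral.integral_add (f := fun t => ρ t * φ t) (g := fun t => ρ t * ψ t)
    ((hρ.mul hφ).intervalIntegrable _ _) ((hρ.mul hψ).intervalIntegrable _ _)]
  ring

theorem quadFunctional_const_mul (a : ℂ) (φ : ℝ → ℂ) :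
    quadFunctional ρ x c (fun t => a * φ t) = a * quadFunctional ρ x c φ := by
  simp only [quadFunctional, mul_sub, Finset.mul_sum, ← intervalIntegral.integral_const_mul]
  congr 1
  · exact intervalIntegral.integral_congr fun t _ => by ring
  · exact Finset.sum_congr rfl fun β _ => by ring

/-- Exactness on polynomials of degree at most `k`. -/
def KillsPoly (ρ : ℝ → ℂ) (x : ι → ℝ) (c : ι → ℂ) (k : ℕ) : Prop :=
  ∀ α ≤ k, quadFunctional ρ x c (fun t => (t : ℂ) ^ α) = 0

variable {c d k}

theorem KillsPoly.eval (h : KillsPoly ρ x c k) (hρ : Continuous ρ) {p : Polynomial ℂ}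
    (hp : p.natDegree ≤ k) : quadFunctional ρ x c (fun t => p.eval (t : ℂ)) = 0 := by
  suffices H : ∀ n ≤ k + 1, quadFunctional ρ x c
      (fun t => ∑ i ∈ Finset.range n, p.coeff i * (t : ℂ) ^ i) = 0 by
    have e : (fun t : ℝ => p.eval (t : ℂ))
        = fun t : ℝ => ∑ i ∈ Finset.range (k + 1), p.coeff i * (t : ℂ) ^ i := by
      ext t; rw [p.eval_eq_sum_range' (n := k + 1) (by omega)]
    rw [e]; exact H _ le_rfl
  intro n
  induction n with
  | zero => intro _; simp [quadFunctional]
  | succ n ih =>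
    intro hn
    simp only [Finset.sum_range_succ]
    rw [quadFunctional_add c hρ (φ := fun t : ℝ => ∑ i ∈ Finset.range n, p.coeff i * (t : ℂ) ^ i)
      (ψ := fun t : ℝ => p.coeff n * (t : ℂ) ^ n) (by fun_prop) (by fun_prop), ih (by omega),
      quadFunctional_const_mul, h n (by omega)]
    simp

theorem tpow_add_tpow_neg {u : ℝ} (hu : u ≠ 0) :
    (u : ℂ) ^ k / (k.factorial : ℂ) = tpow k u + (-1) ^ k * tpow k (-u) := by
  rcases lt_or_gt_of_ne hu with h | h
  · rw [tpow, if_neg (by linarith), tpow, if_pos (by linarith), zero_add, ← mul_div_assoc,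
      ← mul_pow]
    push_cast; simp
  · rw [tpow, if_pos h, tpow, if_neg (by linarith)]; simp

/-- Exactness on (y - t)^k/k! trades the part of the functional to the right of t for the part to
its left, which is what iterated primitives from 0 can integrate further. Nodes are excluded because
for k = 0 the splitting of u^k/k! fails at u = 0. -/
theorem KillsPoly.peano_eq (h : KillsPoly ρ x c k) (hρ : Continuous ρ) {t : ℝ}
    (ht : t ∈ Icc (0 : ℝ) 1) (hne : ∀ β, x β ≠ t) :
    peano ρ x c k t
      = (-1) ^ (k + 1) * (primitive^[k + 1] ρ t - ∑ β, c β * tpow k (t - x β)) := by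
  have h0 := h.eval hρ (p := Polynomial.C ((k.factorial : ℂ)⁻¹) * (Polynomial.X - Polynomial.C (t : ℂ)) ^ k) (by
    refine Polynomial.natDegree_C_mul_le _ _ |>.trans ?_
    refine Polynomial.natDegree_pow_le.trans ?_
    simp)
  have e : (fun y : ℝ => (Polynomial.C ((k.factorial : ℂ)⁻¹) *
      (Polynomial.X - Polynomial.C (t : ℂ)) ^ k).eval (y : ℂ))
      = fun y : ℝ => ((y : ℂ) - t) ^ k / (k.factorial : ℂ) := by
    ext y; simp; ring
  rw [e, quadFunctional] at h0
  have hc : Continuous fun y : ℝ => ρ y * (((y : ℂ) - t) ^ k / (k.factorial : ℂ)) := by fun_prop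
  rw [← intervalIntegral.integral_add_adjacent_intervals (hc.intervalIntegrable 0 t)
    (hc.intervalIntegrable t 1)] at h0
  have h1 : ∫ y in (0 : ℝ)..t, ρ y * (((y : ℂ) - t) ^ k / (k.factorial : ℂ))
      = (-1) ^ k * primitive^[k + 1] ρ t := by
    rw [primitive_iterate_eq hρ.locallyIntegrable k ht.1, ← intervalIntegral.integral_const_mul]
    refine intervalIntegral.integral_congr fun y _ => ?_
    have : ((y : ℂ) - t) ^ k = (-1) ^ k * ((t : ℂ) - y) ^ k := by rw [← mul_pow]; ring
    simp only [this]; ring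
  have h2 : ∑ β, c β * (((x β : ℂ) - t) ^ k / (k.factorial : ℂ))
      = ∑ β, c β * tpow k (x β - t) + (-1) ^ k * ∑ β, c β * tpow k (t - x β) := by
    rw [Finset.mul_sum, ← Finset.sum_add_distrib]
    refine Finset.sum_congr rfl fun β _ => ?_
    have := tpow_add_tpow_neg (k := k) (sub_ne_zero.2 (hne β))
    push_cast at this
    rw [this, neg_sub]; ring
  rw [h1, h2] at h0
  rw [peano, pow_succ]
  linear_combination h0

/-- Integrating the left-sided kernel k + 1 more times gives the convolution of the functional with
the Green function of order 2k + 2. Exceptional points are null and do not matter. -/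
theorem KillsPoly.primitive_peano (h : KillsPoly ρ x c k) (hρ : Continuous ρ)
    (hx : ∀ β, x β ∈ Icc (0 : ℝ) 1) {s : ℝ} (hs : s ∈ Icc (0 : ℝ) 1) :
    primitive^[k + 1] (peano ρ x c k) s
      = (-1) ^ (k + 1) *
        (primitive^[2 * k + 2] ρ s - ∑ β, c β * tpow (2 * k + 1) (s - x β)) := by
  have hL1 := locallyIntegrable_primitive_iterate hρ.locallyIntegrable (k + 1)
  have hL2 : ∀ β ∈ Finset.univ, LocallyIntegrable (fun t => c β * tpow k (t - x β)) volume :=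
    fun β _ => locallyIntegrable_const_mul (locallyIntegrable_tpow_right k (x β)) _
  have hL3 := locallyIntegrable_finsetSum _ hL2
  rw [primitive_iterate_congr (g := fun t => (-1) ^ (k + 1) *
    (primitive^[k + 1] ρ t - ∑ β, c β * tpow k (t - x β))) (locallyIntegrable_peano c k hρ)
    (locallyIntegrable_const_mul (hL1.sub hL3) _) ?_ k hs]
  · rw [primitive_iterate_const_mul, primitive_iterate_sub hL1 hL3, primitive_iterate_sum _ hL2,
      ← Function.iterate_add_apply]
    have e1 : k + 1 + (k + 1) = 2 * k + 2 := by ring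
    rw [e1]
    simp only
    congr 2
    refine Finset.sum_congr rfl fun β _ => ?_
    rw [primitive_iterate_const_mul, primitive_iterate_tpow _ _ (hx β).1]
    have e2 : k + (k + 1) = 2 * k + 1 := by ring
    rw [e2]
  · have hne : ∀ᵐ t : ℝ, ∀ β, x β ≠ t := by
      rw [ae_all_iff]
      intro β
      filter_upwards [Measure.ae_ne volume (x β)] with t ht using ht.symm
    filter_upwards [ae_restrict_mem measurableSet_Icc, ae_restrict_of_ae hne] with t ht hne
    exact h.peano_eq hρ ht hne

end peano

/-! ### The norm of the functional, orthogonality and uniqueness -/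

section extremal

variable {ι : Type*} [Fintype ι] {ρ : ℝ → ℂ} {x : ι → ℝ} {c d : ι → ℂ} {k : ℕ}

theorem sqrt_integral_cutDeriv (k : ℕ) (φ : ℝ → ℂ) :
    Real.sqrt (∫ t in (0 : ℝ)..1, ‖cutDeriv k φ t‖ ^ 2) = sobolevNorm k φ := by
  rw [sobolevNorm]
  congr 1
  refine intervalIntegral.integral_congr fun t ht => ?_
  rw [uIcc_of_le zero_le_one] at ht
  rw [cutDeriv, indicator_of_mem ht]

theorem norm_integral_mul_le {f g : ℝ → ℂ} (hf : MemLp f 2 (volume.restrict (Icc (0 : ℝ) 1)))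
    (hg : MemLp g 2 (volume.restrict (Icc (0 : ℝ) 1))) :
    ‖∫ t in (0 : ℝ)..1, f t * g t‖
      ≤ Real.sqrt (∫ t in (0 : ℝ)..1, ‖f t‖ ^ 2) * Real.sqrt (∫ t in (0 : ℝ)..1, ‖g t‖ ^ 2) := by
  simp only [intervalIntegral.integral_of_le (zero_le_one' ℝ), ← integral_Icc_eq_integral_Ioc]
  have h2 : (ENNReal.ofReal 2) = 2 := by simp
  have h := integral_mul_norm_le_Lp_mul_Lq (μ := volume.restrict (Icc (0 : ℝ) 1)) (f := f) (g := g)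
    Real.HolderConjugate.two_two (by rwa [h2]) (by rwa [h2])
  simp only [Real.rpow_two, ← Real.sqrt_eq_rpow] at h
  refine (norm_integral_le_integral_norm _).trans (le_trans (le_of_eq ?_) h)
  simp only [norm_mul]

/-- The Taylor polynomial is killed, and Cauchy–Schwarz bounds the Peano integral of the remainder.
-/
theorem KillsPoly.norm_le (h : KillsPoly ρ x c k) (hρ : Continuous ρ)
    (hx : ∀ β, x β ∈ Icc (0 : ℝ) 1) {φ : ℝ → ℂ} (hφ : MemSobolev (k + 1) φ) :
    ‖quadFunctional ρ x c φ‖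
      ≤ Real.sqrt (∫ t in (0 : ℝ)..1, ‖peano ρ x c k t‖ ^ 2) * sobolevNorm (k + 1) φ := by
  obtain ⟨p, hp, hpe⟩ := hφ.exists_eq_add_primitive
  have hg := hφ.locallyIntegrable_cutDeriv
  have hg2 : MemLp (cutDeriv (k + 1) φ) 2 (volume.restrict (Icc (0 : ℝ) 1)) := by
    refine (memLp_congr_ae ?_).2 hφ.memLp
    filter_upwards [ae_restrict_mem measurableSet_Icc] with t ht
    rw [cutDeriv, indicator_of_mem ht]
  rw [quadFunctional_congr c hx hpe, quadFunctional_add c hρ (φ := fun t : ℝ => p.eval (t : ℂ))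
    (by fun_prop) (continuous_primitive_iterate hg k), h.eval hρ hp, zero_add,
    quadFunctional_primitive c k hρ hx hg, ← sqrt_integral_cutDeriv]
  exact norm_integral_mul_le (memLp_peano c k hρ) hg2

theorem exists_extremal (hρ : Continuous ρ) (hx : ∀ β, x β ∈ Icc (0 : ℝ) 1) :
    ∃ φ, MemSobolev (k + 1) φ ∧ sobolevNorm (k + 1) φ ≤ 1 ∧
      ‖quadFunctional ρ x c φ‖ = Real.sqrt (∫ t in (0 : ℝ)..1, ‖peano ρ x c k t‖ ^ 2) := by
  set I := ∫ t in (0 : ℝ)..1, ‖peano ρ x c k t‖ ^ 2 with hI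
  set S := Real.sqrt I with hS
  have hI0 : 0 ≤ I := intervalIntegral.integral_nonneg zero_le_one fun t _ => by positivity
  have hSI : S * S = I := Real.mul_self_sqrt hI0
  -- The equality case of Cauchy–Schwarz. If S = 0 then S⁻¹ = 0 and the zero function serves.
  set g : ℝ → ℂ := fun t => ((S⁻¹ : ℝ) : ℂ) * (starRingEnd ℂ) (peano ρ x c k t) with hg
  have hgL : LocallyIntegrable g volume := by
    refine locallyIntegrable_const_mul ?_ _
    refine (locallyIntegrable_peano (x := x) c k hρ).mono ?_ (Filter.Eventually.of_forall fun t => by simp)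
    exact Complex.continuous_conj.comp_aestronglyMeasurable
      (locallyIntegrable_peano c k hρ).aestronglyMeasurable
  have hg2 : MemLp g 2 (volume.restrict (Icc (0 : ℝ) 1)) :=
    (memLp_peano c k hρ).star.const_mul _
  refine ⟨primitive^[k + 1] g, memSobolev_primitive_iterate hgL hg2 k, ?_, ?_⟩
  · have : ∫ t in (0 : ℝ)..1, ‖intervalDeriv (k + 1) (primitive^[k + 1] g) t‖ ^ 2
        = S⁻¹ ^ 2 * I := by
      rw [hI, ← intervalIntegral.integral_const_mul]
      refine intervalIntegral.integral_congr_ae ?_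
      have := ae_intervalDeriv_primitive_iterate hgL k
      rw [ae_restrict_iff' measurableSet_Icc] at this
      filter_upwards [this] with t ht htx
      rw [uIoc_of_le zero_le_one] at htx
      rw [ht (Ioc_subset_Icc_self htx), hg]
      simp [mul_pow]
    rw [sobolevNorm, this, Real.sqrt_le_one]
    rw [← hSI]
    rcases eq_or_ne S 0 with h | h
    · rw [h]; simp
    · field_simp; exact le_rfl
  · rw [quadFunctional_primitive c k hρ hx hgL]
    have : ∫ t in (0 : ℝ)..1, peano ρ x c k t * g t = ((S⁻¹ * I : ℝ) : ℂ) := by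
      rw [hI, ← intervalIntegral.integral_const_mul, ← intervalIntegral.integral_ofReal]
      refine intervalIntegral.integral_congr fun t _ => ?_
      simp only [hg]
      push_cast
      rw [← Complex.mul_conj']; ring
    rw [this, Complex.norm_real,
      Real.norm_of_nonneg (mul_nonneg (inv_nonneg.2 (Real.sqrt_nonneg _)) hI0)]
    change S⁻¹ * I = S
    rw [← hSI]
    rcases eq_or_ne S 0 with h | h
    · rw [h]; simp
    · field_simp

theorem iSup_norm_eq (h : KillsPoly ρ x c k) (hρ : Continuous ρ) (hx : ∀ β, x β ∈ Icc (0 : ℝ) 1) :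
    ⨆ (φ : ℝ → ℂ) (_ : MemSobolev (k + 1) φ) (_ : sobolevNorm (k + 1) φ ≤ 1),
        ‖quadFunctional ρ x c φ‖ₑ
      = ENNReal.ofReal (Real.sqrt (∫ t in (0 : ℝ)..1, ‖peano ρ x c k t‖ ^ 2)) := by
  refine le_antisymm ?_ ?_
  · refine iSup_le fun φ => iSup_le fun hφ => iSup_le fun hn => ?_
    rw [← ofReal_norm]
    refine ENNReal.ofReal_le_ofReal ((h.norm_le hρ hx hφ).trans ?_)
    exact mul_le_of_le_one_right (Real.sqrt_nonneg _) hn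
  · obtain ⟨φ, h1, h2, h3⟩ := exists_extremal (c := c) (k := k) hρ hx
    rw [← h3, ofReal_norm]
    exact le_iSup_of_le φ (le_iSup_of_le h1 (le_iSup_of_le h2 le_rfl))

/-- The extremal equation: the convolution of the functional with the Green function agrees with
a polynomial of degree at most `k` at the nodes. -/
def SolvesGrid (ρ : ℝ → ℂ) (x : ι → ℝ) (c : ι → ℂ) (k : ℕ) : Prop :=
  ∃ r : Polynomial ℂ, r.natDegree ≤ k ∧ ∀ β,
    primitive^[2 * k + 2] ρ (x β) - ∑ γ, c γ * tpow (2 * k + 1) (x β - x γ) = r.eval ((x β : ℝ) : ℂ)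

theorem quadFunctional_zero (φ : ℝ → ℂ) : quadFunctional 0 x d φ = - ∑ β, d β * φ (x β) := by
  simp [quadFunctional]

theorem KillsPoly.conj (hd : KillsPoly 0 x d k) :
    KillsPoly 0 x (fun β => (starRingEnd ℂ) (d β)) k := by
  intro α hα
  have h := congrArg (starRingEnd ℂ) (hd α hα)
  rw [quadFunctional_zero] at h ⊢
  simpa using h

/-- By Peano's representation for the weight 0, the inner product is a combination, with weights
conj(d_β), of nodal values of the iterated primitive of the kernel of c. The grid condition makes
these the values of a polynomial of degree at most k, which the conjugate of d kills. -/
theorem integral_conj_peano_mul (h : KillsPoly ρ x c k) (hρ : Continuous ρ)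
    (hx : ∀ β, x β ∈ Icc (0 : ℝ) 1) (hr : SolvesGrid ρ x c k) (hd : KillsPoly 0 x d k) :
    ∫ t in (0 : ℝ)..1, (starRingEnd ℂ) (peano 0 x d k t) * peano ρ x c k t = 0 := by
  obtain ⟨r, hrd, hr⟩ := hr
  have h1 := quadFunctional_primitive (ρ := 0) (fun β => (starRingEnd ℂ) (d β)) k continuous_zero hx
    (locallyIntegrable_peano (x := x) c k hρ)
  simp only [conj_peano_zero]
  rw [← h1, quadFunctional_zero]
  have h2 := hd.conj.eval continuous_zero hrd
  rw [quadFunctional_zero] at h2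
  have h3 : ∀ β, primitive^[k + 1] (peano ρ x c k) (x β)
      = (-1) ^ (k + 1) * r.eval ((x β : ℝ) : ℂ) := fun β => by
    rw [h.primitive_peano hρ hx (hx β), hr]
  simp only [h3]
  have h4 : ∑ β, (starRingEnd ℂ) (d β) * ((-1) ^ (k + 1) * r.eval ((x β : ℝ) : ℂ))
      = (-1) ^ (k + 1) * ∑ β, (starRingEnd ℂ) (d β) * r.eval ((x β : ℝ) : ℂ) := by
    rw [Finset.mul_sum]; exact Finset.sum_congr rfl fun β _ => by ring
  rw [h4, neg_eq_zero.1 h2]; simp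

theorem intervalIntegrable_of_memLp_mul {f g : ℝ → ℂ}
    (hf : MemLp f 2 (volume.restrict (Icc (0 : ℝ) 1)))
    (hg : MemLp g 2 (volume.restrict (Icc (0 : ℝ) 1))) :
    IntervalIntegrable (fun t => f t * g t) volume 0 1 := by
  rw [intervalIntegrable_iff_integrableOn_Icc_of_le zero_le_one]
  exact hf.integrable_mul hg

theorem intervalIntegrable_norm_sq {f : ℝ → ℂ}
    (hf : MemLp f 2 (volume.restrict (Icc (0 : ℝ) 1))) :
    IntervalIntegrable (fun t => ‖f t‖ ^ 2) volume 0 1 := by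
  rw [intervalIntegrable_iff_integrableOn_Icc_of_le zero_le_one]
  exact hf.integrable_norm_pow two_ne_zero

theorem integral_norm_sq_peano_add (h : KillsPoly ρ x c k) (hρ : Continuous ρ)
    (hx : ∀ β, x β ∈ Icc (0 : ℝ) 1) (hr : SolvesGrid ρ x c k) (hd : KillsPoly 0 x d k) :
    ∫ t in (0 : ℝ)..1, ‖peano ρ x (c + d) k t‖ ^ 2
      = (∫ t in (0 : ℝ)..1, ‖peano ρ x c k t‖ ^ 2) + ∫ t in (0 : ℝ)..1, ‖peano 0 x d k t‖ ^ 2 := by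
  have h0 := integral_conj_peano_mul h hρ hx hr hd
  have hm1 := memLp_peano (x := x) c k hρ
  have hm2 : MemLp (peano 0 x d k) 2 (volume.restrict (Icc (0 : ℝ) 1)) :=
    memLp_peano (x := x) d k continuous_zero
  have hcr : IntervalIntegrable
      (fun t => (starRingEnd ℂ) (peano 0 x d k t) * peano ρ x c k t) volume 0 1 :=
    intervalIntegrable_of_memLp_mul hm2.star hm1
  have hre : ∫ t in (0 : ℝ)..1, ((starRingEnd ℂ) (peano 0 x d k t) * peano ρ x c k t).re = 0 := by
    have := congrArg Complex.re h0
    rw [intervalIntegral.integral_of_le zero_le_one] at this ⊢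
    exact (integral_re hcr.1).trans this
  have hpt : ∀ t, ‖peano ρ x (c + d) k t‖ ^ 2 = (‖peano ρ x c k t‖ ^ 2 + ‖peano 0 x d k t‖ ^ 2)
      + 2 * ((starRingEnd ℂ) (peano 0 x d k t) * peano ρ x c k t).re := by
    intro t
    rw [peano_add]
    simp only [← Complex.normSq_eq_norm_sq, Complex.normSq_apply, Complex.add_re, Complex.add_im,
      Complex.mul_re, Complex.conj_re, Complex.conj_im]
    ring
  simp only [hpt]
  have hcr' : IntervalIntegrable
      (fun t => ((starRingEnd ℂ) (peano 0 x d k t) * peano ρ x c k t).re) volume 0 1 :=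
    ⟨hcr.1.re, hcr.2.re⟩
  rw [intervalIntegral.integral_add ((intervalIntegrable_norm_sq hm1).add
    (intervalIntegrable_norm_sq hm2)) (hcr'.const_mul 2), intervalIntegral.integral_const_mul, hre,
    intervalIntegral.integral_add (intervalIntegrable_norm_sq hm1) (intervalIntegrable_norm_sq hm2)]
  simp

theorem eq_zero_of_sum_eval_eq_zero (hinj : Function.Injective x)
    (h : ∀ p : Polynomial ℂ, ∑ β, d β * p.eval ((x β : ℝ) : ℂ) = 0) : d = 0 := by
  classical
  ext β
  have := h (∏ γ ∈ Finset.univ.erase β, (Polynomial.X - Polynomial.C ((x γ : ℝ) : ℂ)))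
  rw [Finset.sum_eq_single β] at this
  · refine (mul_eq_zero.1 this).resolve_right ?_
    simp only [Polynomial.eval_prod, Polynomial.eval_sub, Polynomial.eval_X, Polynomial.eval_C]
    refine Finset.prod_ne_zero_iff.2 fun γ hγ => sub_ne_zero.2 fun e => ?_
    exact (Finset.mem_erase.1 hγ).1 (hinj (Complex.ofReal_injective e.symm))
  · intro γ _ hγ
    simp only [Polynomial.eval_prod, Polynomial.eval_sub, Polynomial.eval_X, Polynomial.eval_C]
    rw [Finset.prod_eq_zero (Finset.mem_erase.2 ⟨hγ, Finset.mem_univ γ⟩) (sub_self _), mul_zero]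
  · simp

/-- A kernel vanishing almost everywhere makes d annihilate every power: x^n with n ≤ k by
hypothesis, and n > k because x^n/n! is a (k+1)-fold primitive. Distinct nodes then force d = 0. -/
theorem eq_zero_of_integral_peano_eq_zero (hx : ∀ β, x β ∈ Icc (0 : ℝ) 1)
    (hinj : Function.Injective x) (hd : KillsPoly 0 x d k)
    (h : ∫ t in (0 : ℝ)..1, ‖peano 0 x d k t‖ ^ 2 = 0) : d = 0 := by
  have hm : MemLp (peano 0 x d k) 2 (volume.restrict (Icc (0 : ℝ) 1)) :=
    memLp_peano (x := x) d k continuous_zero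
  have hae : ∀ᵐ t ∂(volume.restrict (Ioc (0 : ℝ) 1)), peano 0 x d k t = 0 := by
    have := (intervalIntegral.integral_eq_zero_iff_of_le_of_nonneg_ae zero_le_one
      (Filter.Eventually.of_forall fun t => by positivity) (intervalIntegrable_norm_sq hm)).1 h
    filter_upwards [this] with t ht
    simpa using ht
  have hmom : ∀ n : ℕ, ∑ β, d β * ((x β : ℝ) : ℂ) ^ n = 0 := by
    intro n
    rcases Nat.lt_or_ge k n with hn | hn
    · have hg : Continuous fun t : ℝ => (t : ℂ) ^ (n - (k + 1)) / ((n - (k + 1)).factorial : ℂ) := by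
        fun_prop
      have h1 := quadFunctional_primitive (ρ := 0) d k continuous_zero hx hg.locallyIntegrable
      rw [quadFunctional_zero, primitive_iterate_pow] at h1
      have h2 : ∫ t in (0 : ℝ)..1, peano 0 x d k t *
          ((t : ℂ) ^ (n - (k + 1)) / ((n - (k + 1)).factorial : ℂ)) = 0 := by
        refine intervalIntegral.integral_zero_ae ?_
        rw [ae_restrict_iff' measurableSet_Ioc] at hae
        filter_upwards [hae] with t ht htx
        rw [uIoc_of_le zero_le_one] at htx
        rw [ht htx, zero_mul]
      rw [h2] at h1
      have e : n - (k + 1) + (k + 1) = n := by omega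
      rw [e] at h1
      have hf : (n.factorial : ℂ) ≠ 0 := Nat.cast_ne_zero.2 n.factorial_ne_zero
      have h3 : ∑ β, d β * (((x β : ℝ) : ℂ) ^ n / (n.factorial : ℂ))
          = (∑ β, d β * ((x β : ℝ) : ℂ) ^ n) / (n.factorial : ℂ) := by
        rw [Finset.sum_div]; exact Finset.sum_congr rfl fun β _ => by ring
      rw [h3, neg_eq_zero] at h1
      exact (div_eq_zero_iff.1 h1).resolve_right hf
    · have := hd n hn
      rw [quadFunctional_zero] at this
      exact neg_eq_zero.1 this
  refine eq_zero_of_sum_eval_eq_zero hinj fun p => ?_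
  simp only [Polynomial.eval_eq_sum_range, Finset.mul_sum]
  rw [Finset.sum_comm]
  refine Finset.sum_eq_zero fun n _ => ?_
  have : ∑ β, d β * (p.coeff n * ((x β : ℝ) : ℂ) ^ n)
      = p.coeff n * ∑ β, d β * ((x β : ℝ) : ℂ) ^ n := by
    rw [Finset.mul_sum]; exact Finset.sum_congr rfl fun β _ => by ring
  rw [this, hmom, mul_zero]

/-- The homogeneous extremal problem has only the trivial solution. -/
theorem eq_zero_of_solvesGrid (hx : ∀ β, x β ∈ Icc (0 : ℝ) 1) (hinj : Function.Injective x)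
    (hd : KillsPoly 0 x d k) (hr : SolvesGrid 0 x d k) : d = 0 := by
  refine eq_zero_of_integral_peano_eq_zero hx hinj hd ?_
  have h := integral_conj_peano_mul hd continuous_zero hx hr hd
  have e : ∀ t, (starRingEnd ℂ) (peano 0 x d k t) * peano 0 x d k t
      = ((‖peano 0 x d k t‖ ^ 2 : ℝ) : ℂ) := fun t => by
    rw [Complex.conj_mul']; push_cast; rfl
  simp only [e] at h
  rw [intervalIntegral.integral_ofReal] at h
  exact_mod_cast h

end extremal

/-! ### Sard's problem on the uniform grid -/

/-- The nodes `hβ`. -/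
def node (N : ℕ) (β : Fin (N + 1)) : ℝ := step N * (β : ℕ)

/-- The weight `e^{2πiωt}`. -/
def weight (ω : ℝ) (t : ℝ) : ℂ := Complex.exp (2 * Real.pi * Complex.I * ω * t)

theorem continuous_weight (ω : ℝ) : Continuous (weight ω) := by unfold weight; fun_prop

theorem node_mem {N : ℕ} (hN : 1 ≤ N) (β : Fin (N + 1)) : node N β ∈ Icc (0 : ℝ) 1 := by
  have h1 : ((β : ℕ) : ℝ) ≤ N := by exact_mod_cast Nat.lt_succ_iff.1 β.2
  have h2 : (0 : ℝ) < N := by exact_mod_cast hN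
  rw [node, step]
  refine ⟨by positivity, ?_⟩
  rw [one_div, inv_mul_le_iff₀ h2]; linarith

theorem node_injective {N : ℕ} (hN : 1 ≤ N) : Function.Injective (node N) := by
  intro β γ h
  have h2 : (0 : ℝ) < N := by exact_mod_cast hN
  have h3 : (1 / (N : ℝ)) ≠ 0 := by positivity
  rw [node, node, step] at h
  have := mul_left_cancel₀ h3 h
  exact Fin.ext (by exact_mod_cast this)

theorem isExact_iff {k N : ℕ} {ω : ℝ} {C : Fin (N + 1) → ℂ} :
    IsExact (k + 1) N ω C ↔ KillsPoly (weight ω) (node N) C k :=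
  ⟨fun h α hα => h α (Nat.lt_succ_of_le hα), fun h α hα => h α (Nat.le_of_lt_succ hα)⟩

theorem errorNorm_eq {k N : ℕ} (hN : 1 ≤ N) {ω : ℝ} {C : Fin (N + 1) → ℂ}
    (h : IsExact (k + 1) N ω C) :
    errorNorm (k + 1) N ω C = ENNReal.ofReal (Real.sqrt
      (∫ t in (0 : ℝ)..1, ‖peano (weight ω) (node N) C k t‖ ^ 2)) :=
  iSup_norm_eq (isExact_iff.1 h) (continuous_weight ω) (node_mem hN)

/-- Exact rules differ by functionals that kill polynomials, so Pythagoras shows that the squared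
norm exceeds that of `C` by the squared norm of the difference kernel, which vanishes only for C' =
C. -/
theorem isSardOptimal_iff {k N : ℕ} (hN : 1 ≤ N) {ω : ℝ} {C : Fin (N + 1) → ℂ}
    (h : IsExact (k + 1) N ω C) (hr : SolvesGrid (weight ω) (node N) C k)
    (C' : Fin (N + 1) → ℂ) : IsSardOptimal (k + 1) N ω C' ↔ C' = C := by
  have hpos : ∀ (ρ : ℝ → ℂ) (c : Fin (N + 1) → ℂ),
      0 ≤ ∫ t in (0 : ℝ)..1, ‖peano ρ (node N) c k t‖ ^ 2 := fun ρ c =>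
    intervalIntegral.integral_nonneg zero_le_one fun t _ => by positivity
  have hdiff : ∀ C', IsExact (k + 1) N ω C' → KillsPoly 0 (node N) (C' - C) k ∧
      ∫ t in (0 : ℝ)..1, ‖peano (weight ω) (node N) C' k t‖ ^ 2
        = (∫ t in (0 : ℝ)..1, ‖peano (weight ω) (node N) C k t‖ ^ 2)
          + ∫ t in (0 : ℝ)..1, ‖peano 0 (node N) (C' - C) k t‖ ^ 2 := by
    intro C' h'
    have hk : KillsPoly 0 (node N) (C' - C) k := by
      intro α hα
      have h1 := isExact_iff.1 h α hα
      have h2 := isExact_iff.1 h' α hα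
      rw [quadFunctional_zero]
      rw [quadFunctional] at h1 h2
      simp only [Pi.sub_apply, sub_mul, Finset.sum_sub_distrib]
      linear_combination h2 - h1
    refine ⟨hk, ?_⟩
    rw [← integral_norm_sq_peano_add (isExact_iff.1 h) (continuous_weight ω) (node_mem hN) hr hk,
      add_sub_cancel]
  have hle : ∀ C', IsExact (k + 1) N ω C' →
      errorNorm (k + 1) N ω C ≤ errorNorm (k + 1) N ω C' := by
    intro C' h'
    rw [errorNorm_eq hN h, errorNorm_eq hN h', (hdiff C' h').2]
    refine ENNReal.ofReal_le_ofReal (Real.sqrt_le_sqrt ?_)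
    linarith [hpos 0 (C' - C)]
  have hopt : errorNorm (k + 1) N ω C
      = ⨅ (C' : Fin (N + 1) → ℂ) (_ : IsExact (k + 1) N ω C'), errorNorm (k + 1) N ω C' :=
    le_antisymm (le_iInf fun C' => le_iInf fun h' => hle C' h') (iInf_le_of_le C (iInf_le _ h))
  constructor
  · rintro ⟨h', he⟩
    rw [← hopt, errorNorm_eq hN h, errorNorm_eq hN h', (hdiff C' h').2,
      ENNReal.ofReal_eq_ofReal_iff (Real.sqrt_nonneg _) (Real.sqrt_nonneg _),
      Real.sqrt_inj (add_nonneg (hpos _ _) (hpos _ _)) (hpos _ _)] at he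
    have := eq_zero_of_integral_peano_eq_zero (node_mem hN) (node_injective hN) (hdiff C' h').1
      (by linarith)
    exact sub_eq_zero.1 this
  · rintro rfl
    exact ⟨h, hopt⟩

/-! ### The constant `K` -/

section constant

variable {N : ℕ} {ω : ℝ}

theorem w_eq (N : ℕ) (ω : ℝ) : w N ω = 2 * Complex.I * ((Real.pi * ω * step N : ℝ) : ℂ) := by
  rw [w]; push_cast; ring

theorem w_ne_zero (hω : ∀ n : ℤ, ω * step N ≠ n) : w N ω ≠ 0 := by
  have h : ω * step N ≠ 0 := by simpa using hω 0
  rw [w_eq, mul_assoc Real.pi]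
  refine mul_ne_zero (mul_ne_zero two_ne_zero Complex.I_ne_zero) ?_
  exact_mod_cast mul_ne_zero Real.pi_ne_zero h

theorem eh_ne_one (hω : ∀ n : ℤ, ω * step N ≠ n) : eh N ω ≠ 1 := by
  intro h
  obtain ⟨n, hn⟩ := Complex.exp_eq_one_iff.1 h
  apply hω n
  have hp : (2 * Real.pi * Complex.I : ℂ) ≠ 0 := Complex.two_pi_I_ne_zero
  have h1 : (2 * Real.pi * Complex.I : ℂ) * ((ω * step N : ℝ) : ℂ)
      = (2 * Real.pi * Complex.I : ℂ) * ((n : ℝ) : ℂ) := by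
    rw [w] at hn; push_cast; linear_combination hn
  exact Complex.ofReal_injective (mul_left_cancel₀ hp h1)

theorem norm_eh (N : ℕ) (ω : ℝ) : ‖eh N ω‖ = 1 := by
  rw [eh, w_eq]
  have : (2 * Complex.I * ((Real.pi * ω * step N : ℝ) : ℂ))
      = ((2 * (Real.pi * ω * step N) : ℝ) : ℂ) * Complex.I := by push_cast; ring
  rw [this, Complex.norm_exp_ofReal_mul_I]

theorem eh_ne_zero (N : ℕ) (ω : ℝ) : eh N ω ≠ 0 := Complex.exp_ne_zero _

theorem eh_pow (β : ℕ) : eh N ω ^ β = Complex.exp (w N ω * β) := by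
  rw [eh, ← Complex.exp_nat_mul, mul_comm]

theorem exp_w_mul (hN : 1 ≤ N) : Complex.exp (w N ω * N) = e1 ω := by
  have h2 : (N : ℂ) ≠ 0 := by exact_mod_cast (by omega : N ≠ 0)
  rw [e1, w, step]
  congr 1
  push_cast
  field_simp

/-- On the unit circle the palindromic coefficients pair z^α with z^{2k-α}; with z^k taken out, each
pair is a cosine. -/
theorem aeval_eulerFrobenius_eq_cos (k : ℕ) (θ : ℝ) :
    Polynomial.aeval (Complex.exp (2 * Complex.I * θ)) (eulerFrobenius (2 * k))
      = Complex.exp (2 * Complex.I * θ) ^ k *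
        ((2 * ∑ α ∈ Finset.range k, ((eulerFrobenius (2 * k)).coeff α : ℝ) *
            Real.cos (2 * θ * ((k : ℝ) - α)) + ((eulerFrobenius (2 * k)).coeff k : ℝ) : ℝ) : ℂ) := by
  set z := Complex.exp (2 * Complex.I * θ) with hz
  set e := (eulerFrobenius (2 * k)).coeff with he
  have hz0 : z ≠ 0 := Complex.exp_ne_zero _
  rw [Polynomial.aeval_eq_sum_range, natDegree_eulerFrobenius]
  have e1 : 2 * k + 1 = k + (k + 1) := by ring
  rw [e1, Finset.sum_range_add, Finset.sum_range_succ' (n := k), ← Finset.sum_range_reflect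
    (fun x => (eulerFrobenius (2 * k)).coeff (k + (x + 1)) • z ^ (k + (x + 1)))]
  rw [← add_assoc, ← Finset.sum_add_distrib]
  push_cast
  rw [mul_add, Finset.mul_sum, Finset.mul_sum]
  congr 1
  · refine Finset.sum_congr rfl fun α hα => ?_
    have hα' : α < k := Finset.mem_range.1 hα
    have e2 : k + (k - 1 - α + 1) = k + (k - α) := by omega
    rw [e2, ← eulerFrobenius_coeff_symm (k := 2 * k) (a := α) (b := k + (k - α)) (by omega)]
    have hcos : 2 * Complex.cos (2 * (θ : ℂ) * ((k : ℂ) - α)) = z ^ (k - α) + (z ^ (k - α))⁻¹ := by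
      rw [Complex.two_cos, hz, ← Complex.exp_nat_mul, ← Complex.exp_neg, Nat.cast_sub hα'.le]
      congr 2 <;> ring
    have h3 : z ^ k * (z ^ (k - α))⁻¹ = z ^ α := by
      have : z ^ k = z ^ α * z ^ (k - α) := by rw [← pow_add]; congr 1; omega
      rw [this, mul_assoc, mul_inv_cancel₀ (pow_ne_zero _ hz0), mul_one]
    rw [zsmul_eq_mul, zsmul_eq_mul, pow_add]
    linear_combination (-(z ^ k * (e α : ℂ))) * hcos - (e α : ℂ) * h3
  · rw [zsmul_eq_mul, add_zero, mul_comm]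

/-- This property determines K: the top moment of K λ^γ balances the top moment of the exponential
in the integral. -/
theorem K_mul_geomMoment {m : ℕ} (hm : 1 ≤ m) (hω : ∀ n : ℤ, ω * step N ≠ n) :
    (K m N ω : ℂ) * geomMoment (2 * m - 1) (eh N ω)
      = ((2 * m - 1).factorial : ℂ) / w N ω ^ (2 * m) := by
  obtain ⟨k, rfl⟩ : ∃ k, m = k + 1 := ⟨m - 1, by omega⟩
  set θ : ℝ := Real.pi * ω * step N with hθ
  have hz1 := eh_ne_one hω
  have hw := w_ne_zero hω
  have hE := eulerFrobenius_ne_zero_of_norm_eq_one hm (norm_eh N ω)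
  have ek : 2 * (k + 1) - 2 = 2 * k := by omega
  have hzθ : eh N ω = Complex.exp (2 * Complex.I * θ) := by rw [eh, w_eq]
  have hEc := aeval_eulerFrobenius_eq_cos k θ
  rw [← hzθ] at hEc
  rw [ek] at hE
  set D : ℝ := 2 * ∑ α ∈ Finset.range k, ((eulerFrobenius (2 * k)).coeff α : ℝ) *
    Real.cos (2 * θ * ((k : ℝ) - α)) + ((eulerFrobenius (2 * k)).coeff k : ℝ) with hD
  have hDK : K (k + 1) N ω
      = (Real.sin θ / θ) ^ (2 * (k + 1)) * ((2 * (k + 1) - 1).factorial : ℝ) / D := by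
    rw [K, hD, ← eulerFrobenius_coeff_eq_efCoeff _ _ hm, ek]
    congr 2
    simp only [Nat.add_sub_cancel]
    congr 1
    refine Finset.sum_congr rfl fun α _ => ?_
    rw [← eulerFrobenius_coeff_eq_efCoeff _ _ hm, ek, hθ]
    congr 2
    push_cast; ring
  have hD0 : (D : ℂ) ≠ 0 := by
    intro h; rw [h, mul_zero] at hEc; exact hE hEc
  have hθ0 : (θ : ℂ) ≠ 0 := by
    intro h; apply hw; rw [w_eq, ← hθ, h, mul_zero]
  set u := Complex.exp (θ * Complex.I) with hu
  have hu0 : u ≠ 0 := Complex.exp_ne_zero _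
  have hzu : eh N ω = u ^ 2 := by
    rw [hzθ, hu, ← Complex.exp_nat_mul]; congr 1; push_cast; ring
  -- The power 2m of this identity yields sin^{2m} θ and a factor λ^m, which cancels λ · λ^{m-1}
  -- from the numerator.
  have hsin : 1 - eh N ω = -(2 * Complex.I) * u * Complex.sin θ := by
    have h2 := Complex.two_sin (θ : ℂ)
    have h3 : Complex.exp (-(θ : ℂ) * Complex.I) = u⁻¹ := by
      rw [hu, ← Complex.exp_neg]; congr 1; ring
    rw [h3, ← hu] at h2
    have hI := Complex.I_mul_I
    have h4 : u * u⁻¹ = 1 := mul_inv_cancel₀ hu0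
    rw [hzu]
    linear_combination (Complex.I * u) * h2 + (u * (u⁻¹ - u)) * hI - h4
  have hpow : (1 - eh N ω) ^ (2 * (k + 1))
      = (2 * Complex.I) ^ (2 * (k + 1)) * eh N ω ^ (k + 1) * Complex.sin θ ^ (2 * (k + 1)) := by
    rw [hsin, hzu, mul_pow, mul_pow, ← pow_mul, Even.neg_pow (even_two_mul (k + 1))]
  have hs0 : Complex.sin (θ : ℂ) ≠ 0 := by
    intro h; rw [h, mul_zero] at hsin; exact hz1 (sub_eq_zero.1 hsin).symm
  have e3 : 2 * (k + 1) - 1 = 2 * k + 1 := by omega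
  have hG : geomMoment (2 * (k + 1) - 1) (eh N ω)
      = D / ((2 * Complex.I) ^ (2 * (k + 1)) * Complex.sin θ ^ (2 * (k + 1))) := by
    rw [e3, geomMoment_succ _ hz1, hEc]
    have : 2 * k + 2 = 2 * (k + 1) := by ring
    rw [this, hpow]
    have := eh_ne_zero N ω
    have := Complex.I_ne_zero
    field_simp
    ring
  rw [hG, hDK, w_eq, ← hθ]
  push_cast
  have := Complex.I_ne_zero
  rw [div_pow]
  field_simp
  ring

end constant

/-! ### The linear system -/

section system

variable {n : ℕ}

/-- The ratios `q_k`, `q_k⁻¹` and `λ` of the geometric sequences in the optimal coefficients. -/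
def ratios (q : Fin n → ℂ) (lam : ℂ) : (Fin n ⊕ Fin n) ⊕ Unit → ℂ :=
  Sum.elim (Sum.elim q fun k => (q k)⁻¹) fun _ => lam

/-- The amplitudes of the geometric sequences in the optimal coefficients. -/
def amplitudes (N : ℕ) (q : Fin n → ℂ) (κ : ℂ) (a b : Fin n → ℂ) :
    (Fin n ⊕ Fin n) ⊕ Unit → ℂ :=
  Sum.elim (Sum.elim a fun k => b k * q k ^ N) fun _ => κ

theorem sum_amplitudes (N : ℕ) (q : Fin n → ℂ) (κ lam : ℂ) (a b : Fin n → ℂ) (F : ℂ → ℂ) :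
    ∑ x, amplitudes N q κ a b x * F (ratios q lam x)
      = ∑ k, a k * F (q k) + ∑ k, b k * q k ^ N * F (q k)⁻¹ + κ * F lam := by
  simp [amplitudes, ratios, Fintype.sum_sum_type]

/-- The moment of order `j` of the left half of the functional, without the node `0`. -/
def leftMoment (N : ℕ) (ω : ℝ) (q : Fin n → ℂ) (κ σ : ℂ) (a b : Fin n → ℂ) (j : ℕ) : ℂ :=
  ∑ x, amplitudes N q κ a b x * geomMoment j (ratios q (eh N ω) x)
    - σ * ((-1) ^ (j + 1) * (j.factorial : ℂ) / w N ω ^ (j + 1))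

/-- The moment of order `j` about `N` of the part of the functional to the right of `N`. -/
def rightMoment (N : ℕ) (ω : ℝ) (q : Fin n → ℂ) (κ σ : ℂ) (a b : Fin n → ℂ) (j : ℕ) : ℂ :=
  ∑ x, amplitudes N q κ a b x * ratios q (eh N ω) x ^ N * geomMoment j (ratios q (eh N ω) x)
    - σ * e1 ω * ((-1) ^ (j + 1) * (j.factorial : ℂ) / w N ω ^ (j + 1))

/-- The difference of the two sides of the second family of equations. -/
def secondDefect (N : ℕ) (ω : ℝ) (q : Fin n → ℂ) (κ σ : ℂ) (a b : Fin n → ℂ) (j : ℕ) : ℂ :=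
  leftMoment N ω q κ σ a b j
    - ∑ α ∈ Finset.Icc 1 j, (N : ℂ) ^ (j - α) * (j.choose α : ℂ) * rightMoment N ω q κ σ a b α

theorem rightMoment_eq {N : ℕ} {ω : ℝ} (hN : 1 ≤ N) {q : Fin n → ℂ} (hq0 : ∀ k, q k ≠ 0)
    (κ σ : ℂ) (a b : Fin n → ℂ) (j : ℕ) :
    rightMoment N ω q κ σ a b j
      = ∑ k, a k * (q k ^ N * geomMoment j (q k)) + ∑ k, b k * geomMoment j (q k)⁻¹
        + κ * (e1 ω * geomMoment j (eh N ω))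
        - σ * e1 ω * ((-1) ^ (j + 1) * (j.factorial : ℂ) / w N ω ^ (j + 1)) := by
  have h := sum_amplitudes N q κ (eh N ω) a b (fun z => z ^ N * geomMoment j z)
  simp only [← mul_assoc] at h
  rw [rightMoment, h, eh_pow, exp_w_mul hN]
  have h2 : ∑ k, b k * q k ^ N * (q k)⁻¹ ^ N * geomMoment j (q k)⁻¹
      = ∑ k, b k * geomMoment j (q k)⁻¹ := by
    refine Finset.sum_congr rfl fun k _ => ?_
    have := hq0 k
    rw [inv_pow]; field_simp
  rw [h2]
  simp only [mul_assoc]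

/-- Every inner sum over t is the expansion of a moment at q_k, 1/q_k or λ, up to elementary
factors, and h^{α-j} = N^{j-α}. The first family is (-1)^{j+1} times the vanishing of the left
moments; the second subtracts right moments shifted by N, without the order 0. -/
theorem isSystemSolution_iff {m N : ℕ} {ω : ℝ} (hN : 1 ≤ N) (hω : ∀ n : ℤ, ω * step N ≠ n)
    {q : Fin (m - 1) → ℂ} (hq0 : ∀ k, q k ≠ 0) (hq1 : ∀ k, q k ≠ 1) (a b : Fin (m - 1) → ℂ) :
    IsSystemSolution m N ω q a b ↔
      (∀ j ∈ Finset.Icc 1 (m - 1), leftMoment N ω q (K m N ω) 1 a b j = 0) ∧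
      (∀ j ∈ Finset.Icc 1 (m - 1), secondDefect N ω q (K m N ω) 1 a b j = 0) := by
  have hl0 := eh_ne_zero N ω
  have hl1 := eh_ne_one hω
  have hw := w_ne_zero hω
  unfold IsSystemSolution
  refine and_congr (forall₂_congr fun j hj => ?_) (forall₂_congr fun j hj => ?_)
  · have hj1 := (Finset.mem_Icc.1 hj).1
    have h1 : ∀ k, ∑ t ∈ Finset.Icc 1 j, q k * diffZero t j / (q k - 1) ^ (t + 1)
        = (-1) ^ (j + 1) * geomMoment j (q k) := fun k => by
      rw [← geomMoment_inv_eq_sum hj1 (hq0 k) (hq1 k), geomMoment_inv hj1 (hq0 k) (hq1 k)]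
    have h2 : ∀ k, ∑ t ∈ Finset.Icc 1 j, q k ^ (N + t) * diffZero t j / (1 - q k) ^ (t + 1)
        = (-1) ^ (j + 1) * (q k ^ N * geomMoment j (q k)⁻¹) := fun k => by
      rw [geomMoment_inv hj1 (hq0 k) (hq1 k), geomMoment_eq_sum hj1 (hq1 k), Finset.mul_sum,
        Finset.mul_sum, Finset.mul_sum]
      refine Finset.sum_congr rfl fun t _ => ?_
      have : (-1 : ℂ) ^ (j + 1) * (-1) ^ (j + 1) = 1 := by rw [← mul_pow]; simp
      rw [pow_add]
      linear_combination (-(q k ^ N * q k ^ t * diffZero t j / (1 - q k) ^ (t + 1))) * this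
    have h3 : ∑ t ∈ Finset.Icc 1 j, eh N ω * K m N ω * diffZero t j / (eh N ω - 1) ^ (t + 1)
        = (-1) ^ (j + 1) * (K m N ω * geomMoment j (eh N ω)) := by
      have := geomMoment_inv hj1 hl0 hl1
      rw [geomMoment_inv_eq_sum hj1 hl0 hl1] at this
      calc _ = K m N ω * ∑ t ∈ Finset.Icc 1 j, eh N ω * diffZero t j / (eh N ω - 1) ^ (t + 1) := by
            rw [Finset.mul_sum]; exact Finset.sum_congr rfl fun t _ => by ring
        _ = _ := by rw [this]; ring
    simp only [h1, h2, h3]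
    rw [leftMoment, sum_amplitudes]
    have e1 : ∑ k, a k * ((-1) ^ (j + 1) * geomMoment j (q k))
        = (-1) ^ (j + 1) * ∑ k, a k * geomMoment j (q k) := by
      rw [Finset.mul_sum]; exact Finset.sum_congr rfl fun k _ => by ring
    have e2 : ∑ k, b k * ((-1) ^ (j + 1) * (q k ^ N * geomMoment j (q k)⁻¹))
        = (-1) ^ (j + 1) * ∑ k, b k * q k ^ N * geomMoment j (q k)⁻¹ := by
      rw [Finset.mul_sum]; exact Finset.sum_congr rfl fun k _ => by ring
    rw [e1, e2]
    have hs : (-1 : ℂ) ^ (j + 1) * (-1) ^ (j + 1) = 1 := by rw [← mul_pow]; simp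
    generalize (-1 : ℂ) ^ (j + 1) = s at *
    constructor
    · intro h
      linear_combination s * h - (∑ k, a k * geomMoment j (q k)
        + ∑ k, b k * q k ^ N * geomMoment j (q k)⁻¹ + K m N ω * geomMoment j (eh N ω)) * hs
    · intro h
      linear_combination s * h + ((j.factorial : ℂ) / w N ω ^ (j + 1)) * hs
  · have hj1 := (Finset.mem_Icc.1 hj).1
    have h2 : ∀ k, ∑ t ∈ Finset.Icc 1 j, q k ^ (N + 1) * diffZero t j / (q k - 1) ^ (t + 1)
        = q k ^ N * geomMoment j (q k)⁻¹ := fun k => by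
      rw [geomMoment_inv_eq_sum hj1 (hq0 k) (hq1 k), Finset.mul_sum]
      exact Finset.sum_congr rfl fun t _ => by rw [pow_succ]; ring
    have h3 : ∀ α ∈ Finset.Icc 1 j, ∀ k,
        ∑ t ∈ Finset.Icc 1 α, q k ^ (N + t) * diffZero t α / (1 - q k) ^ (t + 1)
        = q k ^ N * geomMoment α (q k) := fun α hα k => by
      rw [geomMoment_eq_sum (Finset.mem_Icc.1 hα).1 (hq1 k), Finset.mul_sum]
      exact Finset.sum_congr rfl fun t _ => by rw [pow_add]; ring
    have h4 : ∀ α, 1 ≤ α →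
        ∑ t ∈ Finset.Icc 1 α, (eh N ω / (1 - eh N ω)) ^ t * diffZero t α
        = (1 - eh N ω) * geomMoment α (eh N ω) := fun α hα => by
      rw [geomMoment_eq_sum hα hl1, Finset.mul_sum]
      refine Finset.sum_congr rfl fun t _ => ?_
      have : 1 - eh N ω ≠ 0 := sub_ne_zero.2 hl1.symm
      rw [div_pow, pow_succ]; field_simp
    have hstep : ∀ α ∈ Finset.Icc 1 j, (step N : ℂ) ^ ((α : ℤ) - j) = (N : ℂ) ^ (j - α) := by
      intro α hα
      have hle := (Finset.mem_Icc.1 hα).2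
      have : ((α : ℤ) - j) = -((j - α : ℕ) : ℤ) := by omega
      rw [this, step, zpow_neg, zpow_natCast]
      push_cast
      rw [one_div, inv_pow, inv_inv]
    have hL : ∑ k, a k * ((∑ t ∈ Finset.Icc 1 j, q k ^ t * diffZero t j / (1 - q k) ^ (t + 1))
        - ∑ α ∈ Finset.Icc 1 j, (step N : ℂ) ^ ((α : ℤ) - j) * (j.choose α : ℂ) *
            ∑ t ∈ Finset.Icc 1 α, q k ^ (N + t) * diffZero t α / (1 - q k) ^ (t + 1))
        = ∑ k, a k * geomMoment j (q k) - ∑ α ∈ Finset.Icc 1 j,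
          (N : ℂ) ^ (j - α) * (j.choose α : ℂ) * ∑ k, a k * (q k ^ N * geomMoment α (q k)) := by
      simp only [Finset.mul_sum]
      rw [Finset.sum_comm, ← Finset.sum_sub_distrib]
      refine Finset.sum_congr rfl fun k _ => ?_
      rw [← geomMoment_eq_sum hj1 (hq1 k), mul_sub, Finset.mul_sum]
      congr 1
      refine Finset.sum_congr rfl fun α hα => ?_
      rw [← Finset.mul_sum, h3 α hα k, hstep α hα]; ring
    have hR : ∑ k, b k * ((∑ t ∈ Finset.Icc 1 j, q k ^ (N + 1) * diffZero t j / (q k - 1) ^ (t + 1))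
        - ∑ α ∈ Finset.Icc 1 j, (step N : ℂ) ^ ((α : ℤ) - j) * (j.choose α : ℂ) *
            ∑ t ∈ Finset.Icc 1 α, q k * diffZero t α / (q k - 1) ^ (t + 1))
        = ∑ k, b k * q k ^ N * geomMoment j (q k)⁻¹ - ∑ α ∈ Finset.Icc 1 j,
          (N : ℂ) ^ (j - α) * (j.choose α : ℂ) * ∑ k, b k * geomMoment α (q k)⁻¹ := by
      simp only [Finset.mul_sum]
      rw [Finset.sum_comm, ← Finset.sum_sub_distrib]
      refine Finset.sum_congr rfl fun k _ => ?_
      rw [h2 k, mul_sub, Finset.mul_sum, mul_assoc]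
      congr 1
      refine Finset.sum_congr rfl fun α hα => ?_
      rw [← Finset.mul_sum, ← geomMoment_inv_eq_sum (Finset.mem_Icc.1 hα).1 (hq0 k) (hq1 k),
        hstep α hα]; ring
    have hI : ∑ α ∈ Finset.Icc 1 j, (step N : ℂ) ^ ((α : ℤ) - j) *
          ((-1) ^ α * (Nat.factorial j : ℂ) * e1 ω / ((Nat.factorial (j - α) : ℂ) * w N ω ^ (α + 1)))
        = - ∑ α ∈ Finset.Icc 1 j, (N : ℂ) ^ (j - α) * (j.choose α : ℂ) *
            (e1 ω * ((-1) ^ (α + 1) * (α.factorial : ℂ) / w N ω ^ (α + 1))) := by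
      rw [← Finset.sum_neg_distrib]
      refine Finset.sum_congr rfl fun α hα => ?_
      rw [hstep α hα]
      have hf : (j.choose α : ℂ) * (α.factorial : ℂ) * ((j - α).factorial : ℂ) = j.factorial := by
        exact_mod_cast Nat.choose_mul_factorial_mul_factorial (Finset.mem_Icc.1 hα).2
      have hne : ((j - α).factorial : ℂ) ≠ 0 := Nat.cast_ne_zero.2 (Nat.factorial_ne_zero _)
      rw [← hf, pow_succ (-1 : ℂ)]
      field_simp
    have hK : K m N ω * e1 ω / (1 - eh N ω) *
          ∑ α ∈ Finset.Icc 1 j, (step N : ℂ) ^ ((α : ℤ) - j) * (j.choose α : ℂ) *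
            ∑ t ∈ Finset.Icc 1 α, (eh N ω / (1 - eh N ω)) ^ t * diffZero t α
        = ∑ α ∈ Finset.Icc 1 j, (N : ℂ) ^ (j - α) * (j.choose α : ℂ) *
            (K m N ω * (e1 ω * geomMoment α (eh N ω))) := by
      rw [Finset.mul_sum]
      refine Finset.sum_congr rfl fun α hα => ?_
      rw [hstep α hα, h4 α (Finset.mem_Icc.1 hα).1]
      have : 1 - eh N ω ≠ 0 := sub_ne_zero.2 hl1.symm
      field_simp
    have hK' : K m N ω / (1 - eh N ω) *
        ∑ t ∈ Finset.Icc 1 j, (eh N ω / (1 - eh N ω)) ^ t * diffZero t j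
        = K m N ω * geomMoment j (eh N ω) := by
      rw [h4 j hj1]
      have : 1 - eh N ω ≠ 0 := sub_ne_zero.2 hl1.symm
      field_simp
    rw [hL, hR, hI, hK, hK', secondDefect, leftMoment, sum_amplitudes]
    simp only [rightMoment_eq hN hq0, mul_add, mul_sub, Finset.sum_add_distrib,
      Finset.sum_sub_distrib, one_mul]
    constructor <;> intro h <;> linear_combination h

end system

/-! ### Exactness and the grid condition for the explicit coefficients -/

section coefficients
open Polynomial

variable {n N : ℕ} {ω : ℝ} {q : Fin n → ℂ} {κ σ : ℂ} {a b : Fin n → ℂ}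

/-- The coefficient at the node `0`, divided by `h`. -/
def leftEnd (N : ℕ) (ω : ℝ) (q : Fin n → ℂ) (κ σ : ℂ) (a b : Fin n → ℂ) : ℂ :=
  eh N ω * κ / (eh N ω - 1) - σ / w N ω
    + ∑ k, (a k * (q k / (q k - 1)) + b k * (q k ^ N / (1 - q k)))

/-- The coefficient at the node `1`, divided by `h`. -/
def rightEnd (N : ℕ) (ω : ℝ) (q : Fin n → ℂ) (κ σ : ℂ) (a b : Fin n → ℂ) : ℂ :=
  e1 ω * κ / (1 - eh N ω) + σ * e1 ω / w N ω
    + ∑ k, (a k * (q k ^ N / (1 - q k)) + b k * (q k / (q k - 1)))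

/-- The coefficients, divided by `h`. -/
def coeffSeq (N : ℕ) (ω : ℝ) (q : Fin n → ℂ) (κ σ : ℂ) (a b : Fin n → ℂ) (γ : ℕ) : ℂ :=
  if γ = 0 then leftEnd N ω q κ σ a b
  else if γ = N then rightEnd N ω q κ σ a b
  else ∑ x, amplitudes N q κ a b x * ratios q (eh N ω) x ^ γ

theorem explicitCoeff_eq {m : ℕ} {q a b : Fin (m - 1) → ℂ} (hq0 : ∀ k, q k ≠ 0)
    (β : Fin (N + 1)) :
    explicitCoeff m N ω q a b β = step N * coeffSeq N ω q (K m N ω) 1 a b β := by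
  unfold explicitCoeff coeffSeq
  split_ifs with h1 h2
  · rw [leftEnd]
  · rw [rightEnd, one_mul]
  · congr 1
    have h := sum_amplitudes N q (K m N ω) (eh N ω) a b (fun z => z ^ (β : ℕ))
    rw [h, eh_pow, w, Finset.sum_add_distrib]
    have : ∑ k, b k * q k ^ (N - (β : ℕ)) = ∑ k, b k * q k ^ N * (q k)⁻¹ ^ (β : ℕ) := by
      refine Finset.sum_congr rfl fun k _ => ?_
      have hβ : (β : ℕ) ≤ N := Nat.lt_succ_iff.1 β.2
      rw [inv_pow, mul_assoc, pow_sub₀ _ (hq0 k) hβ]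
    rw [this]
    ring

/-- The formula for C_0 is chosen to make the left functional vanish on constants. -/
theorem sum_geomMoment_zero_add_leftEnd (hω : ∀ n : ℤ, ω * step N ≠ n) (hq0 : ∀ k, q k ≠ 0)
    (hq1 : ∀ k, q k ≠ 1) :
    leftMoment N ω q κ σ a b 0 + leftEnd N ω q κ σ a b = 0 := by
  have hl1 := eh_ne_one hω
  have h1 : (1 - eh N ω) ≠ 0 := sub_ne_zero.2 hl1.symm
  have h2 : (eh N ω - 1) ≠ 0 := sub_ne_zero.2 hl1
  have hA : ∑ k, a k * geomMoment 0 (q k) = - ∑ k, a k * (q k / (q k - 1)) := by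
    rw [← Finset.sum_neg_distrib]
    refine Finset.sum_congr rfl fun k _ => ?_
    rw [geomMoment_zero, ← neg_sub (q k) 1, div_neg]; ring
  have hB : ∑ k, b k * q k ^ N * geomMoment 0 (q k)⁻¹ = - ∑ k, b k * (q k ^ N / (1 - q k)) := by
    rw [← Finset.sum_neg_distrib]
    refine Finset.sum_congr rfl fun k _ => ?_
    have h3 : q k - 1 ≠ 0 := sub_ne_zero.2 (hq1 k)
    have h4 := hq0 k
    have h5 : 1 - (q k)⁻¹ = (q k - 1) / q k := by field_simp
    rw [geomMoment_zero, h5, ← neg_sub (q k) 1, div_neg]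
    field_simp
  have hC : κ * geomMoment 0 (eh N ω) = - (eh N ω * κ / (eh N ω - 1)) := by
    rw [geomMoment_zero, ← neg_sub (eh N ω) 1, div_neg]; ring
  rw [leftMoment, sum_amplitudes, hA, hB, hC, leftEnd, Finset.sum_add_distrib]
  simp
  ring

/-- The formula for C_N plays the same role at the other end: it replaces the interior value at N
and absorbs the right moment of order 0. -/
theorem rightMoment_zero_add (hN : 1 ≤ N) (hω : ∀ n : ℤ, ω * step N ≠ n) (hq0 : ∀ k, q k ≠ 0)
    (hq1 : ∀ k, q k ≠ 1) :
    rightMoment N ω q κ σ a b 0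
      + (∑ x, amplitudes N q κ a b x * ratios q (eh N ω) x ^ N - rightEnd N ω q κ σ a b) = 0 := by
  have hl1 := eh_ne_one hω
  have h1 : (1 - eh N ω) ≠ 0 := sub_ne_zero.2 hl1.symm
  have h := sum_amplitudes N q κ (eh N ω) a b (fun z => z ^ N)
  have hB' : ∑ k, b k * q k ^ N * (q k)⁻¹ ^ N = ∑ k, b k := by
    refine Finset.sum_congr rfl fun k _ => ?_
    have := hq0 k
    rw [inv_pow]; field_simp
  have hA : ∑ k, a k * (q k ^ N / (1 - q k))
      = ∑ k, a k * (q k ^ N * geomMoment 0 (q k)) + ∑ k, a k * q k ^ N := by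
    rw [← Finset.sum_add_distrib]
    refine Finset.sum_congr rfl fun k _ => ?_
    have h3 : 1 - q k ≠ 0 := sub_ne_zero.2 (hq1 k).symm
    rw [geomMoment_zero]; field_simp; ring
  have hB : ∑ k, b k * (q k / (q k - 1)) = ∑ k, b k * geomMoment 0 (q k)⁻¹ + ∑ k, b k := by
    rw [← Finset.sum_add_distrib]
    refine Finset.sum_congr rfl fun k _ => ?_
    have h3 : q k - 1 ≠ 0 := sub_ne_zero.2 (hq1 k)
    have h4 := hq0 k
    have h5 : 1 - (q k)⁻¹ = (q k - 1) / q k := by field_simp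
    rw [geomMoment_zero, h5]; field_simp; ring
  have hC : e1 ω * κ / (1 - eh N ω) = κ * (e1 ω * geomMoment 0 (eh N ω)) + κ * e1 ω := by
    rw [geomMoment_zero]; field_simp; ring
  rw [rightMoment_eq hN hq0, h, hB', eh_pow, exp_w_mul hN, rightEnd, Finset.sum_add_distrib, hA, hB,
    hC]
  simp
  ring

variable (N ω q κ σ a b) in
/-- The functional of the left half of the coefficient sequence. -/
def leftFunctional : ℂ[X] →ₗ[ℂ] ℂ :=
  leftMoments (ratios q (eh N ω)) (amplitudes N q κ a b) σ (w N ω) (leftEnd N ω q κ σ a b)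

theorem leftFunctional_X_pow (j : ℕ) : leftFunctional N ω q κ σ a b (X ^ j)
    = leftMoment N ω q κ σ a b j + leftEnd N ω q κ σ a b * 0 ^ j := by
  rw [leftFunctional, leftMoments_apply, leftMoment]
  simp only [geomSum, laplace, umbral_X_pow, eval_pow, eval_X]
  ring

theorem ratios_ne_one (hω : ∀ n : ℤ, ω * step N ≠ n) (hq1 : ∀ k, q k ≠ 1) (x) :
    ratios q (eh N ω) x ≠ 1 := by
  rcases x with (k | k) | _
  · exact hq1 k
  · simpa [ratios] using hq1 k
  · exact eh_ne_one hω

theorem ratios_ne_zero (hq0 : ∀ k, q k ≠ 0) (x) : ratios q (eh N ω) x ≠ 0 := by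
  rcases x with (k | k) | _
  · exact hq0 k
  · simpa [ratios] using hq0 k
  · exact eh_ne_zero N ω

theorem coeffSeq_of_lt {γ : ℕ} (h1 : 1 ≤ γ) (h2 : γ < N) :
    coeffSeq N ω q κ σ a b γ = ∑ x, amplitudes N q κ a b x * ratios q (eh N ω) x ^ γ := by
  rw [coeffSeq, if_neg (by omega), if_neg (by omega)]

theorem leftFunctional_X_pow_eq_zero (hω : ∀ n : ℤ, ω * step N ≠ n) (hq0 : ∀ k, q k ≠ 0)
    (hq1 : ∀ k, q k ≠ 1)
    (h1 : ∀ j ∈ Finset.Icc 1 n, leftMoment N ω q κ σ a b j = 0) {j : ℕ} (hj : j ≤ n) :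
    leftFunctional N ω q κ σ a b (X ^ j) = 0 := by
  rw [leftFunctional_X_pow]
  rcases Nat.eq_zero_or_pos j with rfl | hj'
  · rw [pow_zero, mul_one]
    exact sum_geomMoment_zero_add_leftEnd hω hq0 hq1
  · rw [h1 j (Finset.mem_Icc.2 ⟨hj', hj⟩), zero_pow (by omega)]; simp

/-- The two families of equations make the quadrature formula exact. -/
theorem integral_sub_sum_coeffSeq (hN : 1 ≤ N) (hω : ∀ n : ℤ, ω * step N ≠ n)
    (hq0 : ∀ k, q k ≠ 0) (hq1 : ∀ k, q k ≠ 1)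
    (h1 : ∀ j ∈ Finset.Icc 1 n, leftMoment N ω q κ σ a b j = 0)
    (h2 : ∀ j ∈ Finset.Icc 1 n, secondDefect N ω q κ σ a b j = 0) {j : ℕ} (hj : j ≤ n) :
    σ * (∫ t in (0 : ℝ)..N, Complex.exp (w N ω * t) * (t : ℂ) ^ j)
      - ∑ γ ∈ Finset.range (N + 1), coeffSeq N ω q κ σ a b γ * (γ : ℂ) ^ j = 0 := by
  have h := functional_eq_leftMoments (ratios q (eh N ω)) (amplitudes N q κ a b) σ (w N ω)
    (leftEnd N ω q κ σ a b) (ratios_ne_one hω hq1) (w_ne_zero hω) hN (coeffSeq N ω q κ σ a b)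
    (by simp [coeffSeq]) (fun γ h1 h2 => coeffSeq_of_lt h1 h2) (X ^ j)
  simp only [eval_pow, eval_X] at h
  have hU := leftFunctional_X_pow_eq_zero hω hq0 hq1 h1 hj
  rw [leftFunctional] at hU
  rw [h, hU, neg_zero, zero_add]
  have hcN : coeffSeq N ω q κ σ a b N = rightEnd N ω q κ σ a b := by
    rw [coeffSeq, if_neg (by omega), if_pos rfl]
  rw [hcN, exp_w_mul hN]
  simp only [taylor_X_pow, geomSum, laplace, umbral_X_add_C_pow]
  have hW : ∑ x, amplitudes N q κ a b x * ratios q (eh N ω) x ^ N *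
        (∑ i ∈ Finset.range (j + 1), (N : ℂ) ^ (j - i) * (j.choose i : ℂ)
          * geomMoment i (ratios q (eh N ω) x))
      - σ * e1 ω * (∑ i ∈ Finset.range (j + 1), (N : ℂ) ^ (j - i) * (j.choose i : ℂ)
          * ((-1) ^ (i + 1) * (i.factorial : ℂ) / w N ω ^ (i + 1)))
      = ∑ i ∈ Finset.range (j + 1), (N : ℂ) ^ (j - i) * (j.choose i : ℂ)
          * rightMoment N ω q κ σ a b i := by
    simp only [Finset.mul_sum]
    rw [Finset.sum_comm, ← Finset.sum_sub_distrib]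
    refine Finset.sum_congr rfl fun i _ => ?_
    rw [rightMoment, mul_sub, Finset.mul_sum]
    congr 1
    · exact Finset.sum_congr rfl fun x _ => by ring
    · ring
  have h0 := rightMoment_zero_add (a := a) (b := b) (κ := κ) (σ := σ) hN hω hq0 hq1
  have hsplit : ∑ i ∈ Finset.range (j + 1), (N : ℂ) ^ (j - i) * (j.choose i : ℂ)
          * rightMoment N ω q κ σ a b i
      = ∑ i ∈ Finset.Icc 1 j, (N : ℂ) ^ (j - i) * (j.choose i : ℂ)
          * rightMoment N ω q κ σ a b i + (N : ℂ) ^ j * rightMoment N ω q κ σ a b 0 := by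
    rw [Finset.sum_range_succ']
    have : Finset.Icc 1 j = Finset.Ico 1 (j + 1) := by ext; simp
    rw [this, Finset.sum_Ico_eq_sum_range]
    simp [add_comm]
  -- Given the first family, the second says exactly this; the missing order 0 is
  -- `rightMoment_zero_add`.
  have hz : ∑ i ∈ Finset.Icc 1 j, (N : ℂ) ^ (j - i) * (j.choose i : ℂ)
          * rightMoment N ω q κ σ a b i = 0 := by
    rcases Nat.eq_zero_or_pos j with rfl | hj'
    · simp
    · have hm := Finset.mem_Icc.2 ⟨hj', hj⟩
      have := h2 j hm
      rw [secondDefect, h1 j hm, zero_sub, neg_eq_zero] at this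
      exact this
  rw [hsplit, hz] at hW
  linear_combination hW + (N : ℂ) ^ j * h0

/-- The amplitudes at q_k and 1/q_k contribute nothing, being at zeros of the moment of order 2m -
1; the term at λ cancels the integral by the choice of K. -/
theorem leftMoment_top_eq_zero {m : ℕ} (hm : 1 ≤ m) {q a b : Fin (m - 1) → ℂ}
    (hq : IsInnerRoots m q) (hω : ∀ n : ℤ, ω * step N ≠ n) (β : ℕ) :
    ∑ x, amplitudes N q (σ * K m N ω) a b x * ratios q (eh N ω) x ^ β
        * geomMoment (2 * m - 1) (ratios q (eh N ω) x) * (-1) ^ (2 * m - 1)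
      + σ * Complex.exp (w N ω * β) * ((2 * m - 1).factorial : ℂ) / w N ω ^ (2 * m - 1 + 1) = 0 := by
  have h := sum_amplitudes N q (σ * K m N ω) (eh N ω) a b
    (fun z => z ^ β * geomMoment (2 * m - 1) z * (-1) ^ (2 * m - 1))
  simp only [← mul_assoc] at h
  have hK := K_mul_geomMoment hm hω
  rw [h]
  simp only [hq.geomMoment_eq_zero, hq.geomMoment_inv_eq_zero]
  have e : 2 * m - 1 + 1 = 2 * m := by omega
  have ho : (-1 : ℂ) ^ (2 * m - 1) = -1 := Odd.neg_one_pow ⟨m - 1, by omega⟩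
  rw [e, ho, ← eh_pow]
  simp only [mul_zero, zero_mul, Finset.sum_const_zero, zero_add]
  linear_combination (-(σ * eh N ω ^ β)) * hK

theorem convolution_coeffSeq {m : ℕ} (hm : 1 ≤ m) {q a b : Fin (m - 1) → ℂ}
    (hq : IsInnerRoots m q) (hω : ∀ n : ℤ, ω * step N ≠ n) {β : ℕ} (hβ : β ≤ N) :
    ∑ γ ∈ Finset.range β,
        coeffSeq N ω q (σ * K m N ω) σ a b γ * ((β : ℂ) - γ) ^ (2 * m - 1)
      - σ * ∫ t in (0 : ℝ)..β, Complex.exp (w N ω * t) * ((β : ℂ) - t) ^ (2 * m - 1)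
      = leftFunctional N ω q (σ * K m N ω) σ a b ((C (β : ℂ) - X) ^ (2 * m - 1)) := by
  have hK := leftMoment_top_eq_zero (N := N) (σ := σ) (a := a) (b := b) hm hq hω
  rcases Nat.eq_zero_or_pos β with rfl | hβ'
  · have h0 := hK 0
    have hneg : ((C ((0 : ℕ) : ℂ) - X : ℂ[X])) ^ (2 * m - 1) = (-X) ^ (2 * m - 1) := by simp
    rw [hneg, leftFunctional, leftMoments_apply]
    simp only [geomSum_neg_X_pow, laplace_neg_X_pow, eval_pow, eval_neg, eval_X, neg_zero]
    rw [zero_pow (by omega)]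
    simp only [pow_zero, mul_one, Nat.cast_zero, mul_zero, Complex.exp_zero] at h0
    have : ∑ x, amplitudes N q (σ * K m N ω) a b x * ((-1) ^ (2 * m - 1)
          * geomMoment (2 * m - 1) (ratios q (eh N ω) x))
        = ∑ x, amplitudes N q (σ * K m N ω) a b x
          * geomMoment (2 * m - 1) (ratios q (eh N ω) x) * (-1) ^ (2 * m - 1) :=
      Finset.sum_congr rfl fun x _ => by ring
    rw [this]
    simp only [Finset.range_zero, Finset.sum_empty, Nat.cast_zero, intervalIntegral.integral_same,
      mul_zero, sub_zero]
    linear_combination (-1) * h0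
  · exact convolution_eq_leftMoments _ _ _ _ _ (ratios_ne_one hω hq.ne_one) (w_ne_zero hω)
      (by omega) hK β hβ' (coeffSeq N ω q (σ * K m N ω) σ a b) (by simp [coeffSeq])
      (fun γ h1 h2 => coeffSeq_of_lt h1 (by omega))

variable (N ω q κ σ a b) in
/-- The polynomial that the convolution with the Green function equals on the grid. -/
def gridPoly (m : ℕ) : ℂ[X] :=
  ∑ i ∈ Finset.range m, C (((2 * m - 1).choose i : ℂ) * (-1) ^ (2 * m - 1 - i)
    * leftFunctional N ω q κ σ a b (X ^ (2 * m - 1 - i))) * X ^ i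

theorem natDegree_gridPoly {m : ℕ} (hm : 1 ≤ m) :
    (gridPoly N ω q κ σ a b m).natDegree ≤ m - 1 := by
  refine natDegree_sum_le_of_forall_le _ _ fun i hi => (natDegree_C_mul_X_pow_le _ _).trans ?_
  have := Finset.mem_range.1 hi
  omega

/-- In the binomial expansion of (β - X)^{2m-1} the power β^i comes with X^{2m-1-i}, and the
functional kills this for i ≥ m. The degree thus drops from 2m - 1 to at most m - 1. -/
theorem leftFunctional_eq_gridPoly {m : ℕ} (hm : 1 ≤ m)
    (h : ∀ j ≤ m - 1, leftFunctional N ω q κ σ a b (X ^ j) = 0) (β : ℂ) :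
    leftFunctional N ω q κ σ a b ((C β - X) ^ (2 * m - 1))
      = (gridPoly N ω q κ σ a b m).eval β := by
  rw [sub_eq_add_neg, add_pow, map_sum, gridPoly, eval_finsetSum]
  have hterm : ∀ i, leftFunctional N ω q κ σ a b
      (C β ^ i * (-X) ^ (2 * m - 1 - i) * ((2 * m - 1).choose i : ℂ[X]))
      = ((2 * m - 1).choose i : ℂ) * (-1) ^ (2 * m - 1 - i)
        * leftFunctional N ω q κ σ a b (X ^ (2 * m - 1 - i)) * β ^ i := by
    intro i
    have : (C β ^ i * (-X) ^ (2 * m - 1 - i) * ((2 * m - 1).choose i : ℂ[X]))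
        = (((2 * m - 1).choose i : ℂ) * (-1) ^ (2 * m - 1 - i) * β ^ i)
          • (X ^ (2 * m - 1 - i) : ℂ[X]) := by
      rw [neg_pow, smul_eq_C_mul]
      simp only [map_mul, map_pow, map_natCast, map_neg, map_one]
      ring
    rw [this, map_smul, smul_eq_mul]; ring
  simp only [hterm, eval_mul, eval_C, eval_pow, eval_X]
  refine (Finset.sum_subset (by intro i hi; simp at hi ⊢; omega) fun i hi hni => ?_).symm
  rw [h _ (by simp at hni; omega)]
  simp

end coefficients

/-! ### Rescaling to the unit interval -/

section rescale

variable {N : ℕ} {ω : ℝ}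

theorem integral_weight_rescale (σ : ℂ) (F : ℝ → ℂ) (β : ℕ) :
    ∫ t in (0 : ℝ)..(step N * β), σ * weight ω t * F t
      = step N * (σ * ∫ s in (0 : ℝ)..β, Complex.exp (w N ω * s) * F (step N * s)) := by
  have h := intervalIntegral.smul_integral_comp_mul_left (a := 0) (b := (β : ℝ))
    (fun t => σ * weight ω t * F t) (step N)
  rw [mul_zero] at h
  rw [← h, ← intervalIntegral.integral_const_mul, Complex.real_smul]
  congr 1
  refine intervalIntegral.integral_congr fun s _ => ?_
  simp only [weight, w]
  have : (2 * Real.pi * Complex.I * ω * ((step N * s : ℝ) : ℂ))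
      = 2 * Real.pi * Complex.I * ω * step N * s := by push_cast; ring
  rw [this]; ring

theorem step_mul_self (hN : 1 ≤ N) : step N * N = 1 := by
  have : (N : ℝ) ≠ 0 := by exact_mod_cast (by omega : N ≠ 0)
  rw [step]; field_simp

theorem step_pos (hN : 1 ≤ N) : 0 < step N := by
  have : (0 : ℝ) < N := by exact_mod_cast hN
  rw [step]; positivity

theorem sum_tpow_node (hN : 1 ≤ N) (c : ℕ → ℂ) {n : ℕ} (β : Fin (N + 1)) :
    ∑ γ : Fin (N + 1), (step N * c γ) * tpow n (node N β - node N γ)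
      = (step N : ℂ) ^ (n + 1) / (n.factorial : ℂ)
        * ∑ γ ∈ Finset.range β, c γ * (((β : ℕ) : ℂ) - γ) ^ n := by
  refine (Fin.sum_univ_eq_sum_range (fun γ => (step N * c γ) *
    tpow n (node N β - step N * (γ : ℝ))) (N + 1)).trans ?_
  rw [← Finset.sum_subset (s₁ := Finset.range β) (by
    intro i hi; simp at hi ⊢; have := β.2; omega)]
  · rw [Finset.mul_sum]
    refine Finset.sum_congr rfl fun γ hγ => ?_
    have hlt : (γ : ℝ) < ((β : ℕ) : ℝ) := by exact_mod_cast Finset.mem_range.1 hγ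
    have hp := step_pos hN
    rw [tpow, if_pos (by rw [node, ← mul_sub]; exact mul_pos hp (sub_pos.2 hlt)), node]
    push_cast
    rw [← mul_sub, mul_pow]; ring
  · intro γ _ hγ
    have hle : ((β : ℕ) : ℝ) ≤ (γ : ℝ) := by simp at hγ; exact_mod_cast hγ
    have hp := step_pos hN
    rw [tpow, if_neg, mul_zero]
    rw [node, ← mul_sub, not_lt]
    exact mul_nonpos_of_nonneg_of_nonpos hp.le (sub_nonpos.2 hle)

theorem killsPoly_of_moments (hN : 1 ≤ N) (σ : ℂ) (c : ℕ → ℂ) (k : ℕ)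
    (h : ∀ j ≤ k, σ * (∫ t in (0 : ℝ)..N, Complex.exp (w N ω * t) * (t : ℂ) ^ j)
      - ∑ γ ∈ Finset.range (N + 1), c γ * (γ : ℂ) ^ j = 0) :
    KillsPoly (fun t => σ * weight ω t) (node N) (fun β => step N * c β) k := by
  intro j hj
  have hint := integral_weight_rescale (N := N) (ω := ω) σ (fun t => (t : ℂ) ^ j) N
  rw [step_mul_self hN] at hint
  have h1 : ∫ s in (0 : ℝ)..N, Complex.exp (w N ω * s) * ((step N * s : ℝ) : ℂ) ^ j
      = (step N : ℂ) ^ j * ∫ s in (0 : ℝ)..N, Complex.exp (w N ω * s) * (s : ℂ) ^ j := by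
    rw [← intervalIntegral.integral_const_mul]
    refine intervalIntegral.integral_congr fun s _ => ?_
    push_cast; ring
  rw [h1] at hint
  rw [quadFunctional, hint]
  have h2 : ∑ β : Fin (N + 1), step N * c β * ((node N β : ℝ) : ℂ) ^ j
      = (step N : ℂ) ^ (j + 1) * ∑ γ ∈ Finset.range (N + 1), c γ * (γ : ℂ) ^ j := by
    rw [Finset.mul_sum, ← Fin.sum_univ_eq_sum_range]
    refine Finset.sum_congr rfl fun β _ => ?_
    rw [node]; push_cast; ring
  rw [h2]
  linear_combination (step N : ℂ) ^ (j + 1) * h j hj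

/-- The Green function is homogeneous of degree 2k + 1, and the quadrature weights and the measure
each carry one more factor h. -/
theorem convolution_node (hN : 1 ≤ N) (σ : ℂ) (c : ℕ → ℂ) (k : ℕ) (β : Fin (N + 1)) :
    primitive^[2 * k + 2] (fun t => σ * weight ω t) (node N β)
      - ∑ γ : Fin (N + 1), (step N * c γ) * tpow (2 * k + 1) (node N β - node N γ)
      = - ((step N : ℂ) ^ (2 * k + 2) / ((2 * k + 1).factorial : ℂ)) *
        (∑ γ ∈ Finset.range β, c γ * (((β : ℕ) : ℂ) - γ) ^ (2 * k + 1)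
          - σ * ∫ t in (0 : ℝ)..(β : ℕ),
              Complex.exp (w N ω * t) * (((β : ℕ) : ℂ) - t) ^ (2 * k + 1)) := by
  have hc : Continuous fun t => σ * weight ω t := continuous_const.mul (continuous_weight ω)
  rw [primitive_iterate_eq hc.locallyIntegrable (2 * k + 1) (node_mem hN β).1, sum_tpow_node hN]
  have h := integral_weight_rescale (N := N) (ω := ω) σ
    (fun t => (((node N β : ℝ) : ℂ) - t) ^ (2 * k + 1) / ((2 * k + 1).factorial : ℂ)) β
  have h1 : ∫ s in (0 : ℝ)..(β : ℕ), Complex.exp (w N ω * s)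
        * ((((node N β : ℝ) : ℂ) - ((step N * s : ℝ) : ℂ)) ^ (2 * k + 1)
          / ((2 * k + 1).factorial : ℂ))
      = (step N : ℂ) ^ (2 * k + 1) / ((2 * k + 1).factorial : ℂ)
        * ∫ s in (0 : ℝ)..(β : ℕ), Complex.exp (w N ω * s) * (((β : ℕ) : ℂ) - s) ^ (2 * k + 1) := by
    rw [← intervalIntegral.integral_const_mul]
    refine intervalIntegral.integral_congr fun s _ => ?_
    simp only [node]
    push_cast
    rw [← mul_sub, mul_pow]; ring
  rw [h1] at h
  have h2 : ∫ t in (0 : ℝ)..(node N β), (((node N β : ℝ) : ℂ) - t) ^ (2 * k + 1)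
        / ((2 * k + 1).factorial : ℂ) * (σ * weight ω t)
      = ∫ t in (0 : ℝ)..(step N * (β : ℕ)), σ * weight ω t
        * ((((node N β : ℝ) : ℂ) - t) ^ (2 * k + 1) / ((2 * k + 1).factorial : ℂ)) :=
    intervalIntegral.integral_congr fun t _ => by ring
  rw [h2, h]
  ring

theorem solvesGrid_of_convolution (hN : 1 ≤ N) (σ : ℂ) (c : ℕ → ℂ) (k : ℕ) (R : Polynomial ℂ)
    (hR : R.natDegree ≤ k)
    (h : ∀ β ≤ N, ∑ γ ∈ Finset.range β, c γ * ((β : ℂ) - γ) ^ (2 * k + 1)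
      - σ * ∫ t in (0 : ℝ)..β, Complex.exp (w N ω * t) * ((β : ℂ) - t) ^ (2 * k + 1)
      = R.eval (β : ℂ)) :
    SolvesGrid (fun t => σ * weight ω t) (node N) (fun β => step N * c β) k := by
  -- `R` is a polynomial in the index β, and β = Nx at the node x.
  refine ⟨Polynomial.C (-((step N : ℂ) ^ (2 * k + 2) / ((2 * k + 1).factorial : ℂ)))
    * R.comp (Polynomial.C (N : ℂ) * Polynomial.X), ?_, fun β => ?_⟩
  · refine (Polynomial.natDegree_C_mul_le _ _).trans (Polynomial.natDegree_comp_le.trans ?_)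
    calc R.natDegree * (Polynomial.C (N : ℂ) * Polynomial.X).natDegree
        ≤ k * 1 := Nat.mul_le_mul hR
          ((Polynomial.natDegree_C_mul_le _ _).trans Polynomial.natDegree_X_le)
      _ = k := mul_one k
  · rw [convolution_node hN, h β (Nat.lt_succ_iff.1 β.2)]
    simp only [Polynomial.eval_mul, Polynomial.eval_C, Polynomial.eval_comp, Polynomial.eval_X]
    congr 2
    have := step_mul_self hN
    rw [node]
    have h2 : ((step N : ℝ) : ℂ) * (N : ℂ) = 1 := by exact_mod_cast this
    push_cast
    linear_combination (-((β : ℕ) : ℂ)) * h2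

end rescale

/-! ### Unique solvability of the linear system -/

section solvability
open Polynomial

section linear

variable {n N : ℕ} {ω : ℝ} {q : Fin n → ℂ}

/-- The moments are linear in (κ, σ, a, b) jointly. The parameter σ scales the weight: σ = 1 is the
problem itself, σ = 0 the homogeneous one. -/
theorem amplitudes_add_smul (c κ κ' : ℂ) (a a' b b' : Fin n → ℂ) (x) :
    amplitudes N q (κ + c * κ') (a + c • a') (b + c • b') x
      = amplitudes N q κ a b x + c * amplitudes N q κ' a' b' x := by
  rcases x with (k | k) | _ <;> simp [amplitudes]
  ring

theorem leftMoment_add_smul (c κ κ' σ σ' : ℂ) (a a' b b' : Fin n → ℂ) (j : ℕ) :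
    leftMoment N ω q (κ + c * κ') (σ + c * σ') (a + c • a') (b + c • b') j
      = leftMoment N ω q κ σ a b j + c * leftMoment N ω q κ' σ' a' b' j := by
  simp only [leftMoment, amplitudes_add_smul, add_mul, Finset.sum_add_distrib, mul_assoc,
    ← Finset.mul_sum]
  ring

theorem rightMoment_add_smul (c κ κ' σ σ' : ℂ) (a a' b b' : Fin n → ℂ) (j : ℕ) :
    rightMoment N ω q (κ + c * κ') (σ + c * σ') (a + c • a') (b + c • b') j
      = rightMoment N ω q κ σ a b j + c * rightMoment N ω q κ' σ' a' b' j := by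
  simp only [rightMoment, amplitudes_add_smul, add_mul, Finset.sum_add_distrib, mul_assoc,
    ← Finset.mul_sum]
  ring

theorem secondDefect_add_smul (c κ κ' σ σ' : ℂ) (a a' b b' : Fin n → ℂ) (j : ℕ) :
    secondDefect N ω q (κ + c * κ') (σ + c * σ') (a + c • a') (b + c • b') j
      = secondDefect N ω q κ σ a b j + c * secondDefect N ω q κ' σ' a' b' j := by
  simp only [secondDefect, leftMoment_add_smul, rightMoment_add_smul, mul_add,
    Finset.sum_add_distrib]
  have : ∑ α ∈ Finset.Icc 1 j, (N : ℂ) ^ (j - α) * (j.choose α : ℂ)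
        * (c * rightMoment N ω q κ' σ' a' b' α)
      = c * ∑ α ∈ Finset.Icc 1 j, (N : ℂ) ^ (j - α) * (j.choose α : ℂ)
        * rightMoment N ω q κ' σ' a' b' α := by
    rw [Finset.mul_sum]; exact Finset.sum_congr rfl fun α _ => by ring
  rw [this]
  ring

variable (N ω q) in
/-- The matrix of the linear system, as a linear map. -/
def systemMap : (Fin n → ℂ) × (Fin n → ℂ) →ₗ[ℂ] (Fin n → ℂ) × (Fin n → ℂ) :=
  IsLinearMap.mk' (fun ab => (fun i => leftMoment N ω q 0 0 ab.1 ab.2 (i + 1),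
      fun i => secondDefect N ω q 0 0 ab.1 ab.2 (i + 1))) (by
    constructor
    · intro x y
      ext i
      · simpa using leftMoment_add_smul (N := N) (ω := ω) (q := q) 1 0 0 0 0 x.1 y.1 x.2 y.2 (i + 1)
      · simpa using
          secondDefect_add_smul (N := N) (ω := ω) (q := q) 1 0 0 0 0 x.1 y.1 x.2 y.2 (i + 1)
    · intro c x
      have hl (j : ℕ) : leftMoment N ω q 0 0 0 0 j = 0 := by
        have := leftMoment_add_smul (N := N) (ω := ω) (q := q) 1 0 0 0 0 0 0 0 0 j
        simpa using this
      have hs (j : ℕ) : secondDefect N ω q 0 0 0 0 j = 0 := by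
        have := secondDefect_add_smul (N := N) (ω := ω) (q := q) 1 0 0 0 0 0 0 0 0 j
        simpa using this
      ext i
      · simpa [hl] using
          leftMoment_add_smul (N := N) (ω := ω) (q := q) c 0 0 0 0 0 x.1 0 x.2 (i + 1)
      · simpa [hs] using
          secondDefect_add_smul (N := N) (ω := ω) (q := q) c 0 0 0 0 0 x.1 0 x.2 (i + 1))

theorem forall_Icc_iff_forall_fin {p : ℕ → Prop} :
    (∀ j ∈ Finset.Icc 1 n, p j) ↔ ∀ i : Fin n, p (i + 1) := by
  constructor
  · exact fun h i => h _ (Finset.mem_Icc.2 ⟨by omega, i.2⟩)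
  · intro h j hj
    obtain ⟨h1, h2⟩ := Finset.mem_Icc.1 hj
    have := h ⟨j - 1, by omega⟩
    rwa [show ((⟨j - 1, by omega⟩ : Fin n) : ℕ) + 1 = j from Nat.sub_add_cancel h1] at this

theorem systemMap_eq_zero_iff (ab : (Fin n → ℂ) × (Fin n → ℂ)) :
    systemMap N ω q ab = 0 ↔
      (∀ j ∈ Finset.Icc 1 n, leftMoment N ω q 0 0 ab.1 ab.2 j = 0) ∧
      (∀ j ∈ Finset.Icc 1 n, secondDefect N ω q 0 0 ab.1 ab.2 j = 0) := by
  rw [forall_Icc_iff_forall_fin, forall_Icc_iff_forall_fin, Prod.ext_iff, funext_iff, funext_iff]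
  rfl

theorem existsUnique_of_injective (h : Function.Injective (systemMap N ω q)) (κ σ : ℂ) :
    ∃! ab : (Fin n → ℂ) × (Fin n → ℂ),
      (∀ j ∈ Finset.Icc 1 n, leftMoment N ω q κ σ ab.1 ab.2 j = 0) ∧
      (∀ j ∈ Finset.Icc 1 n, secondDefect N ω q κ σ ab.1 ab.2 j = 0) := by
  have hb : Function.Bijective (systemMap N ω q) := ⟨h, LinearMap.injective_iff_surjective.1 h⟩
  have hiff : ∀ ab : (Fin n → ℂ) × (Fin n → ℂ),
      ((∀ j ∈ Finset.Icc 1 n, leftMoment N ω q κ σ ab.1 ab.2 j = 0) ∧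
        (∀ j ∈ Finset.Icc 1 n, secondDefect N ω q κ σ ab.1 ab.2 j = 0)) ↔
      systemMap N ω q ab = -(fun i : Fin n => leftMoment N ω q κ σ 0 0 (i + 1),
        fun i : Fin n => secondDefect N ω q κ σ 0 0 (i + 1)) := by
    intro ab
    rw [forall_Icc_iff_forall_fin, forall_Icc_iff_forall_fin, Prod.ext_iff, funext_iff, funext_iff]
    refine and_congr (forall_congr' fun i => ?_) (forall_congr' fun i => ?_)
    · have := leftMoment_add_smul (N := N) (ω := ω) (q := q) 1 0 κ 0 σ ab.1 0 ab.2 0 (i + 1)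
      simp only [zero_add, one_mul, smul_zero, add_zero] at this
      rw [this]
      exact add_eq_zero_iff_eq_neg
    · have := secondDefect_add_smul (N := N) (ω := ω) (q := q) 1 0 κ 0 σ ab.1 0 ab.2 0 (i + 1)
      simp only [zero_add, one_mul, smul_zero, add_zero] at this
      rw [this]
      exact add_eq_zero_iff_eq_neg
  simp only [hiff]
  exact hb.existsUnique _

end linear

variable {m N : ℕ} {ω : ℝ} {q : Fin (m - 1) → ℂ} {σ : ℂ} {a b : Fin (m - 1) → ℂ}

theorem killsPoly_coeffSeq (hN : 1 ≤ N) (hω : ∀ n : ℤ, ω * step N ≠ n) (hq : IsInnerRoots m q)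
    (h1 : ∀ j ∈ Finset.Icc 1 (m - 1), leftMoment N ω q (σ * K m N ω) σ a b j = 0)
    (h2 : ∀ j ∈ Finset.Icc 1 (m - 1), secondDefect N ω q (σ * K m N ω) σ a b j = 0) :
    KillsPoly (fun t => σ * weight ω t) (node N)
      (fun β => step N * coeffSeq N ω q (σ * K m N ω) σ a b β) (m - 1) :=
  killsPoly_of_moments hN σ _ _ fun _ hj =>
    integral_sub_sum_coeffSeq hN hω hq.ne_zero hq.ne_one h1 h2 hj

theorem solvesGrid_coeffSeq (hm : 1 ≤ m) (hN : 1 ≤ N) (hω : ∀ n : ℤ, ω * step N ≠ n)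
    (hq : IsInnerRoots m q)
    (h1 : ∀ j ∈ Finset.Icc 1 (m - 1), leftMoment N ω q (σ * K m N ω) σ a b j = 0) :
    SolvesGrid (fun t => σ * weight ω t) (node N)
      (fun β => step N * coeffSeq N ω q (σ * K m N ω) σ a b β) (m - 1) := by
  refine solvesGrid_of_convolution hN σ _ _ (gridPoly N ω q (σ * K m N ω) σ a b m)
    (natDegree_gridPoly hm) fun β hβ => ?_
  rw [show 2 * (m - 1) + 1 = 2 * m - 1 by omega, convolution_coeffSeq hm hq hω hβ,
    leftFunctional_eq_gridPoly hm fun j hj =>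
      leftFunctional_X_pow_eq_zero hω hq.ne_zero hq.ne_one h1 hj]

/-- With σ = 0 the general construction yields an exact rule for the weight 0 that meets the grid
condition; such a rule is trivial. -/
theorem coeffSeq_eq_zero_of_homogeneous (hm : 1 ≤ m) (hN : 1 ≤ N)
    (hω : ∀ n : ℤ, ω * step N ≠ n) (hq : IsInnerRoots m q)
    (h1 : ∀ j ∈ Finset.Icc 1 (m - 1), leftMoment N ω q 0 0 a b j = 0)
    (h2 : ∀ j ∈ Finset.Icc 1 (m - 1), secondDefect N ω q 0 0 a b j = 0) {β : ℕ} (hβ : β ≤ N) :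
    coeffSeq N ω q 0 0 a b β = 0 := by
  have e : (fun t => (0 : ℂ) * weight ω t) = 0 := by ext t; simp
  have hk := killsPoly_coeffSeq hN hω hq (σ := 0) (by rwa [zero_mul]) (by rwa [zero_mul])
  have hs := solvesGrid_coeffSeq hm hN hω hq (σ := 0) (by rwa [zero_mul])
  rw [e, zero_mul] at hk hs
  have h := congrFun (eq_zero_of_solvesGrid (node_mem hN) (node_injective hN) hk hs)
    ⟨β, Nat.lt_succ_of_le hβ⟩
  exact (mul_eq_zero.1 h).resolve_left (Complex.ofReal_ne_zero.2 (step_pos hN).ne')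

/-- The place where N + 1 ≥ m enters: a polynomial of degree at most m - 1 vanishes at N + 1 points.
-/
theorem gridPoly_eq_zero_of_homogeneous (hm : 1 ≤ m) (hmN : m ≤ N + 1)
    (hω : ∀ n : ℤ, ω * step N ≠ n) (hq : IsInnerRoots m q)
    (h1 : ∀ j ∈ Finset.Icc 1 (m - 1), leftMoment N ω q 0 0 a b j = 0)
    (hc : ∀ β ≤ N, coeffSeq N ω q 0 0 a b β = 0) : gridPoly N ω q 0 0 a b m = 0 := by
  refine eq_zero_of_natDegree_lt_card_of_eval_eq_zero (gridPoly N ω q 0 0 a b m)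
    (ι := Fin (N + 1)) (f := fun β => ((β : ℕ) : ℂ))
    (fun x y h => Fin.ext (Nat.cast_injective (R := ℂ) h)) (fun β => ?_) ?_
  · have hβ : (β : ℕ) ≤ N := Nat.lt_succ_iff.1 β.2
    have h := convolution_coeffSeq (N := N) (σ := 0) (a := a) (b := b) hm hq hω hβ
    rw [zero_mul] at h
    rw [← leftFunctional_eq_gridPoly hm (fun j hj =>
      leftFunctional_X_pow_eq_zero hω hq.ne_zero hq.ne_one h1 hj), ← h, zero_mul, sub_zero]
    refine Finset.sum_eq_zero fun γ hγ => ?_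
    rw [hc γ (by have := Finset.mem_range.1 hγ; omega), zero_mul]
  · have := natDegree_gridPoly (N := N) (ω := ω) (q := q) (κ := 0) (σ := 0) (a := a) (b := b) hm
    rw [Fintype.card_fin]
    omega

/-- Orders j ≥ m are read off from the coefficients of the grid polynomial, lower ones from the
equations. -/
theorem leftFunctional_X_pow_eq_zero_of_homogeneous (hm : 1 ≤ m) (hω : ∀ n : ℤ, ω * step N ≠ n)
    (hq : IsInnerRoots m q)
    (h1 : ∀ j ∈ Finset.Icc 1 (m - 1), leftMoment N ω q 0 0 a b j = 0)
    (hg : gridPoly N ω q 0 0 a b m = 0) {j : ℕ} (hj : j < 2 * m) :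
    leftFunctional N ω q 0 0 a b (X ^ j) = 0 := by
  rcases Nat.lt_or_ge (m - 1) j with h | h
  · have hi : 2 * m - 1 - j ∈ Finset.range m := Finset.mem_range.2 (by omega)
    have hcoeff : (gridPoly N ω q 0 0 a b m).coeff (2 * m - 1 - j) = 0 := by rw [hg, coeff_zero]
    rw [gridPoly, finsetSum_coeff] at hcoeff
    simp only [coeff_C_mul, coeff_X_pow, mul_ite, mul_one, mul_zero] at hcoeff
    rw [Finset.sum_ite_eq, if_pos hi, show 2 * m - 1 - (2 * m - 1 - j) = j by omega] at hcoeff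
    refine (mul_eq_zero.1 hcoeff).resolve_left (mul_ne_zero ?_ (pow_ne_zero _ (by norm_num)))
    exact Nat.cast_ne_zero.2 (Nat.choose_pos (Nat.sub_le _ _)).ne'
  · exact leftFunctional_X_pow_eq_zero hω hq.ne_zero hq.ne_one h1 h

/-- The three groups have modulus below, above and equal to 1. -/
theorem ratios_injective (hq : IsInnerRoots m q) :
    Function.Injective (ratios q (eh N ω)) := by
  have hinv : ∀ k, 1 < ‖(q k)⁻¹‖ := fun k => by
    rw [norm_inv]
    exact (one_lt_inv₀ (norm_pos_iff.2 (hq.ne_zero k))).2 (hq.norm_lt_one k)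
  have hlt := hq.norm_lt_one
  have hone := norm_eh N ω
  refine Function.Injective.sumElim (Function.Injective.sumElim hq.1
    (inv_injective.comp hq.1) fun k l h => ?_) (Function.injective_of_subsingleton _) ?_
  · have := hlt k; have := hinv l; rw [h] at *; linarith
  · rintro (k | k) _ h
    · have := hlt k; simp only [Sum.elim_inl] at h; rw [h] at this; linarith
    · have := hinv k; simp only [Sum.elim_inr] at h; rw [h] at this; linarith

theorem systemMap_injective (hm : 1 ≤ m) (hN : 1 ≤ N) (hmN : m ≤ N + 1)
    (hω : ∀ n : ℤ, ω * step N ≠ n) (hq : IsInnerRoots m q) :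
    Function.Injective (systemMap N ω q) := by
  rw [← LinearMap.ker_eq_bot, LinearMap.ker_eq_bot']
  rintro ⟨a, b⟩ hab
  obtain ⟨h1, h2⟩ := (systemMap_eq_zero_iff _).1 hab
  have hc : ∀ β ≤ N, coeffSeq N ω q 0 0 a b β = 0 := fun β hβ =>
    coeffSeq_eq_zero_of_homogeneous hm hN hω hq h1 h2 hβ
  have hg := gridPoly_eq_zero_of_homogeneous hm hmN hω hq h1 hc
  have hleft : leftEnd N ω q 0 0 a b = 0 := by simpa [coeffSeq] using hc 0 (Nat.zero_le _)
  -- There are 2m - 1 ratios and 2m vanishing moments. Order 0 needs the coefficient at the node 0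
  -- to vanish, which is `hleft`.
  have hamp := eq_zero_of_sum_geomMoment_eq_zero (ratios q (eh N ω)) (amplitudes N q 0 a b)
    (ratios_injective hq) (ratios_ne_zero hq.ne_zero) (ratios_ne_one hω hq.ne_one) (2 * m)
    (by simp; omega) fun j hj => by
      have h := leftFunctional_X_pow_eq_zero_of_homogeneous hm hω hq h1 hg hj
      rw [leftFunctional_X_pow, hleft] at h
      simpa [leftMoment] using h
  refine Prod.ext (funext fun k => ?_) (funext fun k => ?_)
  · exact hamp (Sum.inl (Sum.inl k))
  · exact (mul_eq_zero.1 (hamp (Sum.inl (Sum.inr k)))).resolve_right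
      (pow_ne_zero _ (hq.ne_zero k))

theorem isSardOptimal_iff_eq_explicitCoeff (hm : 1 ≤ m) (hN : 1 ≤ N)
    (hω : ∀ n : ℤ, ω * step N ≠ n) (hq : IsInnerRoots m q) (h : IsSystemSolution m N ω q a b)
    (C : Fin (N + 1) → ℂ) :
    IsSardOptimal m N ω C ↔ C = explicitCoeff m N ω q a b := by
  obtain ⟨h1, h2⟩ := (isSystemSolution_iff hN hω hq.ne_zero hq.ne_one a b).1 h
  rw [← one_mul (K m N ω : ℂ)] at h1 h2
  have hk := killsPoly_coeffSeq hN hω hq h1 h2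
  have hs := solvesGrid_coeffSeq hm hN hω hq h1
  simp only [one_mul] at hk hs
  have e : explicitCoeff m N ω q a b
      = fun β : Fin (N + 1) => step N * coeffSeq N ω q (K m N ω) 1 a b β :=
    funext fun β => explicitCoeff_eq hq.ne_zero β
  have hopt := isSardOptimal_iff hN (isExact_iff.2 hk) hs C
  rwa [Nat.sub_add_cancel hm, ← e] at hopt

end solvability
end
end SardFourier

theorem theorem6 (m N : ℕ) (hm : 1 ≤ m) (hN : 1 ≤ N) (hmN : m ≤ N + 1) (ω : ℝ)
    (hω : ∀ n : ℤ, ω * SardFourier.step N ≠ n) :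
    (∀ α ≤ 2 * m - 2,
      (SardFourier.eulerFrobenius (2 * m - 2)).coeff α = SardFourier.efCoeff m α) ∧
    (SardFourier.eulerFrobenius (2 * m - 2)).natDegree = 2 * m - 2 ∧
    (∃ q : Fin (m - 1) → ℂ, SardFourier.IsInnerRoots m q) ∧
    ∀ q : Fin (m - 1) → ℂ, SardFourier.IsInnerRoots m q →
      (∃! ab : (Fin (m - 1) → ℂ) × (Fin (m - 1) → ℂ),
        SardFourier.IsSystemSolution m N ω q ab.1 ab.2) ∧
      ∀ a b : Fin (m - 1) → ℂ, SardFourier.IsSystemSolution m N ω q a b →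
        ∀ C : Fin (N + 1) → ℂ, SardFourier.IsSardOptimal m N ω C ↔
          C = SardFourier.explicitCoeff m N ω q a b := by
  refine ⟨fun α _ => SardFourier.eulerFrobenius_coeff_eq_efCoeff m α hm,
    SardFourier.natDegree_eulerFrobenius _, SardFourier.exists_isInnerRoots m hm,
    fun q hq => ⟨?_, fun a b h C =>
      SardFourier.isSardOptimal_iff_eq_explicitCoeff hm hN hω hq h C⟩⟩
  simp only [SardFourier.isSystemSolution_iff hN hω hq.ne_zero hq.ne_one]
  exact SardFourier.existsUnique_of_injective
    (SardFourier.systemMap_injective hm hN hmN hω hq) _ _
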